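/- For each $z\in\mathbb{C}$ there is a probability measure $\mu_z$ on $\mathbb{R}$, depending on $z$ only, such that the following holds. For every $n$ let $A_n=(x^{(n)}_{ij})_{1\le i,j\le n}$ be a random $n\times n$ complex matrix whose rows are independent and identically distributed, with an arbitrary law $\nu_n$ on $\mathbb{C}^n$; all $A_n$ are defined on one probability space (with any joint law). Assume: (A1) for every $k\in\mathbb{N}$, $\sup_n\max_{1\le i,j\le n}\mathbb{E}\,|x^{(n)}_{ij}|^k<\infty$; (A2) for every $k\in\mathbb{N}$, $$\sum\Bigl|\mathbb{E}\Bigl[\prod_{l=1}^{k}x^{(n)}_{i_lj_l}\prod_{l=k+1}^{2k}\overline{x^{(n)}_{i_lj_l}}\Bigr]\Bigr|=o(n^{k+1})\qquad(n\to\infty),$$ where the sum runs over all $(i_1,\dots,i_{2k}),(j_1,\dots,j_{2k})\in\{1,\dots,n\}^{2k}$ such that some pair $(i,j)$ occurs exactly once among $(i_1,j_1),\dots,(i_{2k},j_{2k})$; that is, the sum of the absolute values of those entries of $\mathbb{E}[A_n^{\otimes k}\otimes\overline{A_n}^{\otimes k}]$ in which at least one matrix entry appears with power exactly one; (A3) for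 every $\varepsilon>0$, $$\lim_{n\to\infty}\frac1n\sum_{i=1}^n\mathbb{P}\Bigl(\Bigl|\frac1n\sum_{j=1}^n|x^{(n)}_{ij}|^2-1\Bigr|\ge\varepsilon\Bigr)=0\quad\text{and}\quad\lim_{n\to\infty}\frac1n\sum_{j=1}^n\mathbb{P}\Bigl(\Bigl|\frac1n\sum_{i=1}^n|x^{(n)}_{ij}|^2-1\Bigr|\ge\varepsilon\Bigr)=0.$$ For $z\in\mathbb{C}$ put $H_n(z)=\bigl(\tfrac1{\sqrt n}A_n-zI\bigr)\bigl(\tfrac1{\sqrt n}A_n-zI\bigr)^*$ and let $L_n(z)=\frac1n\sum_{m=1}^n\delta_{\lambda_m(H_n(z))}$ be its spectral measure, where $\lambda_1(H_n(z)),\dots,\lambda_n(H_n(z))$ are the eigenvalues of $H_n(z)$ counted with multiplicity. Then for every $z\in\mathbb{C}$, almost surely, $L_n(z)$ converges weakly to $\mu_z$ as $n\to\infty$. In particular the limit is non-random and does not depend on the laws $\nu_n$. -/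

import Mathlib

open MeasureTheory ProbabilityTheory Filter Topology Asymptotics
open scoped Matrix ComplexConjugate

noncomputable section

namespace RowDependent

variable {Ω : Type*} [MeasurableSpace Ω]

/-- A random `n × n` matrix whose rows are independent and all have law `ν`. -/
structure HasIIDRows {n : ℕ} (M : Ω → Matrix (Fin n) (Fin n) ℂ)
    (ν : Measure (Fin n → ℂ)) (P : Measure Ω) : Prop where
  hasLaw : ∀ i, HasLaw (fun ω => M ω i) ν P
  indep : iIndepFun (fun i ω => M ω i) P

/-- The entries of the `2k`-fold moment tensor `E[M^{⊗k} ⊗ (conj M)^{⊗k}]`, indexed by the tuples of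
row indices and of column indices. For real entries this is `E[M^{⊗2k}]`. -/
def momentTensor {n : ℕ} (P : Measure Ω) (M : Ω → Matrix (Fin n) (Fin n) ℂ) (k : ℕ) :
    Matrix (Fin k ⊕ Fin k → Fin n) (Fin k ⊕ Fin k → Fin n) ℂ :=
  Matrix.of fun r c =>
    ∫ ω, (∏ l, M ω (r (Sum.inl l)) (c (Sum.inl l))) *
      ∏ l, conj (M ω (r (Sum.inr l)) (c (Sum.inr l))) ∂P

/-- Some matrix position `(i, j)` occurs exactly once in the list of positions `(r l, c l)`. -/
def HasSimpleFactor {n : ℕ} {ι : Type*} (r c : ι → Fin n) : Prop :=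
  ∃ l, ∀ l', (r l', c l') = (r l, c l) → l' = l

open Classical in
/-- The sum of the sizes of all terms of the `2k`-th moment tensor in which at least one matrix entry
appears with power exactly one. -/
def simpleMomentSum {n : ℕ} (P : Measure Ω) (M : Ω → Matrix (Fin n) (Fin n) ℂ) (k : ℕ) : ℝ :=
  ∑ r : Fin k ⊕ Fin k → Fin n, ∑ c : Fin k ⊕ Fin k → Fin n,
    if HasSimpleFactor r c then ‖momentTensor P M k r c‖ else 0

/-- (A1): for each order, the absolute moments of the entries are uniformly bounded. -/
def AssumptionA1 (P : Measure Ω) (A : (n : ℕ) → Ω → Matrix (Fin n) (Fin n) ℂ) : Prop :=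
  ∀ k : ℕ, ⨆ n, ⨆ i, ⨆ j, ∫⁻ ω, ‖A n ω i j‖ₑ ^ k ∂P < ⊤

/-- (A2): the terms of the `2k`-th moment tensor with an entry of power one add up to
`o(n ^ (k + 1))`. -/
def AssumptionA2 (P : Measure Ω) (A : (n : ℕ) → Ω → Matrix (Fin n) (Fin n) ℂ) : Prop :=
  ∀ k : ℕ, (fun n => simpleMomentSum P (A n) k) =o[atTop] fun n : ℕ => (n : ℝ) ^ (k + 1)

/-- (A3): on average over the rows (the columns), the normalized squared Euclidean norm of a row
(of a column) converges to one in probability. -/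
def AssumptionA3 (P : Measure Ω) (A : (n : ℕ) → Ω → Matrix (Fin n) (Fin n) ℂ) : Prop :=
  ∀ ε : ℝ, 0 < ε →
    Tendsto (fun n : ℕ => (1 / (n : ℝ)) *
      ∑ i, P.real {ω | ε ≤ |(1 / (n : ℝ)) * ∑ j, ‖A n ω i j‖ ^ 2 - 1|}) atTop (𝓝 0) ∧
    Tendsto (fun n : ℕ => (1 / (n : ℝ)) *
      ∑ j, P.real {ω | ε ≤ |(1 / (n : ℝ)) * ∑ i, ‖A n ω i j‖ ^ 2 - 1|}) atTop (𝓝 0)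

/-- The shifted matrix `n^{-1/2} M - z I`. -/
def shifted {n : ℕ} (M : Matrix (Fin n) (Fin n) ℂ) (z : ℂ) : Matrix (Fin n) (Fin n) ℂ :=
  (((1 / Real.sqrt n : ℝ) : ℂ)) • M - z • (1 : Matrix (Fin n) (Fin n) ℂ)

/-- `H(z) = (n^{-1/2} M - z I) (n^{-1/2} M - z I)^*`. -/
def hermitization {n : ℕ} (M : Matrix (Fin n) (Fin n) ℂ) (z : ℂ) : Matrix (Fin n) (Fin n) ℂ :=
  shifted M z * (shifted M z)ᴴ

theorem isHermitian_hermitization {n : ℕ} (M : Matrix (Fin n) (Fin n) ℂ) (z : ℂ) :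
    (hermitization M z).IsHermitian :=
  Matrix.isHermitian_mul_conjTranspose_self _

/-- The spectral measure of a Hermitian matrix: mass `1 / n` at each eigenvalue, counted with
multiplicity. A probability measure when `n` is positive. -/
def spectralMeasure {n : ℕ} {H : Matrix (Fin n) (Fin n) ℂ} (hH : H.IsHermitian) :
    FiniteMeasure ℝ :=
  (n : NNReal)⁻¹ • ∑ i, (diracProba (hH.eigenvalues i)).toFiniteMeasure

end RowDependent

end

/-! The proof is the moment method followed by a concentration argument. Fix `z`. After expanding
the shift, the trace of `H_n(z) ^ k` is a combination of normalized traces of words in `n^{-1/2}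
A_n` and its adjoint. The trace of a word of length `m` is a sum over closed walks of `m` steps on
`n` vertices, each step contributing a matrix entry or a conjugated one.

Walks that use some position exactly once are negligible by (A2). That assumption speaks of moments
with as many plain as conjugated factors, while words are arbitrary. But the product of a monomial
and the conjugate of another one is always of that kind, and if the two share no row its expectation
factors. Exchangeability of the rows moves almost every pair of monomials into this position, so the
square of the wanted sum is bounded by the sum in (A2) (`HasIIDRows.sq_sum_simpleRowSum_le`).

In the other walks every position occurs at least twice. Such a walk has at most `m / 2 + 1`
vertices, and in the case of equality it runs along each edge of a tree once with a letter and once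
with a star (`treeWalk_of_forall_count`). Walks with fewer vertices vanish in the normalization, by
(A1). On a tree walk the monomial is a product of squared moduli over the edges. Averaging over the
label of a leaf produces the normalized squared norm of a row or a column, which (A3) and (A1) allow
to replace by one; stripping leaf after leaf, each shape of walk contributes one in the limit
(`RowModel.tendsto_treeSum`). So the limit of a word counts shapes, depends on the word only and is
at most `2 ^ m`. Hence the expected moments of `L_n(z)` converge to numbers of at most exponential
growth that depend on `z` only (`exists_tendsto_moments`).

Almost sure statements come from the bounded functions `(1 + x)^{-j}`: replacing one row of `A_n`
changes their sum over the eigenvalues by at most `2j`, so McDiarmid's inequality and Borel–Cantelli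
apply. The growth bound on the moments yields, by polynomial approximation, the limits of the
expectations of `(x / (1 + x)) ^ j`. Their integrals control the mass near infinity and, given
tightness, determine weak limits on `[0, ∞)`. -/

noncomputable section

namespace RowDependent

/-! ### Closed walks without simple positions, and trees -/

section Walks

variable {α : Type*}

/-- The last vertex of the walk that starts at `u` and visits the listed vertices. -/
def walkEnd (u : α) : List (Bool × α) → α
  | [] => u
  | (_, v) :: t => walkEnd v t

/-- The matrix position used by a step from `u` to `v`: the transposed one if the letter is a star. -/
def stepPos (ε : Bool) (u v : α) : α × α := if ε then (u, v) else (v, u)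

/-- The letters and matrix positions used by a walk. -/
def walkEdges (u : α) : List (Bool × α) → List (Bool × α × α)
  | [] => []
  | (ε, v) :: t => (ε, stepPos ε u v) :: walkEdges v t

/-- The matrix positions used by a walk. -/
def walkPos (u : α) (s : List (Bool × α)) : List (α × α) := (walkEdges u s).map Prod.snd

theorem walkEnd_append (u : α) (s t : List (Bool × α)) :
    walkEnd u (s ++ t) = walkEnd (walkEnd u s) t := by
  induction s generalizing u with
  | nil => rfl
  | cons x s ih => exact ih x.2

theorem walkEdges_append (u : α) (s t : List (Bool × α)) :
    walkEdges u (s ++ t) = walkEdges u s ++ walkEdges (walkEnd u s) t := by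
  induction s generalizing u with
  | nil => rfl
  | cons x s ih => obtain ⟨ε, v⟩ := x; simp [walkEdges, walkEnd, ih]

theorem walkPos_append (u : α) (s t : List (Bool × α)) :
    walkPos u (s ++ t) = walkPos u s ++ walkPos (walkEnd u s) t := by
  simp [walkPos, walkEdges_append]

theorem walkEnd_mem (u : α) (s : List (Bool × α)) : walkEnd u s ∈ u :: s.map Prod.snd := by
  induction s generalizing u with
  | nil => simp [walkEnd]
  | cons x s ih => exact List.mem_cons_of_mem _ (ih x.2)

theorem walkEnd_mem_of_ne_nil (u : α) {s : List (Bool × α)} (hs : s ≠ []) :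
    walkEnd u s ∈ s.map Prod.snd := by
  cases s with
  | nil => exact absurd rfl hs
  | cons x s => exact walkEnd_mem x.2 s

theorem walkPos_cons (u : α) (ε : Bool) (v : α) (t : List (Bool × α)) :
    walkPos u ((ε, v) :: t) = stepPos ε u v :: walkPos v t := rfl

theorem mem_of_mem_walkPos {u : α} {s : List (Bool × α)} {e : α × α} (he : e ∈ walkPos u s) :
    e.1 ∈ u :: s.map Prod.snd ∧ e.2 ∈ u :: s.map Prod.snd := by
  induction s generalizing u with
  | nil => simp [walkPos, walkEdges] at he
  | cons x s ih =>
    obtain ⟨ε, v⟩ := x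
    rw [walkPos_cons, List.mem_cons] at he
    rcases he with rfl | he
    · cases ε <;> simp [stepPos]
    · obtain ⟨h1, h2⟩ := ih he
      exact ⟨List.mem_cons_of_mem _ h1, List.mem_cons_of_mem _ h2⟩

/-- Closed walks that go twice, in opposite directions, along each edge of a tree, each edge being
used with a letter and its star. -/
inductive TreeWalk : α → List (Bool × α) → Prop
  | nil (u : α) : TreeWalk u []
  | insert (u : α) (s₁ s₂ : List (Bool × α)) (ε : Bool) (a : α) (h : TreeWalk u (s₁ ++ s₂))
      (hu : a ≠ u) (h₁ : a ∉ s₁.map Prod.snd) (h₂ : a ∉ s₂.map Prod.snd) :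
      TreeWalk u (s₁ ++ (ε, a) :: (!ε, walkEnd u s₁) :: s₂)

/-- The walk on a tree coded by its sequence of up and down steps and by the new vertices in their
order of appearance; the first argument is the path from the present vertex to the root. -/
def decodeWalk : List α → List Bool → List α → List α
  | st, true :: b, a :: l => a :: decodeWalk (a :: st) b l
  | _ :: y :: st, false :: b, l => y :: decodeWalk (y :: st) b l
  | _, _, _ => []

/-- An excursion to a new vertex `a` after `s₁` is coded by an up step followed at once by a down
step, together with the label `a`. Afterwards the path to the root is what it was before, so the
rest of the code is decoded as before. -/
theorem exists_decodeWalk_insert (x a : α) (st : List α) (b : List Bool) (l : List α)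
    (s₁ s₂ : List (Bool × α)) (h : decodeWalk (x :: st) b l = (s₁ ++ s₂).map Prod.snd)
    (hb : b.length = (s₁ ++ s₂).length) :
    ∃ b' l', decodeWalk (x :: st) b' l' =
      s₁.map Prod.snd ++ a :: walkEnd x s₁ :: s₂.map Prod.snd ∧ b'.length = b.length + 2 ∧
        l'.length = l.length + 1 := by
  induction s₁ generalizing x st b l with
  | nil =>
    refine ⟨true :: false :: b, a :: l, ?_, rfl, rfl⟩
    simpa [decodeWalk, walkEnd] using h
  | cons y s₁ ih =>
    obtain ⟨ε, y⟩ := y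
    match b, l, st with
    | [], _, _ => simp at hb
    | true :: b, [], st => simp [decodeWalk] at h
    | true :: b, c :: l, st =>
      simp only [decodeWalk, List.cons_append, List.map_cons, List.cons.injEq] at h
      obtain ⟨rfl, h⟩ := h
      obtain ⟨b', l', h1, h2, h3⟩ := ih c (x :: st) b l h (by simpa using hb)
      exact ⟨true :: b', c :: l', by simp [decodeWalk, walkEnd, h1], by simp [h2], by simp [h3]⟩
    | false :: b, l, [] => simp [decodeWalk] at h
    | false :: b, l, c :: st =>
      simp only [decodeWalk, List.cons_append, List.map_cons, List.cons.injEq] at h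
      obtain ⟨rfl, h⟩ := h
      obtain ⟨b', l', h1, h2, h3⟩ := ih c st b l h (by simpa using hb)
      exact ⟨false :: b', l', by simp [decodeWalk, walkEnd, h1], by simp [h2], by simp [h3]⟩

/-- A tree walk of `2q` steps is coded by its start, `2q` bits and `q` labels; this is the source of
the exponential bound on the number of tree walks. -/
theorem TreeWalk.exists_decodeWalk {u : α} {s : List (Bool × α)} (h : TreeWalk u s) :
    ∃ b l, decodeWalk [u] b l = s.map Prod.snd ∧ b.length = s.length ∧
      2 * l.length = s.length := by
  induction h with
  | nil => exact ⟨[], [], rfl, rfl, rfl⟩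
  | insert s₁ s₂ ε a h hu h₁ h₂ ih =>
    obtain ⟨b, l, h1, h2, h3⟩ := ih
    obtain ⟨b', l', h1', h2', h3'⟩ := exists_decodeWalk_insert u a [] b l s₁ s₂ h1 h2
    refine ⟨b', l', by simpa using h1', ?_, ?_⟩
    · simp only [List.length_append, List.length_cons] at *; omega
    · simp only [List.length_append, List.length_cons] at *; omega

variable [DecidableEq α]

/-- The set of vertices of a walk. -/
def walkSupport (u : α) (s : List (Bool × α)) : Finset α := (u :: s.map Prod.snd).toFinset

theorem walkSupport_insert (u : α) (s₁ s₂ : List (Bool × α)) (ε δ : Bool) (a : α) :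
    walkSupport u (s₁ ++ (ε, a) :: (δ, walkEnd u s₁) :: s₂) =
      insert a (walkSupport u (s₁ ++ s₂)) := by
  have := walkEnd_mem u s₁
  ext x
  simp only [walkSupport, List.mem_toFinset, List.map_append, List.map_cons, List.mem_cons,
    List.mem_append, Finset.mem_insert] at this ⊢
  constructor
  · rintro (h | h | h | h | h)
    · tauto
    · tauto
    · tauto
    · subst h; tauto
    · tauto
  · tauto

/-- Each insertion adds two steps and one vertex. -/
theorem TreeWalk.two_mul_card {u : α} {s : List (Bool × α)} (h : TreeWalk u s) :
    2 * (walkSupport u s).card = s.length + 2 := by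
  induction h with
  | nil => simp [walkSupport]
  | insert s₁ s₂ ε a h hu h₁ h₂ ih =>
    rw [walkSupport_insert, Finset.card_insert_of_notMem]
    · simp only [List.length_append, List.length_cons] at ih ⊢
      omega
    · simp only [walkSupport, List.mem_toFinset, List.map_append, List.mem_cons, List.mem_append]
      tauto

/-- In a closed walk with many vertices some vertex other than the start is visited once. -/
theorem exists_visited_once {u : α} {s : List (Bool × α)} (hs : s ≠ []) (hc : walkEnd u s = u)
    (hcard : s.length + 2 ≤ 2 * (walkSupport u s).card) :
    ∃ a ∈ s.map Prod.snd, a ≠ u ∧ (s.map Prod.snd).count a ≤ 1 := by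
  -- If all `V - 1` vertices other than `u` are visited twice, the walk has at least `1 + 2 (V - 1)`
  -- steps, the `1` being a return to `u`; `hcard` allows only `2 V - 2`.
  by_contra! hcon
  have hu : u ∈ s.map Prod.snd := by
    have := walkEnd_mem_of_ne_nil u hs
    rwa [hc] at this
  have hsupp : walkSupport u s = (s.map Prod.snd).toFinset := by
    simp [walkSupport, List.toFinset_cons, List.mem_toFinset.2 hu, Finset.insert_eq_of_mem, -List.mem_map]
  have hlen : s.length = ∑ a ∈ (s.map Prod.snd).toFinset, (s.map Prod.snd).count a := by
    rw [List.sum_toFinset_count_eq_length, List.length_map]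
  have hu' := List.mem_toFinset.2 hu
  rw [← Finset.add_sum_erase _ _ hu'] at hlen
  have h1 : 1 ≤ (s.map Prod.snd).count u := List.one_le_count_iff.2 hu
  have h2 : ∑ a ∈ (s.map Prod.snd).toFinset.erase u, 2 ≤
      ∑ a ∈ (s.map Prod.snd).toFinset.erase u, (s.map Prod.snd).count a := by
    refine Finset.sum_le_sum fun a ha => ?_
    rw [Finset.mem_erase, List.mem_toFinset] at ha
    exact hcon a ha.2 ha.1
  rw [Finset.sum_const, Finset.card_erase_of_mem hu', smul_eq_mul] at h2
  rw [hsupp] at hcard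
  have : 0 < (s.map Prod.snd).toFinset.card := Finset.card_pos.2 ⟨u, hu'⟩
  omega

/-- Take a vertex `a` visited once. The position of the step into `a` must occur again, and the only
other step that touches `a` is the one leaving it. So the walk goes straight back, with the opposite
letter. -/
theorem exists_leaf {u : α} {s : List (Bool × α)} (hs : s ≠ []) (hc : walkEnd u s = u)
    (hpos : ∀ e ∈ walkPos u s, 2 ≤ (walkPos u s).count e)
    (hcard : s.length + 2 ≤ 2 * (walkSupport u s).card) :
    ∃ s₁ s₂ ε a, s = s₁ ++ (ε, a) :: (!ε, walkEnd u s₁) :: s₂ ∧ a ≠ u ∧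
      a ∉ s₁.map Prod.snd ∧ a ∉ s₂.map Prod.snd := by
  obtain ⟨a, ha, hau, hone⟩ := exists_visited_once hs hc hcard
  obtain ⟨⟨ε, a'⟩, hmem, rfl⟩ := List.mem_map.1 ha
  obtain ⟨s₁, t, rfl⟩ := List.append_of_mem hmem
  simp only [List.map_append, List.map_cons, List.count_append, List.count_cons_self] at hone
  have ha₁ : a' ∉ s₁.map Prod.snd := fun h => by
    have := List.one_le_count_iff.2 h; omega
  have hat : a' ∉ t.map Prod.snd := fun h => by
    have := List.one_le_count_iff.2 h; omega
  rw [walkEnd_append, walkEnd] at hc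
  cases t with
  | nil => exact absurd hc hau
  | cons x s₂ =>
    obtain ⟨δ, b⟩ := x
    simp only [List.map_cons, List.mem_cons, not_or] at hat
    refine ⟨s₁, s₂, ε, a', ?_, hau, ha₁, hat.2⟩
    have hp : walkEnd u s₁ ≠ a' := by
      intro h
      have := walkEnd_mem u s₁
      rw [h, List.mem_cons] at this
      tauto
    have hP : walkPos u (s₁ ++ (ε, a') :: (δ, b) :: s₂) = walkPos u s₁ ++
        stepPos ε (walkEnd u s₁) a' :: stepPos δ a' b :: walkPos b s₂ := by
      rw [walkPos_append, walkPos_cons, walkPos_cons]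
    have hcount := hpos (stepPos ε (walkEnd u s₁) a') (by rw [hP]; simp)
    have hends : stepPos ε (walkEnd u s₁) a' = (walkEnd u s₁, a') ∨
        stepPos ε (walkEnd u s₁) a' = (a', walkEnd u s₁) := by
      cases ε <;> simp [stepPos]
    have hn₁ : stepPos ε (walkEnd u s₁) a' ∉ walkPos u s₁ := by
      intro h
      have := mem_of_mem_walkPos h
      have hx : a' ∉ u :: s₁.map Prod.snd := by
        rw [List.mem_cons]; tauto
      rcases hends with h' | h' <;> rw [h'] at this <;> tauto
    have hn₂ : stepPos ε (walkEnd u s₁) a' ∉ walkPos b s₂ := by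
      intro h
      have := mem_of_mem_walkPos h
      have hx : a' ∉ b :: s₂.map Prod.snd := by
        rw [List.mem_cons]; tauto
      rcases hends with h' | h' <;> rw [h'] at this <;> tauto
    rw [hP, List.count_append, List.count_cons_self, List.count_eq_zero_of_not_mem hn₁,
      List.count_cons, List.count_eq_zero_of_not_mem hn₂] at hcount
    have heq : stepPos δ a' b = stepPos ε (walkEnd u s₁) a' := by
      by_contra h
      simp [h] at hcount
    -- Equal letters at one position would force `walkEnd u s₁ = a'`, which `hp` excludes.
    have : δ = !ε ∧ b = walkEnd u s₁ := by
      cases ε <;> cases δ <;> simp_all [stepPos]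
    rw [this.1, this.2]

/-- A closed walk without simple positions and with the largest possible number of vertices is a
tree walk. -/
theorem treeWalk_of_forall_count {u : α} {s : List (Bool × α)} (hc : walkEnd u s = u)
    (hpos : ∀ e ∈ walkPos u s, 2 ≤ (walkPos u s).count e)
    (hcard : s.length + 2 ≤ 2 * (walkSupport u s).card) : TreeWalk u s := by
  induction hn : s.length using Nat.strong_induction_on generalizing s with
  | _ n ih =>
    by_cases hs : s = []
    · subst hs; exact TreeWalk.nil u
    obtain ⟨s₁, s₂, ε, a, rfl, hau, h₁, h₂⟩ := exists_leaf hs hc hpos hcard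
    refine TreeWalk.insert u s₁ s₂ ε a ?_ hau h₁ h₂
    have hnot : a ∉ walkSupport u (s₁ ++ s₂) := by
      simp only [walkSupport, List.mem_toFinset, List.map_append, List.mem_cons, List.mem_append]
      tauto
    have hP : walkPos u (s₁ ++ (ε, a) :: (!ε, walkEnd u s₁) :: s₂) = walkPos u s₁ ++
        stepPos ε (walkEnd u s₁) a :: stepPos (!ε) a (walkEnd u s₁) ::
          walkPos (walkEnd u s₁) s₂ := by
      rw [walkPos_append, walkPos_cons, walkPos_cons]
    refine ih (s₁ ++ s₂).length ?_ ?_ ?_ ?_ rfl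
    · rw [← hn]; simp
    · rw [walkEnd_append] at hc ⊢
      exact hc
    -- The positions of the shortened walk avoid `a`, so removing the two steps at the leaf leaves
    -- their multiplicities unchanged.
    · intro e he
      have hne : stepPos ε (walkEnd u s₁) a ≠ e ∧ stepPos (!ε) a (walkEnd u s₁) ≠ e := by
        have := mem_of_mem_walkPos he
        rw [← List.mem_toFinset, ← List.mem_toFinset] at this
        change _ ∈ walkSupport u (s₁ ++ s₂) ∧ _ ∈ walkSupport u (s₁ ++ s₂) at this
        constructor
        · rintro rfl; cases ε <;> simp [stepPos] at this <;> tauto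
        · rintro rfl; cases ε <;> simp [stepPos] at this <;> tauto
      have := hpos e (by
        rw [hP]; rw [walkPos_append] at he
        simp only [List.mem_append, List.mem_cons] at he ⊢; tauto)
      rw [hP, List.count_append, List.count_cons_of_ne hne.1, List.count_cons_of_ne hne.2] at this
      rwa [walkPos_append, List.count_append]
    · rw [walkSupport_insert, Finset.card_insert_of_notMem hnot] at hcard
      simp only [List.length_append, List.length_cons] at hcard ⊢
      omega

/-- Edge lists of rooted trees: each edge joins a new vertex to another one. -/
inductive IsTreeList : List (α × α) → Prop
  | nil : IsTreeList []
  | cons (ε : Bool) (u a : α) (l : List (α × α)) (h : IsTreeList l) (hu : u ≠ a)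
      (ha : ∀ e ∈ l, e.1 ≠ a ∧ e.2 ≠ a) : IsTreeList (stepPos ε u a :: l)

/-- Each tree edge is one matrix position, met once plain and once conjugated; this turns the
monomial of a tree walk into a product of squared moduli. The head of the list is always an edge to
a leaf, which suits an induction that strips leaves. -/
theorem TreeWalk.exists_treeList {u : α} {s : List (Bool × α)} (h : TreeWalk u s) :
    ∃ l : List (α × α), IsTreeList l ∧
      (∀ e ∈ l, e.1 ∈ walkSupport u s ∧ e.2 ∈ walkSupport u s) ∧
      (walkEdges u s).Perm (l.map (fun e => (true, e)) ++ l.map (fun e => (false, e))) := by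
  induction h with
  | nil => exact ⟨[], IsTreeList.nil, by simp, by simp [walkEdges]⟩
  | insert s₁ s₂ ε a h hu h₁ h₂ ih =>
    obtain ⟨l, hl, hsub, hperm⟩ := ih
    have hnot : a ∉ walkSupport u (s₁ ++ s₂) := by
      simp only [walkSupport, List.mem_toFinset, List.map_append, List.mem_cons, List.mem_append]
      tauto
    have hend : walkEnd u s₁ ∈ walkSupport u (s₁ ++ s₂) := by
      have := walkEnd_mem u s₁
      simp only [walkSupport, List.mem_toFinset, List.map_append, List.mem_cons,
        List.mem_append] at this ⊢
      tauto
    refine ⟨stepPos ε (walkEnd u s₁) a :: l, ?_, ?_, ?_⟩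
    · refine IsTreeList.cons ε _ a l hl (fun h => hnot (h ▸ hend)) fun e he => ?_
      exact ⟨fun h => hnot (h ▸ (hsub e he).1), fun h => hnot (h ▸ (hsub e he).2)⟩
    · rw [walkSupport_insert]
      intro e he
      rw [List.mem_cons] at he
      rcases he with rfl | he
      · cases ε <;> simp [stepPos, hend]
      · exact ⟨Finset.mem_insert_of_mem (hsub e he).1, Finset.mem_insert_of_mem (hsub e he).2⟩
    · rw [walkEdges_append] at hperm ⊢
      have h1 : walkEdges (walkEnd u s₁) ((ε, a) :: (!ε, walkEnd u s₁) :: s₂) =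
          (ε, stepPos ε (walkEnd u s₁) a) :: (!ε, stepPos ε (walkEnd u s₁) a) ::
            walkEdges (walkEnd u s₁) s₂ := by
        cases ε <;> rfl
      rw [h1]
      have h2 : (walkEdges u s₁ ++ (ε, stepPos ε (walkEnd u s₁) a) ::
          (!ε, stepPos ε (walkEnd u s₁) a) :: walkEdges (walkEnd u s₁) s₂).Perm
          ((ε, stepPos ε (walkEnd u s₁) a) :: (!ε, stepPos ε (walkEnd u s₁) a) ::
            (walkEdges u s₁ ++ walkEdges (walkEnd u s₁) s₂)) :=
        List.perm_middle.trans (List.Perm.cons _ List.perm_middle)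
      refine h2.trans (((hperm.cons _).cons _).trans ?_)
      generalize stepPos ε (walkEnd u s₁) a = e
      simp only [List.map_cons, List.cons_append]
      cases ε
      · exact (List.Perm.swap _ _ _).trans (List.Perm.cons _ List.perm_middle.symm)
      · exact List.Perm.cons _ List.perm_middle.symm

end Walks

end RowDependent

end

noncomputable section

namespace RowDependent

/-! ### Walks as cyclic sequences of vertices -/

section CyclicWalks

variable {α β : Type*} {k : ℕ}

/-- The vertex before the `l`-th one in the cyclic sequence `v`. -/
def prevVertex (v : Fin (k + 1) → α) (l : Fin (k + 1)) : α :=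
  (Fin.cons (v (Fin.last k)) v : Fin (k + 2) → α) l.castSucc

/-- The row index used by the `l`-th letter of the word `w` along the cyclic walk `v`. -/
def rowIdx (w : Fin (k + 1) → Bool) (v : Fin (k + 1) → α) (l : Fin (k + 1)) : α :=
  (stepPos (w l) (prevVertex v l) (v l)).1

/-- The column index used by the `l`-th letter of the word `w` along the cyclic walk `v`. -/
def colIdx (w : Fin (k + 1) → Bool) (v : Fin (k + 1) → α) (l : Fin (k + 1)) : α :=
  (stepPos (w l) (prevVertex v l) (v l)).2

theorem prevVertex_comp (f : α → β) (v : Fin (k + 1) → α) (l : Fin (k + 1)) :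
    prevVertex (f ∘ v) l = f (prevVertex v l) := by
  unfold prevVertex
  refine Fin.cases ?_ (fun i => ?_) l
  · simp
  · simp

theorem rowIdx_comp (f : α → β) (w : Fin (k + 1) → Bool) (v : Fin (k + 1) → α) :
    rowIdx w (f ∘ v) = f ∘ rowIdx w v := by
  funext l
  simp only [rowIdx, prevVertex_comp, Function.comp_apply, stepPos]
  split_ifs <;> rfl

theorem colIdx_comp (f : α → β) (w : Fin (k + 1) → Bool) (v : Fin (k + 1) → α) :
    colIdx w (f ∘ v) = f ∘ colIdx w v := by
  funext l
  simp only [colIdx, prevVertex_comp, Function.comp_apply, stepPos]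
  split_ifs <;> rfl

/-- For a given letter the vertex `v l` is the column index, for a star it is the row index.
Injectivity lets sums over walks be bounded by sums over all pairs of index tuples. -/
theorem rowIdx_colIdx_injective (w : Fin (k + 1) → Bool) :
    Function.Injective fun v : Fin (k + 1) → α => (rowIdx w v, colIdx w v) := by
  intro v v' h
  rw [Prod.mk.injEq] at h
  funext l
  have h1 := congrFun h.1 l
  have h2 := congrFun h.2 l
  simp only [rowIdx, colIdx, stepPos] at h1 h2
  cases hw : w l <;> simp only [hw] at h1 h2
  · exact h1
  · exact h2

/-- Some matrix position is used exactly once by the word `w` along the cyclic walk `v`. -/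
def SimpleWalk (w : Fin (k + 1) → Bool) (v : Fin (k + 1) → α) : Prop :=
  ∃ l, ∀ l', (rowIdx w v l', colIdx w v l') = (rowIdx w v l, colIdx w v l) → l' = l

theorem simpleWalk_comp {f : α → β} (hf : Function.Injective f) (w : Fin (k + 1) → Bool)
    (v : Fin (k + 1) → α) : SimpleWalk w (f ∘ v) ↔ SimpleWalk w v := by
  simp only [SimpleWalk, rowIdx_comp, colIdx_comp, Function.comp_apply, Prod.mk.injEq, hf.eq_iff]

/-- The steps of the cyclic walk `v` with the letters of `w`. -/
def walkSteps {m : ℕ} (w : Fin m → Bool) (v : Fin m → α) : List (Bool × α) :=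
  List.ofFn fun l => (w l, v l)

theorem walkEdges_walkSteps {m : ℕ} (u : α) (w : Fin m → Bool) (v : Fin m → α) :
    walkEdges u (walkSteps w v) = List.ofFn fun l =>
      (w l, stepPos (w l) ((Fin.cons u v : Fin (m + 1) → α) l.castSucc) (v l)) := by
  induction m generalizing u with
  | zero => rfl
  | succ m ih =>
    have h : walkSteps w v = (w 0, v 0) :: walkSteps (Fin.tail w) (Fin.tail v) := by
      simp [walkSteps, List.ofFn_succ, Fin.tail]
    rw [h, walkEdges, ih, List.ofFn_succ]
    simp only [Fin.castSucc_zero, Fin.cons_zero, Fin.tail, ← Fin.succ_castSucc, Fin.cons_succ]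
    congr 2
    funext l
    congr 2
    exact congrFun (Fin.cons_self_tail v) l.castSucc

theorem walkEnd_walkSteps (u : α) (w : Fin (k + 1) → Bool) (v : Fin (k + 1) → α) :
    walkEnd u (walkSteps w v) = v (Fin.last k) := by
  have h : walkSteps w v = walkSteps (w ∘ Fin.castSucc) (v ∘ Fin.castSucc) ++
      [(w (Fin.last k), v (Fin.last k))] := by
    rw [walkSteps, List.ofFn_succ', List.concat_eq_append]
    rfl
  rw [h, walkEnd_append]
  rfl

theorem walkEdges_cyclic (w : Fin (k + 1) → Bool) (v : Fin (k + 1) → α) :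
    walkEdges (v (Fin.last k)) (walkSteps w v) =
      List.ofFn fun l => (w l, (rowIdx w v l, colIdx w v l)) :=
  walkEdges_walkSteps _ w v

theorem map_snd_walkSteps {m : ℕ} (w : Fin m → Bool) (v : Fin m → α) :
    (walkSteps w v).map Prod.snd = List.ofFn v := by
  simp [walkSteps, List.map_ofFn, Function.comp_def]

theorem walkPos_cyclic (w : Fin (k + 1) → Bool) (v : Fin (k + 1) → α) :
    walkPos (v (Fin.last k)) (walkSteps w v) =
      List.ofFn fun l => (rowIdx w v l, colIdx w v l) := by
  rw [walkPos, walkEdges_cyclic, List.map_ofFn]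
  rfl

variable [DecidableEq α]

theorem walkSupport_cyclic (w : Fin (k + 1) → Bool) (v : Fin (k + 1) → α) :
    walkSupport (v (Fin.last k)) (walkSteps w v) = Finset.univ.image v := by
  ext x
  simp only [walkSupport, map_snd_walkSteps, List.mem_toFinset, List.mem_cons, List.mem_ofFn,
    Finset.mem_image, Finset.mem_univ, true_and]
  constructor
  · rintro (rfl | h)
    · exact ⟨_, rfl⟩
    · exact h
  · exact Or.inr

theorem treeWalk_of_not_simpleWalk {w : Fin (k + 1) → Bool} {v : Fin (k + 1) → α}
    (hv : ¬ SimpleWalk w v) (hcard : k + 3 ≤ 2 * (Finset.univ.image v).card) :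
    TreeWalk (v (Fin.last k)) (walkSteps w v) := by
  refine treeWalk_of_forall_count (walkEnd_walkSteps _ w v) ?_ ?_
  · intro e he
    rw [walkPos_cyclic] at he ⊢
    obtain ⟨l, rfl⟩ := List.mem_ofFn.1 he
    unfold SimpleWalk at hv
    push Not at hv
    obtain ⟨l', h1, h2⟩ := hv l
    -- The count uses the componentwise `BEq` on pairs, the lemmas on duplicates the one from
    -- decidable equality.
    have hbeq : (instBEqProd : BEq (α × α)) = instBEqOfDecidableEq := by
      ext x y; simp
    rw [hbeq, ← List.duplicate_iff_two_le_count, List.duplicate_iff_exists_distinct_get]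
    have key : ∀ i j : Fin (k + 1), i < j → (rowIdx w v i, colIdx w v i) =
        (rowIdx w v l, colIdx w v l) → (rowIdx w v j, colIdx w v j) =
        (rowIdx w v l, colIdx w v l) → ∃ n m : Fin (List.ofFn fun l => (rowIdx w v l, colIdx w v l)).length,
          ∃ _ : n < m, (rowIdx w v l, colIdx w v l) =
            (List.ofFn fun l => (rowIdx w v l, colIdx w v l)).get n ∧
            (rowIdx w v l, colIdx w v l) =
            (List.ofFn fun l => (rowIdx w v l, colIdx w v l)).get m := by
      intro i j hij hi hj
      refine ⟨i.cast (by simp), j.cast (by simp), hij, ?_, ?_⟩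
      · rw [List.get_ofFn]; exact hi.symm
      · rw [List.get_ofFn]; exact hj.symm
    rcases lt_or_gt_of_ne h2 with h | h
    · exact key l' l h h1 rfl
    · exact key l l' h rfl h1
  · rw [walkSupport_cyclic]
    simpa [walkSteps] using hcard

/-- Reaching `k + 3` already forces a tree walk, and for a tree walk twice the number of vertices is
exactly `k + 3`; so the bound cannot be exceeded. -/
theorem two_mul_card_image_of_not_simpleWalk {w : Fin (k + 1) → Bool} {v : Fin (k + 1) → α}
    (hv : ¬ SimpleWalk w v) : 2 * (Finset.univ.image v).card ≤ k + 3 := by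
  by_contra! h
  have := (treeWalk_of_not_simpleWalk hv h.le).two_mul_card
  rw [walkSupport_cyclic] at this
  simp [walkSteps] at this
  omega

/-- There are at most `2 ^ m * n ^ (m / 2 + 1)` tree walks of length `m` on `n` vertices. -/
theorem card_filter_treeWalk_le (n q : ℕ) (w : Fin (k + 1) → Bool) (hq : 2 * q = k + 3)
    (s : Finset (Fin (k + 1) → Fin n))
    (hs : ∀ v ∈ s, TreeWalk (v (Fin.last k)) (walkSteps w v)) :
    s.card ≤ 2 ^ (k + 1) * n ^ q := by
  classical
  -- `p` counts the vertices other than the root, so `2 * p = k + 1`; the root is the first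
  -- component of the code.
  obtain ⟨p, rfl⟩ : ∃ p, q = p + 1 := ⟨q - 1, by omega⟩
  let dec : Fin n × (Fin (k + 1) → Bool) × (Fin p → Fin n) → List (Fin n) := fun x =>
    decodeWalk [x.1] (List.ofFn x.2.1) (List.ofFn x.2.2)
  have hsub : s.image List.ofFn ⊆ Finset.univ.image dec := by
    intro t ht
    obtain ⟨v, hv, rfl⟩ := Finset.mem_image.1 ht
    obtain ⟨b, l, h1, h2, h3⟩ := (hs v hv).exists_decodeWalk
    rw [map_snd_walkSteps] at h1
    have hlen : (walkSteps w v).length = k + 1 := by simp [walkSteps]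
    rw [hlen] at h2 h3
    have hl : l.length = p := by omega
    subst hl
    refine Finset.mem_image.2 ⟨(v (Fin.last k), fun i => b.get (i.cast h2.symm), l.get),
      Finset.mem_univ _, ?_⟩
    simp only [dec, List.ofFn_get]
    rw [← h1]
    congr 1
    apply List.ext_get
    · simp [h2]
    · intro i _ _
      rw [List.get_ofFn]
      rfl
  have := Finset.card_le_card hsub
  rw [Finset.card_image_of_injective _ List.ofFn_injective] at this
  refine this.trans (Finset.card_image_le.trans ?_)
  rw [Finset.card_univ]
  simp only [Fintype.card_prod, Fintype.card_fun, Fintype.card_fin, Fintype.card_bool]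
  rw [pow_succ n]
  exact le_of_eq (by ring)

end CyclicWalks

/-! ### Coincidence patterns of index tuples -/

section Patterns

variable {α β : Type*} {m : ℕ} [DecidableEq α] [DecidableEq β]

/-- The canonical representative of a map up to injections of the target: each index is sent to the
first index with the same value. -/
def pattern (v : Fin m → α) (l : Fin m) : Fin m :=
  (Finset.univ.filter fun l' => v l' = v l).min' ⟨l, by simp⟩

theorem apply_pattern (v : Fin m → α) (l : Fin m) : v (pattern v l) = v l := by
  have := Finset.min'_mem (Finset.univ.filter fun l' => v l' = v l) ⟨l, by simp⟩
  exact (Finset.mem_filter.1 this).2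

theorem pattern_congr {v : Fin m → α} {v' : Fin m → β}
    (h : ∀ l l', v l = v l' ↔ v' l = v' l') : pattern v = pattern v' := by
  funext l
  unfold pattern
  congr 1
  ext l'
  simp [h]

theorem pattern_eq_iff (v : Fin m → α) (l l' : Fin m) :
    pattern v l = pattern v l' ↔ v l = v l' := by
  constructor
  · intro h
    rw [← apply_pattern v l, h, apply_pattern v l']
  · intro h
    unfold pattern
    congr 1
    ext x
    simp [h]

theorem pattern_pattern (v : Fin m → α) : pattern (pattern v) = pattern v :=
  pattern_congr (pattern_eq_iff v)

theorem pattern_comp {f : α → β} (hf : Function.Injective f) (v : Fin m → α) :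
    pattern (f ∘ v) = pattern v :=
  pattern_congr fun l l' => by simp [hf.eq_iff]

/-- Summation over the maps with a given pattern is summation over injections of its range. -/
theorem sum_filter_pattern_eq {R : Type*} [AddCommMonoid R] [Fintype α] (π : Fin m → Fin m)
    (hπ : pattern π = π) (g : (Fin m → α) → R) :
    ∑ v with pattern v = π, g v = ∑ f : Set.range π → α with Function.Injective f,
      g (f ∘ Set.rangeFactorization π) := by
  have hfix : ∀ l, π (π l) = π l := fun l => by
    have := apply_pattern π l
    rwa [hπ] at this
  refine Finset.sum_nbij' (fun v x => v x.1) (fun f => f ∘ Set.rangeFactorization π) ?_ ?_ ?_ ?_ ?_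
  · intro v hv
    rw [Finset.mem_filter] at hv ⊢
    refine ⟨Finset.mem_univ _, ?_⟩
    rintro ⟨_, l, rfl⟩ ⟨_, l', rfl⟩ h
    have h1 : ∀ l, v (π l) = v l := fun l => by rw [← hv.2, apply_pattern v]
    simp only [h1] at h
    refine Subtype.ext ?_
    change π l = π l'
    rw [← hv.2, pattern_eq_iff]
    exact h
  · intro f hf
    rw [Finset.mem_filter] at hf ⊢
    refine ⟨Finset.mem_univ _, ?_⟩
    rw [pattern_comp hf.2]
    conv_rhs => rw [← hπ]
    refine pattern_congr fun l l' => ?_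
    simp [Set.rangeFactorization, Subtype.ext_iff]
  · intro v hv
    rw [Finset.mem_filter] at hv
    funext l
    change v (π l) = v l
    rw [← hv.2, apply_pattern v]
  · intro f hf
    funext x
    obtain ⟨_, l, rfl⟩ := x
    simp [Set.rangeFactorization, hfix]
  · intro v hv
    rw [Finset.mem_filter] at hv
    congr 1
    funext l
    change v l = v (π l)
    rw [← hv.2, apply_pattern v]

end Patterns

end RowDependent

end

/-! ### Moment bounds from (A1), and mean square convergence from (A3) -/

noncomputable section

namespace RowDependent

variable {Ω : Type*} [MeasurableSpace Ω]

/-- The standing assumptions on a sequence of random matrices. -/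
structure RowModel (P : Measure Ω) (A : (n : ℕ) → Ω → Matrix (Fin n) (Fin n) ℂ)
    (ν : (n : ℕ) → Measure (Fin n → ℂ)) : Prop where
  iid : ∀ n, HasIIDRows (A n) (ν n) P
  a1 : AssumptionA1 P A
  a2 : AssumptionA2 P A
  a3 : AssumptionA3 P A

/-- The product of the absolute values of the entries of `M` at the listed positions. -/
def posWeight {n : ℕ} (M : Matrix (Fin n) (Fin n) ℂ) (E : List (Fin n × Fin n)) : ℝ :=
  (E.map fun e => ‖M e.1 e.2‖).prod

theorem posWeight_nonneg {n : ℕ} (M : Matrix (Fin n) (Fin n) ℂ) (E : List (Fin n × Fin n)) :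
    0 ≤ posWeight M E :=
  List.prod_nonneg (List.forall_mem_map.2 fun _ _ => norm_nonneg _)

theorem posWeight_append {n : ℕ} (M : Matrix (Fin n) (Fin n) ℂ) (E F : List (Fin n × Fin n)) :
    posWeight M (E ++ F) = posWeight M E * posWeight M F := by
  simp [posWeight]

/-- Either all factors are at most one, or the product is at most the `N`-th power of the largest
factor, itself a term of the sum. Bounds on moments of single entries thus give bounds on products,
with no independence inside a row. -/
theorem list_prod_le_one_add_sum_pow (L : List ℝ) (hL : ∀ x ∈ L, 0 ≤ x) (N : ℕ)
    (hN : L.length ≤ N) : L.prod ≤ 1 + (L.map fun x => x ^ N).sum := by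
  have hsum : ∀ x ∈ L, x ^ N ≤ (L.map fun x => x ^ N).sum := fun x hx =>
    List.single_le_sum (by simpa using fun a ha => pow_nonneg (hL a ha) N) _
      (List.mem_map.2 ⟨x, hx, rfl⟩)
  have hsum0 : 0 ≤ (L.map fun x => x ^ N).sum :=
    List.sum_nonneg (by simpa using fun a ha => pow_nonneg (hL a ha) N)
  have key : ∀ (b : ℝ), 0 ≤ b → ∀ L : List ℝ, (∀ x ∈ L, 0 ≤ x ∧ x ≤ b) → L.prod ≤ b ^ L.length := by
    intro b hb L
    induction L with
    | nil => simp
    | cons y L ih =>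
      intro h
      rw [List.prod_cons, List.length_cons, pow_succ']
      refine mul_le_mul (h y (by simp)).2 (ih fun x hx => h x (by simp [hx]))
        (List.prod_nonneg fun x hx => (h x (by simp [hx])).1) hb
  by_cases h1 : ∀ x ∈ L, x ≤ 1
  · have := key 1 zero_le_one L fun x hx => ⟨hL x hx, h1 x hx⟩
    rw [one_pow] at this
    linarith
  · push Not at h1
    obtain ⟨x, hx, hx1⟩ := h1
    have hne : L.toFinset.Nonempty := ⟨x, List.mem_toFinset.2 hx⟩
    obtain ⟨y, hy, hmax⟩ := L.toFinset.exists_max_image id hne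
    rw [List.mem_toFinset] at hy
    have hy1 : 1 ≤ y := hx1.le.trans (hmax x (List.mem_toFinset.2 hx))
    have h2 := key y (hL y hy) L fun z hz => ⟨hL z hz, hmax z (List.mem_toFinset.2 hz)⟩
    have h3 := pow_le_pow_right₀ hy1 hN
    have h4 := hsum y hy
    linarith

section Moments

variable {P : Measure Ω} {A : (n : ℕ) → Ω → Matrix (Fin n) (Fin n) ℂ}
  {ν : (n : ℕ) → Measure (Fin n → ℂ)}

theorem HasIIDRows.aemeasurable_entry {n : ℕ} {M : Ω → Matrix (Fin n) (Fin n) ℂ}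
    {ν : Measure (Fin n → ℂ)} (h : HasIIDRows M ν P) (i j : Fin n) :
    AEMeasurable (fun ω => M ω i j) P :=
  (measurable_pi_apply j).comp_aemeasurable (h.hasLaw i).aemeasurable

theorem RowModel.exists_moment_bound (h : RowModel P A ν) (k : ℕ) :
    ∃ C : ℝ, 0 ≤ C ∧ ∀ n i j, Integrable (fun ω => ‖A n ω i j‖ ^ k) P ∧
      ∫ ω, ‖A n ω i j‖ ^ k ∂P ≤ C := by
  have h1 := h.a1 k
  refine ⟨(⨆ n, ⨆ i, ⨆ j, ∫⁻ ω, ‖A n ω i j‖ₑ ^ k ∂P).toReal, ENNReal.toReal_nonneg, fun n i j => ?_⟩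
  have hle : ∫⁻ ω, ‖A n ω i j‖ₑ ^ k ∂P ≤ ⨆ n, ⨆ i, ⨆ j, ∫⁻ ω, ‖A n ω i j‖ₑ ^ k ∂P :=
    le_trans (le_trans (le_iSup (fun j => ∫⁻ ω, ‖A n ω i j‖ₑ ^ k ∂P) j)
      (le_iSup (fun i => ⨆ j, ∫⁻ ω, ‖A n ω i j‖ₑ ^ k ∂P) i))
      (le_iSup (fun n => ⨆ i, ⨆ j, ∫⁻ ω, ‖A n ω i j‖ₑ ^ k ∂P) n)
  have hm : AEStronglyMeasurable (fun ω => ‖A n ω i j‖ ^ k) P :=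
    (((h.iid n).aemeasurable_entry i j).norm.pow_const k).aestronglyMeasurable
  have heq : ∀ ω, ENNReal.ofReal (‖A n ω i j‖ ^ k) = ‖A n ω i j‖ₑ ^ k := fun ω => by
    rw [ENNReal.ofReal_pow (norm_nonneg _), ofReal_norm]
  constructor
  · refine ⟨hm, ?_⟩
    rw [hasFiniteIntegral_iff_ofReal (Eventually.of_forall fun ω => by positivity)]
    simp only [heq]
    exact hle.trans_lt h1
  · rw [integral_eq_lintegral_of_nonneg_ae (Eventually.of_forall fun ω => by positivity) hm]
    simp only [heq]
    exact ENNReal.toReal_mono h1.ne hle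

theorem aemeasurable_posWeight {n : ℕ} {M : Ω → Matrix (Fin n) (Fin n) ℂ}
    {ν : Measure (Fin n → ℂ)} (h : HasIIDRows M ν P) (E : List (Fin n × Fin n)) :
    AEMeasurable (fun ω => posWeight (M ω) E) P := by
  induction E with
  | nil => simp [posWeight]
  | cons e E ih =>
    simp only [posWeight, List.map_cons, List.prod_cons] at ih ⊢
    exact (h.aemeasurable_entry e.1 e.2).norm.mul ih

/-- A direction in which the entries are averaged: along rows or along columns. -/
def dirEntry {n : ℕ} (ε : Bool) (M : Matrix (Fin n) (Fin n) ℂ) (u a : Fin n) : ℂ :=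
  M (stepPos ε u a).1 (stepPos ε u a).2

/-- The normalized squared norm of a row or column. -/
def dirNormSq {n : ℕ} (ε : Bool) (M : Matrix (Fin n) (Fin n) ℂ) (u : Fin n) : ℝ :=
  (1 / (n : ℝ)) * ∑ a, ‖dirEntry ε M u a‖ ^ 2

theorem RowModel.aemeasurable_dirNormSq (h : RowModel P A ν) (ε : Bool) (n : ℕ) (i : Fin n) :
    AEMeasurable (fun ω => dirNormSq ε (A n ω) i) P := by
  refine AEMeasurable.const_mul (Finset.aemeasurable_fun_sum _ fun a _ => ?_) _
  exact ((h.iid n).aemeasurable_entry _ _).norm.pow_const 2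

variable [IsProbabilityMeasure P]

theorem RowModel.exists_posWeight_bound (h : RowModel P A ν) (N : ℕ) :
    ∃ C : ℝ, 0 ≤ C ∧ ∀ n (E : List (Fin n × Fin n)), E.length ≤ N →
      Integrable (fun ω => posWeight (A n ω) E) P ∧ ∫ ω, posWeight (A n ω) E ∂P ≤ C := by
  obtain ⟨C, hC, hA⟩ := h.exists_moment_bound N
  refine ⟨1 + N * C, by positivity, fun n E hE => ?_⟩
  have hint : ∀ F : List (Fin n × Fin n),
      Integrable (fun ω => ((F.map fun e => ‖A n ω e.1 e.2‖ ^ N).sum)) P ∧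
      ∫ ω, ((F.map fun e => ‖A n ω e.1 e.2‖ ^ N).sum) ∂P ≤ F.length * C := by
    intro F
    induction F with
    | nil => simp
    | cons e F ih =>
      simp only [List.map_cons, List.sum_cons]
      refine ⟨(hA n e.1 e.2).1.add ih.1, ?_⟩
      rw [integral_add (hA n e.1 e.2).1 ih.1]
      have := (hA n e.1 e.2).2
      push_cast [List.length_cons]
      linarith [ih.2]
  have hle : ∀ ω, posWeight (A n ω) E ≤ 1 + (E.map fun e => ‖A n ω e.1 e.2‖ ^ N).sum := by
    intro ω
    have := list_prod_le_one_add_sum_pow (E.map fun e => ‖A n ω e.1 e.2‖)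
      (List.forall_mem_map.2 fun _ _ => norm_nonneg _) N
      (by simpa using hE)
    simpa [posWeight, Function.comp_def] using this
  have hI : Integrable (fun ω => 1 + (E.map fun e => ‖A n ω e.1 e.2‖ ^ N).sum) P :=
    (integrable_const _).add (hint E).1
  have hW : Integrable (fun ω => posWeight (A n ω) E) P := by
    refine hI.mono' (aemeasurable_posWeight (h.iid n) E).aestronglyMeasurable
      (Eventually.of_forall fun ω => ?_)
    rw [Real.norm_of_nonneg (posWeight_nonneg _ _)]
    exact hle ω
  refine ⟨hW, (integral_mono hW hI hle).trans ?_⟩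
  rw [integral_add (integrable_const _) (hint E).1]
  have h2 := (hint E).2
  have h3 : (E.length : ℝ) * C ≤ N * C := by gcongr
  simp
  linarith

/-- Off the event `ε ≤ |X - 1|` the square is at most `ε ^ 2`. On it, Young's inequality `y ≤ 1 /
(2δ) + δ y² / 2` with `y = (X - 1)²` trades the square for the probability of the event and a small
multiple of the fourth power. -/
theorem integral_sq_sub_one_le {X : Ω → ℝ} (hX : AEMeasurable X P)
    (h4 : Integrable (fun ω => (X ω - 1) ^ 4) P) {ε δ : ℝ} (hδ : 0 < δ) :
    ∫ ω, (X ω - 1) ^ 2 ∂P ≤ ε ^ 2 + 1 / (2 * δ) * P.real {ω | ε ≤ |X ω - 1|} +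
      δ / 2 * ∫ ω, (X ω - 1) ^ 4 ∂P := by
  have hs : NullMeasurableSet {ω | ε ≤ |X ω - 1|} P :=
    nullMeasurableSet_le aemeasurable_const (hX.sub_const 1).abs
  have hind : Integrable ({ω | ε ≤ |X ω - 1|}.indicator fun _ => (1 : ℝ)) P :=
    (integrable_const 1).indicator₀ hs
  have hb : Integrable (fun ω => ε ^ 2 + 1 / (2 * δ) *
      ({ω | ε ≤ |X ω - 1|}.indicator (fun _ => (1 : ℝ)) ω) + δ / 2 * (X ω - 1) ^ 4) P :=
    ((integrable_const _).add (hind.const_mul _)).add (h4.const_mul _)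
  have hpt : ∀ ω, (X ω - 1) ^ 2 ≤ ε ^ 2 + 1 / (2 * δ) *
      ({ω | ε ≤ |X ω - 1|}.indicator (fun _ => (1 : ℝ)) ω) + δ / 2 * (X ω - 1) ^ 4 := by
    intro ω
    by_cases hω : ε ≤ |X ω - 1|
    · rw [Set.indicator_of_mem (by exact hω)]
      have h1 : (X ω - 1) ^ 2 ≤ 1 / (2 * δ) * 1 + δ / 2 * (X ω - 1) ^ 4 := by
        have : 1 / (2 * δ) * 1 + δ / 2 * (X ω - 1) ^ 4 - (X ω - 1) ^ 2 =
          (1 - δ * (X ω - 1) ^ 2) ^ 2 / (2 * δ) := by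
          field_simp
          ring
        have h2 : 0 ≤ (1 - δ * (X ω - 1) ^ 2) ^ 2 / (2 * δ) := by positivity
        linarith
      nlinarith [sq_nonneg ε]
    · rw [Set.indicator_of_notMem (by exact hω)]
      push Not at hω
      have h1 : (X ω - 1) ^ 2 ≤ ε ^ 2 := by
        rw [← sq_abs (X ω - 1)]
        exact pow_le_pow_left₀ (abs_nonneg _) hω.le 2
      have h2 : 0 ≤ δ / 2 * (X ω - 1) ^ 4 := by positivity
      linarith
  have h2 : Integrable (fun ω => (X ω - 1) ^ 2) P := by
    refine hb.mono' ((hX.sub_const 1).pow_const 2).aestronglyMeasurable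
      (Eventually.of_forall fun ω => ?_)
    rw [Real.norm_of_nonneg (sq_nonneg _)]
    exact hpt ω
  refine (integral_mono h2 hb hpt).trans (le_of_eq ?_)
  rw [integral_add (f := fun ω => ε ^ 2 + 1 / (2 * δ) *
      ({ω | ε ≤ |X ω - 1|}.indicator (fun _ => (1 : ℝ)) ω))
      ((integrable_const _).add (hind.const_mul _)) (h4.const_mul _),
    integral_add (integrable_const _) (hind.const_mul _), integral_const_mul, integral_const_mul,
    integral_indicator₀ hs]
  simp

/-- Convergence to one in probability, on average over an index, improves to convergence in mean
square if the fourth moments are bounded. -/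
theorem tendsto_average_integral_sq {X : (n : ℕ) → Fin n → Ω → ℝ}
    (hX : ∀ n i, AEMeasurable (X n i) P) (C : ℝ)
    (h4 : ∀ n i, Integrable (fun ω => (X n i ω - 1) ^ 4) P ∧ ∫ ω, (X n i ω - 1) ^ 4 ∂P ≤ C)
    (hP : ∀ ε : ℝ, 0 < ε → Tendsto (fun n : ℕ => (1 / (n : ℝ)) *
      ∑ i, P.real {ω | ε ≤ |X n i ω - 1|}) atTop (𝓝 0)) :
    Tendsto (fun n : ℕ => (1 / (n : ℝ)) * ∑ i, ∫ ω, (X n i ω - 1) ^ 2 ∂P) atTop (𝓝 0) := by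
  rw [Metric.tendsto_atTop']
  intro η hη
  -- The choices of `ε` and `δ` make each of the three terms of `integral_sq_sub_one_le` at most `η
  -- / 4` after averaging.
  set ε := Real.sqrt (η / 4) with hε
  have hε2 : ε ^ 2 = η / 4 := Real.sq_sqrt (by positivity)
  have hεpos : 0 < ε := Real.sqrt_pos.2 (by positivity)
  set δ := η / (4 * (|C| + 1)) with hδ
  have hδpos : 0 < δ := by positivity
  have hδC : δ / 2 * C ≤ η / 4 := by
    have h1 : δ * (|C| + 1) = η / 4 := by rw [hδ]; field_simp
    nlinarith [le_abs_self C, abs_nonneg C]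
  have ht := (hP ε hεpos).const_mul (1 / (2 * δ))
  rw [mul_zero] at ht
  obtain ⟨N, hN⟩ := (Metric.tendsto_atTop'.1 ht) (η / 4) (by positivity)
  refine ⟨N, fun n hn => ?_⟩
  have hpos : 0 < (n : ℝ) := by
    have : 0 < n := by omega
    exact_mod_cast this
  have h1 : 0 ≤ (1 / (n : ℝ)) * ∑ i, ∫ ω, (X n i ω - 1) ^ 2 ∂P :=
    mul_nonneg (by positivity) (Finset.sum_nonneg fun i _ => integral_nonneg fun ω => sq_nonneg _)
  rw [Real.dist_0_eq_abs, abs_of_nonneg h1]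
  have h2 : ∑ i, ∫ ω, (X n i ω - 1) ^ 2 ∂P ≤
      ∑ i, (ε ^ 2 + 1 / (2 * δ) * P.real {ω | ε ≤ |X n i ω - 1|} + δ / 2 * C) := by
    refine Finset.sum_le_sum fun i _ => (integral_sq_sub_one_le (ε := ε) (hX n i) (h4 n i).1 hδpos).trans ?_
    have := (h4 n i).2
    gcongr
  have h3 := hN n hn
  rw [Real.dist_0_eq_abs] at h3
  have h3' := (le_abs_self _).trans_lt h3
  rw [Finset.sum_add_distrib, Finset.sum_add_distrib, ← Finset.mul_sum, Finset.sum_const,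
    Finset.sum_const, Finset.card_univ, Fintype.card_fin, nsmul_eq_mul, nsmul_eq_mul] at h2
  have h4' : (1 / (n : ℝ)) * ∑ i, ∫ ω, (X n i ω - 1) ^ 2 ∂P ≤ (1 / (n : ℝ)) *
      (n * ε ^ 2 + 1 / (2 * δ) * ∑ i, P.real {ω | ε ≤ |X n i ω - 1|} + n * (δ / 2 * C)) := by
    gcongr
  have h5 : (1 / (n : ℝ)) * (n * ε ^ 2 + 1 / (2 * δ) * ∑ i, P.real {ω | ε ≤ |X n i ω - 1|} +
      n * (δ / 2 * C)) = ε ^ 2 + 1 / (2 * δ) * (1 / (n : ℝ) *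
      ∑ i, P.real {ω | ε ≤ |X n i ω - 1|}) + δ / 2 * C := by
    field_simp
  rw [h5] at h4'
  linarith

theorem average_sub_one_pow_four_le {n : ℕ} (x : Fin n → ℝ) (hx : ∀ i, 0 ≤ x i) :
    ((1 / (n : ℝ)) * ∑ j, x j - 1) ^ 4 ≤ 8 * ((1 / (n : ℝ)) * ∑ j, x j ^ 4) + 8 := by
  have h1 : ((1 / (n : ℝ)) * ∑ j, x j) ^ 4 ≤ (1 / (n : ℝ)) * ∑ j, x j ^ 4 := by
    rcases Nat.eq_zero_or_pos n with rfl | hn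
    · simp
    have hn' : (n : ℝ) ≠ 0 := by positivity
    have := Real.pow_arith_mean_le_arith_mean_pow Finset.univ (fun _ : Fin n => 1 / (n : ℝ)) x
      (fun i _ => by positivity) (by simp [hn']) (fun i _ => hx i) 4
    simpa only [← Finset.mul_sum] using this
  generalize (1 / (n : ℝ)) * ∑ j, x j = s at h1
  nlinarith [sq_nonneg (s + 1), sq_nonneg (s ^ 2 - 1), sq_nonneg (s - 1),
    mul_nonneg (sq_nonneg (s + 1)) (sq_nonneg (s + 1)), sq_nonneg (s ^ 2 + 2 * s + 1),
    sq_nonneg (s ^ 2 - 2 * s + 1)]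

/-- By Jensen's inequality the fourth power of an average of squared entries is at most the average
of their eighth powers, whose means (A1) bounds. -/
theorem RowModel.integrable_dirNormSq_pow (h : RowModel P A ν) (ε : Bool) :
    ∃ C : ℝ, ∀ n (i : Fin n), Integrable (fun ω => (dirNormSq ε (A n ω) i - 1) ^ 4) P ∧
      ∫ ω, (dirNormSq ε (A n ω) i - 1) ^ 4 ∂P ≤ C := by
  obtain ⟨C, hC, hA⟩ := h.exists_moment_bound 8
  refine ⟨8 * C + 8, fun n i => ?_⟩
  have hn : 0 < (n : ℝ) := by
    have : 0 < n := i.pos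
    exact_mod_cast this
  have hI : Integrable (fun ω => 8 * ((1 / (n : ℝ)) *
      ∑ a, ‖dirEntry ε (A n ω) i a‖ ^ 8) + 8) P := by
    refine Integrable.add (Integrable.const_mul (Integrable.const_mul ?_ _) _) (integrable_const _)
    exact integrable_finsetSum _ fun a _ => (hA n _ _).1
  have hpt : ∀ ω, (dirNormSq ε (A n ω) i - 1) ^ 4 ≤ 8 * ((1 / (n : ℝ)) *
      ∑ a, ‖dirEntry ε (A n ω) i a‖ ^ 8) + 8 := by
    intro ω
    have := average_sub_one_pow_four_le (fun a => ‖dirEntry ε (A n ω) i a‖ ^ 2)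
      (fun a => by positivity)
    simpa only [← pow_mul, dirNormSq] using this
  have h4 : Integrable (fun ω => (dirNormSq ε (A n ω) i - 1) ^ 4) P := by
    refine hI.mono' (((h.aemeasurable_dirNormSq ε n i).sub_const 1).pow_const 4).aestronglyMeasurable
      (Eventually.of_forall fun ω => ?_)
    rw [Real.norm_of_nonneg (by positivity)]
    exact hpt ω
  refine ⟨h4, (integral_mono h4 hI hpt).trans ?_⟩
  have hI8 : Integrable (fun ω => ∑ a, ‖dirEntry ε (A n ω) i a‖ ^ 8) P :=
    integrable_finsetSum _ fun a _ => (hA n _ _).1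
  rw [integral_add ((hI8.const_mul _).const_mul _) (integrable_const _), integral_const_mul,
    integral_const_mul,
    integral_finsetSum (f := fun a ω => ‖dirEntry ε (A n ω) i a‖ ^ 8) _ fun a _ => (hA n _ _).1]
  have hs : ∑ a : Fin n, ∫ ω, ‖dirEntry ε (A n ω) i a‖ ^ 8 ∂P ≤ ∑ a : Fin n, C :=
    Finset.sum_le_sum fun a _ => (hA n _ _).2
  rw [Finset.sum_const, Finset.card_univ, Fintype.card_fin, nsmul_eq_mul] at hs
  have : (1 / (n : ℝ)) * ∑ a : Fin n, ∫ ω, ‖dirEntry ε (A n ω) i a‖ ^ 8 ∂P ≤ C := by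
    calc _ ≤ (1 / (n : ℝ)) * (n * C) := by gcongr
      _ = C := by field_simp
  simp
  simp at this
  linarith

theorem RowModel.tendsto_average_dirNormSq (h : RowModel P A ν) (ε : Bool) :
    Tendsto (fun n : ℕ => (1 / (n : ℝ)) * ∑ i, ∫ ω, (dirNormSq ε (A n ω) i - 1) ^ 2 ∂P)
      atTop (𝓝 0) := by
  obtain ⟨C, hC⟩ := h.integrable_dirNormSq_pow ε
  refine tendsto_average_integral_sq (fun n i => h.aemeasurable_dirNormSq ε n i) C hC
    fun η hη => ?_
  -- The letter `true` averages along rows and `false` along columns: the two halves of (A3).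
  cases ε
  · exact (h.a3 η hη).2
  · exact (h.a3 η hη).1

end Moments

end RowDependent

end

/-! ### Sums over labelled trees -/

noncomputable section

namespace RowDependent

variable {Ω : Type*} [MeasurableSpace Ω]

section Resampling

variable {κ : Type*} [Fintype κ] [DecidableEq κ] {n : ℕ}

/-- Summing over all labellings is the same as averaging over one label first. -/
theorem sum_update_eq (a : κ) (g : (κ → Fin n) → ℝ) :
    ∑ f : κ → Fin n, ∑ b, g (Function.update f a b) = n * ∑ f, g f := by
  have h1 : ∑ f : κ → Fin n, ∑ b, g (Function.update f a b) =
      ∑ x : (κ → Fin n) × Fin n, g (Function.update x.1 a x.2) :=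
    (Fintype.sum_prod_type' fun f b => g (Function.update f a b)).symm
  have h2 : ∑ x : (κ → Fin n) × Fin n, g (Function.update x.1 a x.2) =
      ∑ x : (κ → Fin n) × Fin n, g x.1 := by
    -- Exchanging the label of `a` with the resampled value is an involution.
    let e : (κ → Fin n) × Fin n → (κ → Fin n) × Fin n :=
      fun x => (Function.update x.1 a x.2, x.1 a)
    have he : Function.Involutive e := fun x => by simp [e]
    exact Fintype.sum_equiv he.toPerm _ _ fun x => rfl
  rw [h1, h2, Fintype.sum_prod_type]
  simp [Finset.mul_sum]

theorem sum_apply_eq (a : κ) (h : Fin n → ℝ) (hn : n ≠ 0) :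
    1 / (n : ℝ) ^ Fintype.card κ * ∑ f : κ → Fin n, h (f a) = 1 / (n : ℝ) * ∑ b, h b := by
  have := sum_update_eq a fun f : κ → Fin n => h (f a)
  simp only [Function.update_self, Finset.sum_const, Finset.card_univ, Fintype.card_fun,
    Fintype.card_fin, nsmul_eq_mul] at this
  have hn' : (n : ℝ) ≠ 0 := by exact_mod_cast hn
  push_cast at this
  field_simp
  linarith

end Resampling

/-- The first term vanishes in the limit for every fixed `δ`, and the second is small with `δ`. -/
theorem tendsto_zero_of_forall_le {x D : ℕ → ℝ} {C : ℝ} (hD : Tendsto D atTop (𝓝 0))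
    (h : ∀ δ : ℝ, 0 < δ → ∀ᶠ n in atTop, |x n| ≤ 1 / (2 * δ) * D n + δ / 2 * C) :
    Tendsto x atTop (𝓝 0) := by
  rw [Metric.tendsto_nhds]
  intro η hη
  set δ := η / (|C| + 1) with hδ
  have hδpos : 0 < δ := by positivity
  have hδC : δ / 2 * C ≤ η / 2 := by
    have h1 : δ * (|C| + 1) = η := by rw [hδ]; field_simp
    nlinarith [le_abs_self C, abs_nonneg C]
  have h2 : Tendsto (fun n => 1 / (2 * δ) * D n) atTop (𝓝 0) := by
    simpa using hD.const_mul (1 / (2 * δ))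
  filter_upwards [h δ hδpos, h2.eventually_lt_const (half_pos hη)] with n h3 h4
  rw [Real.dist_0_eq_abs]
  linarith

variable {P : Measure Ω}
  {A : (n : ℕ) → Ω → Matrix (Fin n) (Fin n) ℂ} {ν : (n : ℕ) → Measure (Fin n → ℂ)}

/-- The sum over all labellings of the vertices of a tree of the expected products of the squared
entries along the edges. -/
def treeSum (P : Measure Ω) {κ : Type*} [Fintype κ] [DecidableEq κ] {n : ℕ}
    (M : Ω → Matrix (Fin n) (Fin n) ℂ) (E : List (κ × κ)) : ℝ :=
  ∑ f : κ → Fin n, ∫ ω, posWeight (M ω) (E.map (Prod.map f f)) ^ 2 ∂P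

theorem posWeight_cons_stepPos {κ : Type*} {n : ℕ} (M : Matrix (Fin n) (Fin n) ℂ) (ε : Bool)
    (u a : κ) (l : List (κ × κ)) (f : κ → Fin n) :
    posWeight M ((stepPos ε u a :: l).map (Prod.map f f)) =
      ‖dirEntry ε M (f u) (f a)‖ * posWeight M (l.map (Prod.map f f)) := by
  cases ε <;> simp [posWeight, dirEntry, stepPos]

theorem abs_integral_mul_le {W S : Ω → ℝ} (hW : Integrable (fun ω => W ω ^ 2) P)
    (hS : Integrable (fun ω => S ω ^ 2) P) {δ : ℝ} (hδ : 0 < δ) :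
    |∫ ω, W ω * S ω ∂P| ≤ 1 / (2 * δ) * ∫ ω, S ω ^ 2 ∂P + δ / 2 * ∫ ω, W ω ^ 2 ∂P := by
  rw [← integral_const_mul, ← integral_const_mul, ← integral_add (hS.const_mul _) (hW.const_mul _),
    ← Real.norm_eq_abs]
  refine norm_integral_le_of_norm_le ((hS.const_mul _).add (hW.const_mul _))
    (Eventually.of_forall fun ω => ?_)
  rw [Real.norm_eq_abs, abs_le]
  have h1 : 1 / (2 * δ) * S ω ^ 2 + δ / 2 * W ω ^ 2 - W ω * S ω = (S ω - δ * W ω) ^ 2 / (2 * δ) := by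
    field_simp
    ring
  have h2 : 1 / (2 * δ) * S ω ^ 2 + δ / 2 * W ω ^ 2 + W ω * S ω = (S ω + δ * W ω) ^ 2 / (2 * δ) := by
    field_simp
    ring
  have h3 : 0 ≤ (S ω - δ * W ω) ^ 2 / (2 * δ) := by positivity
  have h4 : 0 ≤ (S ω + δ * W ω) ^ 2 / (2 * δ) := by positivity
  constructor <;> linarith

/-- An entry of `M`, conjugated if the letter is a star. -/
def letterEntry {n : ℕ} (M : Matrix (Fin n) (Fin n) ℂ) (ε : Bool) (e : Fin n × Fin n) : ℂ :=
  if ε then M e.1 e.2 else conj (M e.1 e.2)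

/-- The product of the entries at the positions `(r l, c l)`, conjugated as the word `w` says. -/
def monomial {n m : ℕ} (M : Matrix (Fin n) (Fin n) ℂ) (w : Fin m → Bool) (r c : Fin m → Fin n) :
    ℂ :=
  ∏ l, letterEntry M (w l) (r l, c l)

theorem norm_letterEntry {n : ℕ} (M : Matrix (Fin n) (Fin n) ℂ) (ε : Bool) (e : Fin n × Fin n) :
    ‖letterEntry M ε e‖ = ‖M e.1 e.2‖ := by
  cases ε <;> simp [letterEntry]

theorem norm_monomial {n m : ℕ} (M : Matrix (Fin n) (Fin n) ℂ) (w : Fin m → Bool)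
    (r c : Fin m → Fin n) :
    ‖monomial M w r c‖ = posWeight M (List.ofFn fun l => (r l, c l)) := by
  simp [monomial, posWeight, norm_letterEntry, List.map_ofFn, List.prod_ofFn]

theorem HasIIDRows.aemeasurable_monomial {n m : ℕ} {M : Ω → Matrix (Fin n) (Fin n) ℂ}
    {ν : Measure (Fin n → ℂ)} (h : HasIIDRows M ν P) (w : Fin m → Bool) (r c : Fin m → Fin n) :
    AEMeasurable (fun ω => monomial (M ω) w r c) P := by
  refine Finset.aemeasurable_fun_prod _ fun l _ => ?_
  unfold letterEntry
  split_ifs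
  · exact h.aemeasurable_entry _ _
  · exact Complex.continuous_conj.measurable.comp_aemeasurable (h.aemeasurable_entry _ _)

variable [IsProbabilityMeasure P]

theorem RowModel.integrable_posWeight_pow (h : RowModel P A ν) (N p : ℕ) :
    ∃ C : ℝ, 0 ≤ C ∧ ∀ n (E : List (Fin n × Fin n)), E.length ≤ N →
      Integrable (fun ω => posWeight (A n ω) E ^ p) P ∧
        ∫ ω, posWeight (A n ω) E ^ p ∂P ≤ C := by
  obtain ⟨C, hC, hb⟩ := h.exists_posWeight_bound (p * N)
  refine ⟨C, hC, fun n E hE => ?_⟩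
  have hpow : ∀ (M : Matrix (Fin n) (Fin n) ℂ) (q : ℕ),
      posWeight M (List.replicate q E).flatten = posWeight M E ^ q := by
    intro M q
    induction q with
    | zero => simp [posWeight]
    | succ q ih => rw [List.replicate_succ, List.flatten_cons, posWeight_append, ih, pow_succ']
  have := hb n (List.replicate p E).flatten (by
    simp only [List.length_flatten, List.map_replicate, List.sum_replicate, smul_eq_mul]
    gcongr)
  simpa only [hpow] using this

theorem RowModel.integrable_dirNormSq_sq (h : RowModel P A ν) (ε : Bool) (n : ℕ) (i : Fin n) :
    Integrable (fun ω => (dirNormSq ε (A n ω) i - 1) ^ 2) P := by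
  obtain ⟨C, hC⟩ := h.integrable_dirNormSq_pow ε
  have hm := (h.aemeasurable_dirNormSq ε n i).sub_const 1
  refine ((integrable_const 1).add (hC n i).1).mono' (hm.pow_const 2).aestronglyMeasurable
    (Eventually.of_forall fun ω => ?_)
  rw [Real.norm_of_nonneg (sq_nonneg _)]
  simp only [Pi.add_apply]
  nlinarith [sq_nonneg ((dirNormSq ε (A n ω) i - 1) ^ 2 - 1)]

/-- The label of the leaf `a` enters through the new edge only. Averaging over it replaces the
squared entry on that edge by `dirNormSq` at the other end `u`. -/
theorem RowModel.treeSum_cons_sub (h : RowModel P A ν) {κ : Type*} [Fintype κ] [DecidableEq κ]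
    (ε : Bool) (u a : κ) (l : List (κ × κ)) (hu : u ≠ a) (ha : ∀ e ∈ l, e.1 ≠ a ∧ e.2 ≠ a)
    {n : ℕ} (hn : n ≠ 0) :
    treeSum P (A n) (stepPos ε u a :: l) - treeSum P (A n) l =
      ∑ f : κ → Fin n, ∫ ω, posWeight (A n ω) (l.map (Prod.map f f)) ^ 2 *
        (dirNormSq ε (A n ω) (f u) - 1) ∂P := by
  have hn' : (n : ℝ) ≠ 0 := by exact_mod_cast hn
  have hupd : ∀ (f : κ → Fin n) (b : Fin n),
      l.map (Prod.map (Function.update f a b) (Function.update f a b)) = l.map (Prod.map f f) := by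
    intro f b
    refine List.map_congr_left fun e he => ?_
    obtain ⟨h1, h2⟩ := ha e he
    simp [Prod.map, Function.update_of_ne h1, Function.update_of_ne h2]
  obtain ⟨C, -, hint⟩ := h.integrable_posWeight_pow (l.length + 1) 2
  have hI1 : ∀ (f : κ → Fin n) (b : Fin n), Integrable (fun ω =>
      (‖dirEntry ε (A n ω) (f u) b‖ * posWeight (A n ω) (l.map (Prod.map f f))) ^ 2) P := by
    intro f b
    have := (hint n (stepPos ε (f u) b :: l.map (Prod.map f f)) (by simp)).1
    simpa only [posWeight, List.map_cons, List.prod_cons, dirEntry] using this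
  have hI2 : ∀ (f : κ → Fin n), Integrable (fun ω =>
      posWeight (A n ω) (l.map (Prod.map f f)) ^ 2) P :=
    fun f => (hint n (l.map (Prod.map f f)) (by simp)).1
  have hsum := sum_update_eq a fun f : κ → Fin n =>
    ∫ ω, posWeight (A n ω) ((stepPos ε u a :: l).map (Prod.map f f)) ^ 2 ∂P
  simp only [posWeight_cons_stepPos, hupd, Function.update_self, Function.update_of_ne hu] at hsum
  have h1 : treeSum P (A n) (stepPos ε u a :: l) = (1 / (n : ℝ)) * ∑ f : κ → Fin n, ∑ b,
      ∫ ω, (‖dirEntry ε (A n ω) (f u) b‖ * posWeight (A n ω) (l.map (Prod.map f f))) ^ 2 ∂P := by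
    rw [hsum, treeSum]
    simp only [posWeight_cons_stepPos]
    field_simp
  rw [h1, treeSum, Finset.mul_sum, ← Finset.sum_sub_distrib]
  refine Finset.sum_congr rfl fun f _ => ?_
  rw [← integral_finsetSum _ fun b _ => hI1 f b, ← integral_const_mul,
    ← integral_sub ((integrable_finsetSum _ fun b _ => hI1 f b).const_mul _) (hI2 f)]
  refine integral_congr_ae (Eventually.of_forall fun ω => ?_)
  simp only [dirNormSq, mul_pow, ← Finset.sum_mul]
  ring

/-- Leaves are stripped one at a time. By Young's inequality the error of one step is bounded by the
mean square of `dirNormSq - 1`, averaged over the label of `u`, plus `δ / 2` times a bounded mean of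
a fourth power. The norming exponent is the same at all steps, since vertices without edges keep
their free labels. -/
theorem RowModel.tendsto_treeSum (h : RowModel P A ν) {κ : Type*} [Fintype κ] [DecidableEq κ]
    {E : List (κ × κ)} (hE : IsTreeList E) :
    Tendsto (fun n : ℕ => 1 / (n : ℝ) ^ Fintype.card κ * treeSum P (A n) E) atTop (𝓝 1) := by
  induction hE with
  | nil =>
    refine tendsto_const_nhds.congr' ?_
    filter_upwards [eventually_gt_atTop 0] with n hn
    have hn' : (n : ℝ) ≠ 0 := by positivity
    simp [treeSum, posWeight, hn']
  | cons ε u a l hl hu ha ih =>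
    suffices hs : Tendsto (fun n : ℕ => 1 / (n : ℝ) ^ Fintype.card κ *
        (treeSum P (A n) (stepPos ε u a :: l) - treeSum P (A n) l)) atTop (𝓝 0) by
      have := hs.add ih
      simp only [mul_sub, sub_add_cancel, zero_add] at this
      exact this
    obtain ⟨C, hC, hint⟩ := h.integrable_posWeight_pow l.length 4
    refine tendsto_zero_of_forall_le (h.tendsto_average_dirNormSq ε) (C := C) fun δ hδ => ?_
    filter_upwards [eventually_gt_atTop 0] with n hn
    have hn' : (n : ℝ) ≠ 0 := by positivity
    rw [h.treeSum_cons_sub ε u a l hu ha hn.ne', abs_mul, abs_of_nonneg (by positivity)]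
    have hterm : ∀ f : κ → Fin n, |∫ ω, posWeight (A n ω) (l.map (Prod.map f f)) ^ 2 *
        (dirNormSq ε (A n ω) (f u) - 1) ∂P| ≤
        1 / (2 * δ) * ∫ ω, (dirNormSq ε (A n ω) (f u) - 1) ^ 2 ∂P + δ / 2 * C := by
      intro f
      have h4 := hint n (l.map (Prod.map f f)) (by simp)
      have heq : ∀ ω, (posWeight (A n ω) (l.map (Prod.map f f)) ^ 2) ^ 2 =
          posWeight (A n ω) (l.map (Prod.map f f)) ^ 4 := fun ω => by ring
      have := abs_integral_mul_le (P := P)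
        (W := fun ω => posWeight (A n ω) (l.map (Prod.map f f)) ^ 2)
        (by simpa only [heq] using h4.1) (h.integrable_dirNormSq_sq ε n (f u)) hδ
      simp only [heq] at this
      refine this.trans ?_
      have := h4.2
      gcongr
    calc 1 / (n : ℝ) ^ Fintype.card κ * |∑ f : κ → Fin n, ∫ ω,
          posWeight (A n ω) (l.map (Prod.map f f)) ^ 2 * (dirNormSq ε (A n ω) (f u) - 1) ∂P|
        ≤ 1 / (n : ℝ) ^ Fintype.card κ * ∑ f : κ → Fin n,
          (1 / (2 * δ) * ∫ ω, (dirNormSq ε (A n ω) (f u) - 1) ^ 2 ∂P + δ / 2 * C) := by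
          gcongr
          exact (Finset.abs_sum_le_sum_abs _ _).trans (Finset.sum_le_sum fun f _ => hterm f)
      _ = 1 / (2 * δ) * (1 / (n : ℝ) ^ Fintype.card κ * ∑ f : κ → Fin n,
          ∫ ω, (dirNormSq ε (A n ω) (f u) - 1) ^ 2 ∂P) + δ / 2 * C := by
          rw [Finset.sum_add_distrib, ← Finset.mul_sum, Finset.sum_const, Finset.card_univ,
            Fintype.card_fun, Fintype.card_fin, nsmul_eq_mul]
          push_cast
          field_simp
      _ = _ := by
          rw [sum_apply_eq u (fun b => ∫ ω, (dirNormSq ε (A n ω) b - 1) ^ 2 ∂P) hn.ne']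

theorem RowModel.exists_monomial_bound (h : RowModel P A ν) (m : ℕ) :
    ∃ C : ℝ, 0 ≤ C ∧ ∀ n (w : Fin m → Bool) (r c : Fin m → Fin n),
      Integrable (fun ω => monomial (A n ω) w r c) P ∧ ‖∫ ω, monomial (A n ω) w r c ∂P‖ ≤ C := by
  obtain ⟨C, hC, hb⟩ := h.exists_posWeight_bound m
  refine ⟨C, hC, fun n w r c => ?_⟩
  obtain ⟨h1, h2⟩ := hb n (List.ofFn fun l => (r l, c l)) (by simp)
  simp only [← norm_monomial _ w] at h1 h2
  exact ⟨(integrable_norm_iff ((h.iid n).aemeasurable_monomial w r c).aestronglyMeasurable).1 h1,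
    (norm_integral_le_integral_norm _).trans h2⟩

section CyclicMonomials

variable {k : ℕ} {κ : Type*}

theorem monomial_cyclic {n : ℕ} (M : Matrix (Fin n) (Fin n) ℂ) (w : Fin (k + 1) → Bool)
    (v : Fin (k + 1) → κ) (f : κ → Fin n) :
    monomial M w (rowIdx w (f ∘ v)) (colIdx w (f ∘ v)) =
      ((walkEdges (v (Fin.last k)) (walkSteps w v)).map
        fun e => letterEntry M e.1 (Prod.map f f e.2)).prod := by
  rw [walkEdges_cyclic, List.map_ofFn, List.prod_ofFn, rowIdx_comp, colIdx_comp]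
  rfl

theorem monomial_of_perm {n : ℕ} (M : Matrix (Fin n) (Fin n) ℂ) {w : Fin (k + 1) → Bool}
    {v : Fin (k + 1) → κ} {l : List (κ × κ)}
    (hl : (walkEdges (v (Fin.last k)) (walkSteps w v)).Perm
      (l.map (fun e => (true, e)) ++ l.map (fun e => (false, e)))) (f : κ → Fin n) :
    monomial M w (rowIdx w (f ∘ v)) (colIdx w (f ∘ v)) =
      ((posWeight M (l.map (Prod.map f f)) ^ 2 : ℝ) : ℂ) := by
  rw [monomial_cyclic, (hl.map _).prod_eq, List.map_append, List.prod_append]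
  clear hl
  induction l with
  | nil => simp [posWeight]
  | cons e l ih =>
    simp only [List.map_cons, List.prod_cons, posWeight, letterEntry, if_true] at ih ⊢
    rw [mul_mul_mul_comm, ih, mul_pow, Complex.ofReal_mul]
    congr 1
    simp only [Bool.false_eq_true, if_false]
    rw [Complex.mul_conj, Complex.normSq_eq_norm_sq]

theorem tendsto_card_filter_not_injective (κ : Type*) [Fintype κ]
    [DecidableEq κ] :
    Tendsto (fun n : ℕ => 1 / (n : ℝ) ^ Fintype.card κ *
      ((Finset.univ.filter fun f : κ → Fin n => ¬ Function.Injective f).card : ℝ))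
      atTop (𝓝 0) := by
  have h1 := (isEquivalent_iff_tendsto_one (by
    filter_upwards [eventually_gt_atTop 0] with n hn
    positivity)).1 (isEquivalent_descFactorial (Fintype.card κ))
  have h2 := h1.const_sub (1 : ℝ)
  rw [sub_self] at h2
  refine h2.congr' ?_
  filter_upwards [eventually_gt_atTop 0] with n hn
  have hn' : (n : ℝ) ≠ 0 := by positivity
  have h3 : (Finset.univ.filter fun f : κ → Fin n => Function.Injective f).card =
      n.descFactorial (Fintype.card κ) := by
    rw [← Fintype.card_subtype, Fintype.card_congr (Equiv.subtypeInjectiveEquivEmbedding κ (Fin n)),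
      Fintype.card_embedding_eq, Fintype.card_fin]
  have h4 := Finset.card_filter_add_card_filter_not (s := (Finset.univ : Finset (κ → Fin n)))
    Function.Injective
  rw [h3, Finset.card_univ, Fintype.card_fun, Fintype.card_fin] at h4
  have h5 : ((Finset.univ.filter fun f : κ → Fin n => ¬ Function.Injective f).card : ℝ) =
      (n : ℝ) ^ Fintype.card κ - n.descFactorial (Fintype.card κ) := by
    rw [eq_sub_iff_add_eq', ← Nat.cast_pow, ← h4]
    push_cast
    ring
  rw [h5]
  simp only [Pi.div_apply]
  field_simp

/-- For all labellings this is the tree sum, which tends to one. The labellings that are not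
injective are a vanishing fraction, and the expectations are bounded. -/
theorem RowModel.tendsto_sum_injective (h : RowModel P A ν) [Fintype κ] [DecidableEq κ]
    {w : Fin (k + 1) → Bool} {v : Fin (k + 1) → κ}
    (hv : TreeWalk (v (Fin.last k)) (walkSteps w v)) :
    Tendsto (fun n : ℕ => (1 / (n : ℂ) ^ Fintype.card κ) *
      ∑ f : κ → Fin n with Function.Injective f,
        ∫ ω, monomial (A n ω) w (rowIdx w (f ∘ v)) (colIdx w (f ∘ v)) ∂P) atTop (𝓝 1) := by
  classical
  obtain ⟨l, hl, -, hperm⟩ := hv.exists_treeList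
  obtain ⟨C, hC, hb⟩ := h.exists_monomial_bound (k + 1)
  have hfull : Tendsto (fun n : ℕ => (1 / (n : ℂ) ^ Fintype.card κ) *
      ∑ f : κ → Fin n, ∫ ω, monomial (A n ω) w (rowIdx w (f ∘ v)) (colIdx w (f ∘ v)) ∂P)
      atTop (𝓝 1) := by
    have := (Complex.continuous_ofReal.tendsto 1).comp (h.tendsto_treeSum hl)
    rw [Complex.ofReal_one] at this
    refine this.congr fun n => ?_
    simp only [Function.comp_apply, treeSum]
    push_cast
    congr 1
    refine Finset.sum_congr rfl fun f _ => ?_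
    simp only [monomial_of_perm _ hperm f]
    rw [integral_complex_ofReal]
  have hrest : Tendsto (fun n : ℕ => (1 / (n : ℂ) ^ Fintype.card κ) *
      ∑ f : κ → Fin n with ¬ Function.Injective f,
        ∫ ω, monomial (A n ω) w (rowIdx w (f ∘ v)) (colIdx w (f ∘ v)) ∂P) atTop (𝓝 0) := by
    have hlim := (tendsto_card_filter_not_injective κ).mul_const C
    rw [zero_mul] at hlim
    refine squeeze_zero_norm (fun n => ?_) hlim
    rw [norm_mul, norm_div, norm_pow, norm_one, Complex.norm_natCast, mul_assoc]
    refine mul_le_mul_of_nonneg_left ?_ (by positivity)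
    refine (norm_sum_le_of_le _ fun f _ => (hb n w _ _).2).trans (le_of_eq ?_)
    rw [Finset.sum_const, nsmul_eq_mul]
  have := hfull.sub hrest
  rw [sub_zero] at this
  refine this.congr fun n => ?_
  rw [← mul_sub]
  congr 1
  rw [sub_eq_iff_eq_add, Finset.sum_filter_add_sum_filter_not]

end CyclicMonomials

end RowDependent

end

/-! ### Walks with a simple position: using (A2) -/

noncomputable section

namespace RowDependent

variable {Ω : Type*} [MeasurableSpace Ω] {P : Measure Ω}

section IIDRows

variable {n m : ℕ} {M : Ω → Matrix (Fin n) (Fin n) ℂ} {ν : Measure (Fin n → ℂ)}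

theorem HasIIDRows.map_eq [IsProbabilityMeasure P] (h : HasIIDRows M ν P) :
    P.map (fun ω i => M ω i) = Measure.pi fun _ : Fin n => ν := by
  rw [(iIndepFun_iff_map_fun_eq_pi_map fun i => (h.hasLaw i).aemeasurable).1 h.indep]
  congr 1
  funext i
  exact (h.hasLaw i).map_eq

theorem HasIIDRows.reindex (h : HasIIDRows M ν P) (σ : Equiv.Perm (Fin n)) :
    HasIIDRows (fun ω i => M ω (σ i)) ν P :=
  ⟨fun i => h.hasLaw (σ i), h.indep.precomp σ.injective⟩

theorem HasIIDRows.aemeasurable (h : HasIIDRows M ν P) :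
    AEMeasurable (fun ω i => M ω i) P :=
  aemeasurable_pi_lambda _ fun i => (h.hasLaw i).aemeasurable

theorem measurable_monomial (w : Fin m → Bool) (r c : Fin m → Fin n) :
    Measurable fun x : Fin n → Fin n → ℂ => monomial x w r c := by
  refine Finset.measurable_fun_prod _ fun l _ => ?_
  have h1 : Measurable fun x : Fin n → Fin n → ℂ => x (r l) (c l) :=
    (measurable_pi_apply _).comp (measurable_pi_apply _)
  unfold letterEntry
  split_ifs
  · exact h1
  · exact Complex.continuous_conj.measurable.comp h1

/-- Independent rows with a common law are exchangeable. -/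
theorem HasIIDRows.integral_monomial_reindex [IsProbabilityMeasure P] (h : HasIIDRows M ν P) (σ : Equiv.Perm (Fin n))
    (w : Fin m → Bool) (r c : Fin m → Fin n) :
    ∫ ω, monomial (M ω) w (σ ∘ r) c ∂P = ∫ ω, monomial (M ω) w r c ∂P := by
  have h1 : ∀ {N : Ω → Matrix (Fin n) (Fin n) ℂ}, HasIIDRows N ν P →
      ∫ ω, monomial (N ω) w r c ∂P =
        ∫ x, monomial x w r c ∂(Measure.pi fun _ : Fin n => ν) := fun hN => by
    rw [← hN.map_eq, integral_map hN.aemeasurable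
      (measurable_monomial w r c).aestronglyMeasurable]
  rw [h1 h, ← h1 (h.reindex σ)]
  rfl

theorem HasIIDRows.integral_monomial_mul_conj (h : HasIIDRows M ν P) (w : Fin m → Bool)
    (r c r' c' : Fin m → Fin n) (hd : ∀ l l', r l ≠ r' l') :
    ∫ ω, monomial (M ω) w r c * conj (monomial (M ω) w r' c') ∂P =
      (∫ ω, monomial (M ω) w r c ∂P) * conj (∫ ω, monomial (M ω) w r' c' ∂P) := by
  classical
  let S := Finset.univ.image r
  let T := Finset.univ.image r'
  have hST : Disjoint S T := by
    rw [Finset.disjoint_left]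
    intro i hi hi'
    obtain ⟨l, -, rfl⟩ := Finset.mem_image.1 hi
    obtain ⟨l', -, hl'⟩ := Finset.mem_image.1 hi'
    exact hd l l' hl'.symm
  have hind := h.indep.indepFun_finset₀ S T hST fun i => (h.hasLaw i).aemeasurable
  let g : (U : Finset (Fin n)) → (ρ : Fin m → Fin n) → (∀ l, ρ l ∈ U) → (Fin m → Fin n) →
      (U → Fin n → ℂ) → ℂ := fun U ρ hρ γ x =>
    ∏ l, if w l then x ⟨ρ l, hρ l⟩ (γ l) else conj (x ⟨ρ l, hρ l⟩ (γ l))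
  have hg : ∀ U ρ hρ γ, Measurable (g U ρ hρ γ) := by
    intro U ρ hρ γ
    refine Finset.measurable_fun_prod _ fun l _ => ?_
    have h1 : Measurable fun x : U → Fin n → ℂ => x ⟨ρ l, hρ l⟩ (γ l) :=
      (measurable_pi_apply _).comp (measurable_pi_apply _)
    split_ifs
    · exact h1
    · exact Complex.continuous_conj.measurable.comp h1
  have hrS : ∀ l, r l ∈ S := fun l => Finset.mem_image_of_mem _ (Finset.mem_univ _)
  have hrT : ∀ l, r' l ∈ T := fun l => Finset.mem_image_of_mem _ (Finset.mem_univ _)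
  have hind2 : IndepFun (fun ω => monomial (M ω) w r c)
      (fun ω => conj (monomial (M ω) w r' c')) P :=
    hind.comp (hg S r hrS c) (Complex.continuous_conj.measurable.comp (hg T r' hrT c'))
  have hm1 := (h.aemeasurable_monomial w r c).aestronglyMeasurable
  have hm2 := (h.aemeasurable_monomial w r' c')
  have := hind2.integral_fun_mul_eq_mul_integral hm1
    (Complex.continuous_conj.measurable.comp_aemeasurable hm2).aestronglyMeasurable
  rw [this, integral_conj]

/-- The row or column indices of a product of a monomial and the conjugate of another one, sorted
into unconjugated and conjugated factors. -/
def mergeIdx (w : Fin m → Bool) (r r' : Fin m → Fin n) : Fin m ⊕ Fin m → Fin n :=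
  Sum.elim (fun l => if w l then r l else r' l) fun l => if w l then r' l else r l

theorem mergeIdx_injective (w : Fin m → Bool) :
    Function.Injective fun x : (Fin m → Fin n) × (Fin m → Fin n) => mergeIdx w x.1 x.2 := by
  rintro ⟨r, r'⟩ ⟨s, s'⟩ h
  rw [Prod.mk.injEq]
  constructor <;> funext l
  · have h1 := congrFun h (Sum.inl l)
    have h2 := congrFun h (Sum.inr l)
    cases hw : w l <;> simp_all [mergeIdx]
  · have h1 := congrFun h (Sum.inl l)
    have h2 := congrFun h (Sum.inr l)
    cases hw : w l <;> simp_all [mergeIdx]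

/-- A monomial times the conjugate of another one with the same word has `m` plain and `m`
conjugated factors, whatever the word is, so its expectation is an entry of the tensor in (A2).
Having no row in common makes the two monomials independent. -/
theorem HasIIDRows.momentTensor_mergeIdx (h : HasIIDRows M ν P) (w : Fin m → Bool)
    (r c r' c' : Fin m → Fin n) (hd : ∀ l l', r l ≠ r' l') :
    ‖momentTensor P M m (mergeIdx w r r') (mergeIdx w c c')‖ =
      ‖∫ ω, monomial (M ω) w r c ∂P‖ * ‖∫ ω, monomial (M ω) w r' c' ∂P‖ := by
  rw [← RCLike.norm_conj (∫ ω, monomial (M ω) w r' c' ∂P), ← norm_mul,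
    ← h.integral_monomial_mul_conj w r c r' c' hd]
  congr 1
  simp only [momentTensor, Matrix.of_apply]
  refine integral_congr_ae (Eventually.of_forall fun ω => ?_)
  simp only [monomial, map_prod, ← Finset.prod_mul_distrib]
  refine Finset.prod_congr rfl fun l _ => ?_
  cases hw : w l <;> simp [mergeIdx, letterEntry, hw, mul_comm]

/-- A position simple in the first monomial cannot recur in the second, because it would share its
row. -/
theorem hasSimpleFactor_mergeIdx (w : Fin m → Bool) {r c r' c' : Fin m → Fin n}
    (hd : ∀ l l', r l ≠ r' l') (hs : HasSimpleFactor r c) :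
    HasSimpleFactor (mergeIdx w r r') (mergeIdx w c c') := by
  obtain ⟨l, hl⟩ := hs
  cases hw : w l
  · refine ⟨Sum.inr l, ?_⟩
    rintro (l' | l') h
    · cases hw' : w l' <;> simp [mergeIdx, hw, hw'] at h
      · exact absurd h.1.symm (hd _ _)
      · have := hl l' (by simp [h])
        simp_all
    · cases hw' : w l' <;> simp [mergeIdx, hw, hw'] at h
      · rw [hl l' (by simp [h])]
      · exact absurd h.1.symm (hd _ _)
  · refine ⟨Sum.inl l, ?_⟩
    rintro (l' | l') h
    · cases hw' : w l' <;> simp [mergeIdx, hw, hw'] at h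
      · exact absurd h.1.symm (hd _ _)
      · rw [hl l' (by simp [h])]
    · cases hw' : w l' <;> simp [mergeIdx, hw, hw'] at h
      · have := hl l' (by simp [h])
        simp_all
      · exact absurd h.1.symm (hd _ _)

theorem hasSimpleFactor_comp {ι : Type*} {σ : Fin n → Fin n} (hσ : Function.Injective σ)
    (r c : ι → Fin n) : HasSimpleFactor (σ ∘ r) c ↔ HasSimpleFactor r c := by
  simp [HasSimpleFactor, hσ.eq_iff]

open Classical in
/-- The sum of the absolute values of the expected monomials with row indices `r` that have a simple
factor. -/
def simpleRowSum (P : Measure Ω) (M : Ω → Matrix (Fin n) (Fin n) ℂ) (w : Fin m → Bool)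
    (r : Fin m → Fin n) : ℝ :=
  ∑ c : Fin m → Fin n, if HasSimpleFactor r c then ‖∫ ω, monomial (M ω) w r c ∂P‖ else 0

theorem simpleRowSum_nonneg (w : Fin m → Bool) (r : Fin m → Fin n) :
    0 ≤ simpleRowSum P M w r :=
  Finset.sum_nonneg fun c _ => by split_ifs <;> positivity

theorem HasIIDRows.simpleRowSum_comp [IsProbabilityMeasure P] (h : HasIIDRows M ν P) (σ : Equiv.Perm (Fin n))
    (w : Fin m → Bool) (r : Fin m → Fin n) :
    simpleRowSum P M w (σ ∘ r) = simpleRowSum P M w r := by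
  classical
  simp only [simpleRowSum, h.integral_monomial_reindex]
  refine Finset.sum_congr rfl fun c _ => ?_
  split_ifs with h1 h2 h2
  · rfl
  · exact absurd ((hasSimpleFactor_comp σ.injective r c).1 h1) h2
  · exact absurd ((hasSimpleFactor_comp σ.injective r c).2 h2) h1
  · rfl

-- Products over disjoint rows are tensor entries with a simple factor, and merging the indices is
-- injective, so no entry is used twice.
open Classical in
theorem HasIIDRows.sum_disjoint_simpleRowSum_le (h : HasIIDRows M ν P) (w : Fin m → Bool) :
    ∑ r : Fin m → Fin n, ∑ r' : Fin m → Fin n, (if ∀ l l', r l ≠ r' l' then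
      simpleRowSum P M w r * simpleRowSum P M w r' else 0) ≤ simpleMomentSum P M m := by
  let F : (Fin m ⊕ Fin m → Fin n) × (Fin m ⊕ Fin m → Fin n) → ℝ := fun x =>
    if HasSimpleFactor x.1 x.2 then ‖momentTensor P M m x.1 x.2‖ else 0
  have hF : ∀ x, 0 ≤ F x := fun x => by simp only [F]; split_ifs <;> positivity
  let e : ((Fin m → Fin n) × (Fin m → Fin n)) × ((Fin m → Fin n) × (Fin m → Fin n)) →
      (Fin m ⊕ Fin m → Fin n) × (Fin m ⊕ Fin m → Fin n) :=
    fun x => (mergeIdx w x.1.1 x.1.2, mergeIdx w x.2.1 x.2.2)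
  have he : Function.Injective e := (mergeIdx_injective w).prodMap (mergeIdx_injective w)
  have h1 : simpleMomentSum P M m = ∑ x, F x := by
    rw [Fintype.sum_prod_type]
    rfl
  have h2 : ∑ x, F (e x) ≤ ∑ x, F x := by
    rw [← Finset.sum_image (f := F) (fun x _ y _ hxy => he hxy)]
    exact Finset.sum_le_sum_of_subset_of_nonneg (Finset.subset_univ _) fun x _ _ => hF x
  rw [h1]
  refine le_trans ?_ h2
  rw [Fintype.sum_prod_type, Fintype.sum_prod_type]
  refine Finset.sum_le_sum fun r _ => Finset.sum_le_sum fun r' _ => ?_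
  split_ifs with hd
  · rw [simpleRowSum, simpleRowSum, Finset.sum_mul_sum, Fintype.sum_prod_type]
    refine Finset.sum_le_sum fun c _ => Finset.sum_le_sum fun c' _ => ?_
    split_ifs with hs hs'
    · simp only [F, e, hasSimpleFactor_mergeIdx w hd hs, if_true]
      rw [h.momentTensor_mergeIdx w r c r' c' hd]
    all_goals simp only [mul_zero, zero_mul]; exact hF _
  · exact Finset.sum_nonneg fun x _ => hF _

open Classical in
-- A shift can fail only if it is one of the `m * m` differences `r l - r' l'` modulo `n`.
theorem card_filter_shift_disjoint [NeZero n] (r r' : Fin m → Fin n) :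
    n ≤ (Finset.univ.filter fun s : Fin n => ∀ l l', r l ≠ r' l' + s).card + m * m := by
  have h1 := Finset.card_filter_add_card_filter_not (s := (Finset.univ : Finset (Fin n)))
    fun s => ∀ l l', r l ≠ r' l' + s
  have h2 : (Finset.univ.filter fun s : Fin n => ¬ ∀ l l', r l ≠ r' l' + s) ⊆
      Finset.univ.image fun x : Fin m × Fin m => r x.1 - r' x.2 := by
    intro s hs
    rw [Finset.mem_filter] at hs
    have := hs.2
    push Not at this
    obtain ⟨l, l', hl⟩ := this
    exact Finset.mem_image.2 ⟨(l, l'), Finset.mem_univ _, by simp [hl]⟩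
  have h3 := (Finset.card_le_card h2).trans Finset.card_image_le
  simp only [Finset.card_univ, Fintype.card_prod, Fintype.card_fin] at h1 h3
  omega

/-- A shift of the rows `r'` modulo `n` does not change `T r'`, and for at least half of all shifts
it makes `r'` disjoint from `r`. Averaging the sum over disjoint pairs over all shifts therefore
gives at least half of the full square. -/
theorem HasIIDRows.sq_sum_simpleRowSum_le [IsProbabilityMeasure P] (h : HasIIDRows M ν P) (w : Fin m → Bool)
    (hn : 2 * (m * m) ≤ n) (hn0 : n ≠ 0) :
    (∑ r, simpleRowSum P M w r) ^ 2 ≤ 2 * simpleMomentSum P M m := by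
  classical
  have : NeZero n := ⟨hn0⟩
  set T := simpleRowSum P M w with hT
  have hT0 : ∀ r, 0 ≤ T r := simpleRowSum_nonneg w
  set D := ∑ r : Fin m → Fin n, ∑ r' : Fin m → Fin n,
    (if ∀ l l', r l ≠ r' l' then T r * T r' else 0) with hD
  have hDle : D ≤ simpleMomentSum P M m := h.sum_disjoint_simpleRowSum_le w
  have hshift : ∀ s : Fin n, ∑ r : Fin m → Fin n, ∑ r' : Fin m → Fin n,
      (if ∀ l l', r l ≠ r' l' + s then T r * T r' else 0) = D := by
    intro s
    refine Finset.sum_congr rfl fun r _ => ?_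
    refine Fintype.sum_equiv (Equiv.arrowCongr (Equiv.refl (Fin m)) (Equiv.addRight s)) _ _
      fun r' => ?_
    have h1 : (Equiv.arrowCongr (Equiv.refl (Fin m)) (Equiv.addRight s)) r' =
        (Equiv.addRight s : Equiv.Perm (Fin n)) ∘ r' := rfl
    rw [h1, hT, h.simpleRowSum_comp]
    rfl
  have hsum : (n : ℝ) * D = ∑ r : Fin m → Fin n, ∑ r' : Fin m → Fin n,
      ((Finset.univ.filter fun s : Fin n => ∀ l l', r l ≠ r' l' + s).card : ℝ) * (T r * T r') := by
    calc (n : ℝ) * D = ∑ s : Fin n, D := by simp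
      _ = ∑ s : Fin n, ∑ r : Fin m → Fin n, ∑ r' : Fin m → Fin n,
          (if ∀ l l', r l ≠ r' l' + s then T r * T r' else 0) :=
          Finset.sum_congr rfl fun s _ => (hshift s).symm
      _ = _ := by
          rw [Finset.sum_comm]
          refine Finset.sum_congr rfl fun r _ => ?_
          rw [Finset.sum_comm]
          refine Finset.sum_congr rfl fun r' _ => ?_
          rw [← Finset.sum_filter, Finset.sum_const, nsmul_eq_mul]
  have hlow : ((n : ℝ) / 2) * (∑ r, T r) ^ 2 ≤ n * D := by
    rw [hsum, sq, Finset.sum_mul_sum, Finset.mul_sum]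
    refine Finset.sum_le_sum fun r _ => ?_
    rw [Finset.mul_sum]
    refine Finset.sum_le_sum fun r' _ => ?_
    refine mul_le_mul_of_nonneg_right ?_ (mul_nonneg (hT0 r) (hT0 r'))
    have h1 := card_filter_shift_disjoint r r'
    have h2 : (n : ℝ) ≤ (Finset.univ.filter fun s : Fin n =>
      ∀ l l', r l ≠ r' l' + s).card + m * m := by exact_mod_cast h1
    have h3 : 2 * ((m : ℝ) * m) ≤ n := by exact_mod_cast hn
    linarith
  have hpos : 0 < (n : ℝ) := by positivity
  nlinarith

end IIDRows

variable {A : (n : ℕ) → Ω → Matrix (Fin n) (Fin n) ℂ} {ν : (n : ℕ) → Measure (Fin n → ℂ)}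

/-- (A2) of order `m`, the full length of the word, bounds the square of the sum by `o(n ^ (m +
1))`. The root is even smaller than needed, by a factor `√n`, and the parity of `m` plays no role.
-/
theorem RowModel.tendsto_sum_simpleRowSum [IsProbabilityMeasure P] (h : RowModel P A ν) {m : ℕ} (w : Fin m → Bool) :
    Tendsto (fun n : ℕ => 1 / ((n : ℝ) * Real.sqrt n ^ m) * ∑ r, simpleRowSum P (A n) w r)
      atTop (𝓝 0) := by
  have h1 := (h.a2 m).tendsto_div_nhds_zero
  have h2 : Tendsto (fun n : ℕ => Real.sqrt (2 * (simpleMomentSum P (A n) m /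
      (n : ℝ) ^ (m + 1)))) atTop (𝓝 0) := by
    have := (Real.continuous_sqrt.tendsto _).comp (h1.const_mul 2)
    rwa [mul_zero, Real.sqrt_zero] at this
  refine squeeze_zero' (Eventually.of_forall fun n => ?_) ?_ h2
  · exact mul_nonneg (by positivity) (Finset.sum_nonneg fun r _ => simpleRowSum_nonneg w r)
  filter_upwards [eventually_gt_atTop 0, eventually_ge_atTop (2 * (m * m))] with n hn hnm
  refine Real.le_sqrt_of_sq_le ?_
  have h3 := (h.iid n).sq_sum_simpleRowSum_le w hnm hn.ne'
  have hpos : 0 < (n : ℝ) := by positivity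
  have hone : 1 ≤ (n : ℝ) := by exact_mod_cast hn
  have hsq : (Real.sqrt n ^ m) ^ 2 = (n : ℝ) ^ m := by
    rw [← pow_mul, mul_comm, pow_mul, Real.sq_sqrt hpos.le]
  rw [mul_pow, div_pow, mul_pow, hsq, one_pow]
  have h4 : 0 ≤ simpleMomentSum P (A n) m := by nlinarith [sq_nonneg (∑ r, simpleRowSum P (A n) w r)]
  calc 1 / ((n : ℝ) ^ 2 * n ^ m) * (∑ r, simpleRowSum P (A n) w r) ^ 2
      ≤ 1 / ((n : ℝ) ^ 2 * n ^ m) * (2 * simpleMomentSum P (A n) m) := by gcongr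
    _ ≤ 1 / ((n : ℝ) * n ^ m) * (2 * simpleMomentSum P (A n) m) := by
        gcongr
        nlinarith
    _ = 2 * (simpleMomentSum P (A n) m / n ^ (m + 1)) := by
        rw [pow_succ]; field_simp

open Classical in
/-- The contribution of the simple walks to an expected trace is negligible. -/
theorem RowModel.tendsto_sum_simpleWalk [IsProbabilityMeasure P] (h : RowModel P A ν) {k : ℕ} (w : Fin (k + 1) → Bool) :
    Tendsto (fun n : ℕ => (1 / ((n : ℂ) * (Real.sqrt n : ℂ) ^ (k + 1))) *
      ∑ v : Fin (k + 1) → Fin n with SimpleWalk w v,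
        ∫ ω, monomial (A n ω) w (rowIdx w v) (colIdx w v) ∂P) atTop (𝓝 0) := by
  refine squeeze_zero_norm (fun n => ?_) (h.tendsto_sum_simpleRowSum w)
  rw [norm_mul, norm_div, norm_mul, norm_pow, norm_one, Complex.norm_natCast, Complex.norm_real,
    Real.norm_of_nonneg (Real.sqrt_nonneg _)]
  refine mul_le_mul_of_nonneg_left ?_ (by positivity)
  refine (norm_sum_le _ _).trans ?_
  let F : (Fin (k + 1) → Fin n) × (Fin (k + 1) → Fin n) → ℝ := fun x =>
    if HasSimpleFactor x.1 x.2 then ‖∫ ω, monomial (A n ω) w x.1 x.2 ∂P‖ else 0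
  have hF : ∀ x, 0 ≤ F x := fun x => by simp only [F]; split_ifs <;> positivity
  have h1 : ∑ r, simpleRowSum P (A n) w r = ∑ x, F x := by
    rw [Fintype.sum_prod_type]
    rfl
  have h2 : ∑ v : Fin (k + 1) → Fin n with SimpleWalk w v,
      ‖∫ ω, monomial (A n ω) w (rowIdx w v) (colIdx w v) ∂P‖ =
      ∑ v : Fin (k + 1) → Fin n with SimpleWalk w v, F (rowIdx w v, colIdx w v) := by
    refine Finset.sum_congr rfl fun v hv => ?_
    have : HasSimpleFactor (rowIdx w v) (colIdx w v) := (Finset.mem_filter.1 hv).2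
    simp only [F, this, if_true]
  rw [h1, h2, ← Finset.sum_image (f := F) fun x _ y _ hxy => rowIdx_colIdx_injective w hxy]
  exact Finset.sum_le_sum_of_subset_of_nonneg (Finset.subset_univ _) fun x _ _ => hF x

end RowDependent

end

/-! ### Limits of expected traces of words -/

noncomputable section

namespace RowDependent

section Compression

variable {k : ℕ} {α : Type*} [DecidableEq α]

theorem exists_injective_comp_rangeFactorization_pattern {m : ℕ} (v : Fin m → α) :
    ∃ f : Set.range (pattern v) → α, Function.Injective f ∧
      v = f ∘ Set.rangeFactorization (pattern v) := by
  refine ⟨fun x => v x.1, ?_, ?_⟩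
  · rintro ⟨_, l, rfl⟩ ⟨_, l', rfl⟩ h
    simp only [apply_pattern] at h
    refine Subtype.ext ?_
    exact (pattern_eq_iff v l l').2 h
  · funext l
    exact (apply_pattern v l).symm

theorem simpleWalk_iff_rangeFactorization (w : Fin (k + 1) → Bool) (v : Fin (k + 1) → α) :
    SimpleWalk w v ↔ SimpleWalk w (Set.rangeFactorization (pattern v)) := by
  obtain ⟨f, hf, hv⟩ := exists_injective_comp_rangeFactorization_pattern v
  conv_lhs => rw [hv, simpleWalk_comp hf]

theorem simpleWalk_rangeFactorization_iff (w : Fin (k + 1) → Bool)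
    (π : Fin (k + 1) → Fin (k + 1)) :
    SimpleWalk w (Set.rangeFactorization π) ↔ SimpleWalk w π :=
  (simpleWalk_comp Subtype.val_injective w (Set.rangeFactorization π)).symm

theorem simpleWalk_iff_pattern (w : Fin (k + 1) → Bool) (v : Fin (k + 1) → α) :
    SimpleWalk w v ↔ SimpleWalk w (pattern v) := by
  rw [simpleWalk_iff_rangeFactorization, simpleWalk_rangeFactorization_iff]

theorem card_image_rangeFactorization {m : ℕ} (π : Fin m → Fin m) :
    (Finset.univ.image (Set.rangeFactorization π)).card = Fintype.card (Set.range π) := by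
  rw [Finset.image_univ_of_surjective Set.rangeFactorization_surjective, Finset.card_univ]

theorem card_image_eq {m : ℕ} (π : Fin m → Fin m) :
    (Finset.univ.image π).card = Fintype.card (Set.range π) := by
  rw [← card_image_rangeFactorization]
  conv_lhs => rw [← Set.coe_comp_rangeFactorization π]
  rw [← Finset.image_image, Finset.card_image_of_injective _ Subtype.val_injective]

theorem card_image_eq_pattern {m : ℕ} (v : Fin m → α) :
    (Finset.univ.image v).card = Fintype.card (Set.range (pattern v)) := by
  obtain ⟨f, hf, hv⟩ := exists_injective_comp_rangeFactorization_pattern v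
  conv_lhs => rw [hv]
  rw [← Finset.image_image, Finset.card_image_of_injective _ hf, card_image_rangeFactorization]

open Classical in
/-- The patterns of the closed walks that contribute to the limit of the normalized trace of the
word `w`: those without simple positions and with the largest number of vertices. -/
def goodPatterns (w : Fin (k + 1) → Bool) : Finset (Fin (k + 1) → Fin (k + 1)) :=
  Finset.univ.filter fun π => (pattern π = π ∧ ¬ SimpleWalk w π) ∧
    k + 3 ≤ 2 * Fintype.card (Set.range π)

theorem two_mul_card_range_le {w : Fin (k + 1) → Bool} {π : Fin (k + 1) → Fin (k + 1)}
    (hs : ¬ SimpleWalk w π) : 2 * Fintype.card (Set.range π) ≤ k + 3 := by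
  rw [← card_image_eq]
  exact two_mul_card_image_of_not_simpleWalk hs

theorem card_filter_pattern {n m : ℕ} {π : Fin m → Fin m} (hπ : pattern π = π) :
    (Finset.univ.filter fun v : Fin m → Fin n => pattern v = π).card =
      n.descFactorial (Fintype.card (Set.range π)) := by
  have h := sum_filter_pattern_eq (α := Fin n) π hπ fun _ => 1
  rw [← Finset.card_eq_sum_ones, ← Finset.card_eq_sum_ones] at h
  rw [h, ← Fintype.card_subtype,
    Fintype.card_congr (Equiv.subtypeInjectiveEquivEmbedding _ (Fin n)),
    Fintype.card_embedding_eq, Fintype.card_fin]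

/-- Each good pattern is carried by `n.descFactorial q` walks on `n` vertices. These are tree walks,
different for different patterns, so there are at most `2 ^ (k + 1) * n ^ q` of them; now let `n`
tend to infinity. -/
theorem card_goodPatterns_le (w : Fin (k + 1) → Bool) : (goodPatterns w).card ≤ 2 ^ (k + 1) := by
  classical
  rcases (goodPatterns w).eq_empty_or_nonempty with h0 | ⟨π₀, h0⟩
  · simp [h0]
  obtain ⟨q, hq⟩ : ∃ q, 2 * q = k + 3 := by
    have h1 := (Finset.mem_filter.1 h0).2
    exact ⟨_, le_antisymm (two_mul_card_range_le h1.1.2) h1.2⟩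
  have hle : ∀ n : ℕ, (goodPatterns w).card * n.descFactorial q ≤ 2 ^ (k + 1) * n ^ q := by
    intro n
    let s : Finset (Fin (k + 1) → Fin n) := (goodPatterns w).biUnion fun π =>
      Finset.univ.filter fun v => pattern v = π
    have hs : s.card = (goodPatterns w).card * n.descFactorial q := by
      rw [Finset.card_biUnion, Finset.sum_congr rfl (g := fun _ => n.descFactorial q),
        Finset.sum_const, smul_eq_mul]
      · intro π hπ
        have h1 := (Finset.mem_filter.1 hπ).2
        have h2 := two_mul_card_range_le h1.1.2
        rw [card_filter_pattern h1.1.1]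
        congr 1
        omega
      · intro π _ π' _ hne
        rw [Function.onFun, Finset.disjoint_left]
        intro v hv hv'
        exact hne ((Finset.mem_filter.1 hv).2.symm.trans (Finset.mem_filter.1 hv').2)
    rw [← hs]
    refine card_filter_treeWalk_le n q w hq s fun v hv => ?_
    obtain ⟨π, hπ, hv⟩ := Finset.mem_biUnion.1 hv
    have h1 := (Finset.mem_filter.1 hπ).2
    have h2 : pattern v = π := (Finset.mem_filter.1 hv).2
    refine treeWalk_of_not_simpleWalk ?_ ?_
    · rw [simpleWalk_iff_pattern, h2]
      exact h1.1.2
    · rw [card_image_eq_pattern]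
      simp only [h2]
      exact h1.2
  have hlim := (isEquivalent_iff_tendsto_one (by
    filter_upwards [eventually_gt_atTop 0] with n hn
    positivity)).1 (isEquivalent_descFactorial q)
  have hlim2 := hlim.const_mul ((goodPatterns w).card : ℝ)
  rw [mul_one] at hlim2
  have : ((goodPatterns w).card : ℝ) ≤ 2 ^ (k + 1) := by
    refine le_of_tendsto hlim2 ?_
    filter_upwards [eventually_gt_atTop 0] with n hn
    have hpos : 0 < (n : ℝ) ^ q := by positivity
    rw [Pi.div_apply, mul_div_assoc', div_le_iff₀ hpos]
    exact_mod_cast hle n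
  exact_mod_cast this

end Compression

section Trace

/-- The matrix or its conjugate transpose, according to the letter. -/
def starMatrix {n : ℕ} (M : Matrix (Fin n) (Fin n) ℂ) (ε : Bool) : Matrix (Fin n) (Fin n) ℂ :=
  if ε then M else Mᴴ

theorem starMatrix_apply {n : ℕ} (M : Matrix (Fin n) (Fin n) ℂ) (ε : Bool) (i j : Fin n) :
    starMatrix M ε i j = letterEntry M ε (stepPos ε i j) := by
  cases ε <;> simp [starMatrix, letterEntry, stepPos]

theorem prod_starMatrix_apply {n m : ℕ} (M : Matrix (Fin n) (Fin n) ℂ) (w : Fin m → Bool)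
    (i j : Fin n) :
    (List.ofFn fun l => starMatrix M (w l)).prod i j = ∑ v : Fin m → Fin n,
      if (Fin.cons i v : Fin (m + 1) → Fin n) (Fin.last m) = j then
        ∏ l, letterEntry M (w l) (stepPos (w l) ((Fin.cons i v : Fin (m + 1) → Fin n) l.castSucc)
          (v l)) else 0 := by
  induction m generalizing i with
  | zero => simp [Matrix.one_apply]
  | succ m ih =>
    rw [List.ofFn_succ, List.prod_cons, Matrix.mul_apply]
    simp only [ih, Finset.mul_sum]
    rw [← Fintype.sum_prod_type']
    refine Fintype.sum_equiv (Fin.consEquiv fun _ => Fin n) _ _ fun x => ?_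
    obtain ⟨a, v⟩ := x
    have h1 : (Fin.consEquiv fun _ : Fin (m + 1) => Fin n) (a, v) =
        (Fin.cons a v : Fin (m + 1) → Fin n) := rfl
    rw [h1]
    have h2 : (Fin.cons i (Fin.cons a v : Fin (m + 1) → Fin n) : Fin (m + 2) → Fin n)
        (Fin.last (m + 1)) = (Fin.cons a v : Fin (m + 1) → Fin n) (Fin.last m) := by
      rw [← Fin.succ_last, Fin.cons_succ]
    rw [h2, Fin.prod_univ_succ, mul_ite, mul_zero, starMatrix_apply]
    rfl

theorem trace_prod_starMatrix {n k : ℕ} (M : Matrix (Fin n) (Fin n) ℂ) (w : Fin (k + 1) → Bool) :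
    (List.ofFn fun l => starMatrix M (w l)).prod.trace =
      ∑ v : Fin (k + 1) → Fin n, monomial M w (rowIdx w v) (colIdx w v) := by
  simp only [Matrix.trace, Matrix.diag_apply, prod_starMatrix_apply]
  rw [Finset.sum_comm]
  refine Finset.sum_congr rfl fun v _ => ?_
  have h1 : ∀ i, (Fin.cons i v : Fin (k + 2) → Fin n) (Fin.last (k + 1)) = v (Fin.last k) :=
    fun i => by rw [← Fin.succ_last, Fin.cons_succ]
  simp only [h1]
  rw [Finset.sum_ite_eq]
  simp only [Finset.mem_univ, if_true]
  rfl

end Trace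

universe u

variable {Ω : Type u} [MeasurableSpace Ω] {P : Measure Ω} [IsProbabilityMeasure P]
  {A : (n : ℕ) → Ω → Matrix (Fin n) (Fin n) ℂ} {ν : (n : ℕ) → Measure (Fin n → ℂ)}

theorem sqrt_pow_two_mul (n q : ℕ) : Real.sqrt n ^ (2 * q) = (n : ℝ) ^ q := by
  rw [pow_mul, Real.sq_sqrt (Nat.cast_nonneg n)]

-- Simplicity and the number of vertices depend on the pattern only. With the largest number of
-- vertices the sum runs over the injective labellings of a tree; with fewer, at least one factor
-- `√n` is missing.
open Classical in
theorem RowModel.tendsto_sum_pattern (h : RowModel P A ν) {k : ℕ} (w : Fin (k + 1) → Bool)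
    (π : Fin (k + 1) → Fin (k + 1)) :
    Tendsto (fun n : ℕ => (1 / ((n : ℂ) * (Real.sqrt n : ℂ) ^ (k + 1))) *
      ∑ v : Fin (k + 1) → Fin n with ¬ SimpleWalk w v ∧ pattern v = π,
        ∫ ω, monomial (A n ω) w (rowIdx w v) (colIdx w v) ∂P) atTop
      (𝓝 (if π ∈ goodPatterns w then 1 else 0)) := by
  by_cases hπ : pattern π = π ∧ ¬ SimpleWalk w π
  swap
  · have hempty : ∀ n : ℕ, (Finset.univ.filter fun v : Fin (k + 1) → Fin n =>
        ¬ SimpleWalk w v ∧ pattern v = π) = ∅ := by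
      intro n
      rw [Finset.filter_eq_empty_iff]
      rintro v - ⟨h1, rfl⟩
      exact hπ ⟨pattern_pattern v, fun h2 => h1 ((simpleWalk_iff_pattern w v).2 h2)⟩
    have hmem : π ∉ goodPatterns w := fun hmem => hπ (Finset.mem_filter.1 hmem).2.1
    simp [hempty, hmem]
  have hfilter : ∀ n : ℕ, (Finset.univ.filter fun v : Fin (k + 1) → Fin n =>
      ¬ SimpleWalk w v ∧ pattern v = π) = Finset.univ.filter fun v => pattern v = π := by
    intro n
    refine Finset.filter_congr fun v _ => ⟨fun h1 => h1.2, fun h1 => ⟨?_, h1⟩⟩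
    rw [simpleWalk_iff_pattern, h1]
    exact hπ.2
  simp only [hfilter]
  have hsum : ∀ n : ℕ, ∑ v : Fin (k + 1) → Fin n with pattern v = π,
      ∫ ω, monomial (A n ω) w (rowIdx w v) (colIdx w v) ∂P =
      ∑ f : Set.range π → Fin n with Function.Injective f,
        ∫ ω, monomial (A n ω) w (rowIdx w (f ∘ Set.rangeFactorization π))
          (colIdx w (f ∘ Set.rangeFactorization π)) ∂P :=
    fun n => sum_filter_pattern_eq π hπ.1
      fun v => ∫ ω, monomial (A n ω) w (rowIdx w v) (colIdx w v) ∂P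
  simp only [hsum]
  by_cases hcard : k + 3 ≤ 2 * Fintype.card (Set.range π)
  · have hmem : π ∈ goodPatterns w := Finset.mem_filter.2 ⟨Finset.mem_univ _, hπ, hcard⟩
    rw [if_pos hmem]
    have hs : ¬ SimpleWalk w (Set.rangeFactorization π) := by
      rw [simpleWalk_rangeFactorization_iff]
      exact hπ.2
    have htree := treeWalk_of_not_simpleWalk hs (by rwa [card_image_rangeFactorization])
    refine (h.tendsto_sum_injective htree).congr fun n => ?_
    congr 2
    obtain ⟨q, hq⟩ : ∃ q, Fintype.card (Set.range π) = q + 1 :=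
      ⟨Fintype.card (Set.range π) - 1, by omega⟩
    have hle := two_mul_card_range_le hπ.2
    have hk : k + 1 = 2 * q := by omega
    rw [hq, hk, ← Complex.ofReal_pow, sqrt_pow_two_mul]
    push_cast
    ring
  · have hmem : π ∉ goodPatterns w := fun hmem => hcard (Finset.mem_filter.1 hmem).2.2
    rw [if_neg hmem]
    obtain ⟨C, hC, hb⟩ := h.exists_monomial_bound (k + 1)
    have hlim : Tendsto (fun n : ℕ => C / Real.sqrt n) atTop (𝓝 0) :=
      tendsto_const_nhds.div_atTop (Real.tendsto_sqrt_atTop.comp tendsto_natCast_atTop_atTop)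
    refine squeeze_zero_norm' ?_ hlim
    filter_upwards [eventually_gt_atTop 0] with n hn
    have hpos : 0 < (n : ℝ) := by positivity
    have hone : 1 ≤ Real.sqrt n := by
      rw [Real.one_le_sqrt]; exact_mod_cast hn
    rw [norm_mul, norm_div, norm_mul, norm_pow, norm_one, Complex.norm_natCast, Complex.norm_real,
      Real.norm_of_nonneg (Real.sqrt_nonneg _)]
    have h1 : ‖∑ f : Set.range π → Fin n with Function.Injective f,
        ∫ ω, monomial (A n ω) w (rowIdx w (f ∘ Set.rangeFactorization π))
          (colIdx w (f ∘ Set.rangeFactorization π)) ∂P‖ ≤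
        (n : ℝ) ^ Fintype.card (Set.range π) * C := by
      refine (norm_sum_le_of_le _ fun f _ => (hb n w _ _).2).trans ?_
      rw [Finset.sum_const, nsmul_eq_mul]
      refine mul_le_mul_of_nonneg_right ?_ hC
      have := Finset.card_filter_le (Finset.univ : Finset (Set.range π → Fin n))
        fun f => Function.Injective f
      rw [Finset.card_univ, Fintype.card_fun, Fintype.card_fin] at this
      exact_mod_cast this
    refine (mul_le_mul_of_nonneg_left h1 (by positivity)).trans ?_
    have h2 : (n : ℝ) ^ Fintype.card (Set.range π) * Real.sqrt n ≤
        (n : ℝ) * Real.sqrt n ^ (k + 1) := by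
      rw [← sqrt_pow_two_mul, ← pow_succ]
      -- The first rewrite also hits the `n` under the root, which `Real.sqrt_sq` then restores; the
      -- claim becomes `2 * card + 1 ≤ k + 3`.
      conv_rhs => rw [← Real.sq_sqrt hpos.le, Real.sqrt_sq (Real.sqrt_nonneg _), ← pow_add]
      exact pow_le_pow_right₀ hone (by omega)
    rw [div_mul_eq_mul_div, one_mul, div_le_div_iff₀ (by positivity) (by positivity)]
    calc (n : ℝ) ^ Fintype.card (Set.range π) * C * Real.sqrt n
        = C * ((n : ℝ) ^ Fintype.card (Set.range π) * Real.sqrt n) := by ring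
      _ ≤ C * ((n : ℝ) * Real.sqrt n ^ (k + 1)) := by gcongr

theorem RowModel.integrable_trace_word (h : RowModel P A ν) {k : ℕ} (w : Fin (k + 1) → Bool)
    (n : ℕ) :
    Integrable (fun ω => (List.ofFn fun l => starMatrix (A n ω) (w l)).prod.trace) P := by
  obtain ⟨C, hC, hb⟩ := h.exists_monomial_bound (k + 1)
  simp only [trace_prod_starMatrix]
  exact integrable_finsetSum _ fun v _ => (hb n w _ _).1

theorem RowModel.tendsto_trace_word (h : RowModel P A ν) {k : ℕ} (w : Fin (k + 1) → Bool) :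
    Tendsto (fun n : ℕ => (1 / ((n : ℂ) * (Real.sqrt n : ℂ) ^ (k + 1))) *
      ∫ ω, (List.ofFn fun l => starMatrix (A n ω) (w l)).prod.trace ∂P) atTop
      (𝓝 ((goodPatterns w).card : ℂ)) := by
  classical
  obtain ⟨C, hC, hb⟩ := h.exists_monomial_bound (k + 1)
  have h1 := tendsto_finsetSum Finset.univ fun π _ => h.tendsto_sum_pattern w π
  have h2 := (h.tendsto_sum_simpleWalk w).add h1
  rw [zero_add, Finset.sum_ite_mem, Finset.univ_inter, Finset.sum_const, nsmul_eq_mul,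
    mul_one] at h2
  refine h2.congr fun n => ?_
  simp only [trace_prod_starMatrix]
  rw [integral_finsetSum _ fun v _ => (hb n w _ _).1, ← Finset.mul_sum, ← mul_add]
  congr 1
  have key := Finset.sum_filter_add_sum_filter_not Finset.univ (SimpleWalk w)
    fun v : Fin (k + 1) → Fin n => ∫ ω, monomial (A n ω) w (rowIdx w v) (colIdx w v) ∂P
  rw [← key]
  congr 1
  rw [← Finset.sum_fiberwise (Finset.univ.filter fun v : Fin (k + 1) → Fin n =>
    ¬ SimpleWalk w v) pattern]
  refine Finset.sum_congr rfl fun π _ => ?_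
  rw [Finset.filter_filter]

end RowDependent

end

/-! ### Moments of the shifted matrix -/

noncomputable section

namespace RowDependent

universe u

section Shifted

/-- The letter `z` or its conjugate. -/
def starScalar (z : ℂ) (ε : Bool) : ℂ := if ε then z else conj z

/-- The normalized matrix or its adjoint. -/
def scaledLetter {n : ℕ} (M : Matrix (Fin n) (Fin n) ℂ) (ε : Bool) : Matrix (Fin n) (Fin n) ℂ :=
  (((1 / Real.sqrt n : ℝ) : ℂ)) • starMatrix M ε

theorem starMatrix_shifted {n : ℕ} (M : Matrix (Fin n) (Fin n) ℂ) (z : ℂ) (ε : Bool) :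
    starMatrix (shifted M z) ε = scaledLetter M ε - starScalar z ε • 1 := by
  cases ε
  · simp only [starMatrix, shifted, scaledLetter, starScalar, Bool.false_eq_true, if_false,
      Matrix.conjTranspose_sub, Matrix.conjTranspose_smul, Matrix.conjTranspose_one]
    congr 2
    exact Complex.conj_ofReal _
  · simp [starMatrix, shifted, scaledLetter, starScalar]

theorem prod_scaledLetter {n : ℕ} (M : Matrix (Fin n) (Fin n) ℂ) (p : List Bool) :
    (p.map (scaledLetter M)).prod =
      (((1 / Real.sqrt n : ℝ) : ℂ)) ^ p.length • (p.map (starMatrix M)).prod := by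
  induction p with
  | nil => simp
  | cons ε p ih =>
    rw [List.map_cons, List.prod_cons, ih, List.map_cons, List.prod_cons, List.length_cons,
      scaledLetter, smul_mul_smul_comm, pow_succ']

theorem hermitization_pow {n : ℕ} (M : Matrix (Fin n) (Fin n) ℂ) (z : ℂ) (k : ℕ) :
    hermitization M z ^ k =
      ((List.replicate k [true, false]).flatten.map (starMatrix (shifted M z))).prod := by
  induction k with
  | zero => simp
  | succ k ih =>
    rw [pow_succ', ih, List.replicate_succ, List.flatten_cons, List.map_append, List.prod_append]
    simp [hermitization, starMatrix]

end Shifted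

/-- The normalized expected trace of a product of letters in the scaled matrix and letters in the
shifted matrix. -/
def mixedMoment {Ω : Type*} [MeasurableSpace Ω] (P : Measure Ω) {n : ℕ}
    (M : Ω → Matrix (Fin n) (Fin n) ℂ) (z : ℂ) (p s : List Bool) : ℂ :=
  (1 / (n : ℂ)) * ∫ ω, ((p.map (scaledLetter (M ω))).prod *
    (s.map (starMatrix (shifted (M ω) z))).prod).trace ∂P

/-- `L` is chosen before the probability space and the model. This order of quantifiers expresses
the universality of the limit and is kept in the later existence results. -/
theorem exists_tendsto_pureMoment (p : List Bool) :
    ∃ L : ℂ, ‖L‖ ≤ 2 ^ p.length ∧ ∀ (Ω : Type u) [MeasurableSpace Ω] (P : Measure Ω)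
      [IsProbabilityMeasure P] (A : (n : ℕ) → Ω → Matrix (Fin n) (Fin n) ℂ)
      (ν : (n : ℕ) → Measure (Fin n → ℂ)), RowModel P A ν →
      (∀ n, Integrable (fun ω => (p.map (scaledLetter (A n ω))).prod.trace) P) ∧
      Tendsto (fun n : ℕ => (1 / (n : ℂ)) *
        ∫ ω, (p.map (scaledLetter (A n ω))).prod.trace ∂P) atTop (𝓝 L) := by
  rcases Nat.eq_zero_or_pos p.length with h0 | hpos
  · obtain rfl := List.length_eq_zero_iff.1 h0
    refine ⟨1, by simp, fun Ω _ P _ A ν _ => ⟨fun n => by simp, ?_⟩⟩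
    refine tendsto_const_nhds.congr' ?_
    filter_upwards [eventually_gt_atTop 0] with n hn
    have hn' : (n : ℂ) ≠ 0 := by exact_mod_cast hn.ne'
    simp [hn']
  · obtain ⟨k, hk⟩ : ∃ k, p.length = k + 1 := ⟨p.length - 1, by omega⟩
    obtain ⟨w, rfl⟩ : ∃ w : Fin (k + 1) → Bool, p = List.ofFn w := by
      refine ⟨fun i => p.get (i.cast hk.symm), ?_⟩
      apply List.ext_get
      · simp [hk]
      · intro i _ _
        rw [List.get_ofFn]
        rfl
    refine ⟨(goodPatterns w).card, ?_, fun Ω _ P _ A ν h => ?_⟩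
    · rw [Complex.norm_natCast, List.length_ofFn]
      exact_mod_cast card_goodPatterns_le w
    · have heq : ∀ n ω, ((List.ofFn w).map (scaledLetter (A n ω))).prod.trace =
          (((1 / Real.sqrt n : ℝ) : ℂ)) ^ (k + 1) *
            (List.ofFn fun l => starMatrix (A n ω) (w l)).prod.trace := by
        intro n ω
        rw [prod_scaledLetter, List.length_ofFn, Matrix.trace_smul, smul_eq_mul, List.map_ofFn]
        rfl
      simp only [heq]
      refine ⟨fun n => (h.integrable_trace_word w n).const_mul _, ?_⟩
      refine (h.tendsto_trace_word w).congr fun n => ?_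
      rw [integral_const_mul, ← mul_assoc]
      congr 1
      push_cast
      rw [div_pow, one_pow, div_mul_div_comm, one_mul]

/-- A shifted letter is a scaled letter minus a scalar. Expanding the first one either moves it to
the prefix `p` or drops it, so the induction on `s` needs all `p`; each expansion costs at most a
factor `2 * (1 + ‖z‖)`. -/
theorem exists_tendsto_mixedMoment (z : ℂ) (s : List Bool) : ∀ p : List Bool,
    ∃ L : ℂ, ‖L‖ ≤ (1 + ‖z‖) ^ s.length * 2 ^ (p.length + s.length) ∧
      ∀ (Ω : Type u) [MeasurableSpace Ω] (P : Measure Ω)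
      [IsProbabilityMeasure P] (A : (n : ℕ) → Ω → Matrix (Fin n) (Fin n) ℂ)
      (ν : (n : ℕ) → Measure (Fin n → ℂ)), RowModel P A ν →
      (∀ n, Integrable (fun ω => ((p.map (scaledLetter (A n ω))).prod *
        (s.map (starMatrix (shifted (A n ω) z))).prod).trace) P) ∧
      Tendsto (fun n : ℕ => mixedMoment P (A n) z p s) atTop (𝓝 L) := by
  induction s with
  | nil =>
    intro p
    obtain ⟨L, hL, h⟩ := exists_tendsto_pureMoment.{u} p
    refine ⟨L, by simpa using hL, fun Ω _ P _ A ν hA => ?_⟩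
    simpa [mixedMoment] using h Ω P A ν hA
  | cons ε s ih =>
    intro p
    obtain ⟨L₁, hL₁, h₁⟩ := ih (p ++ [ε])
    obtain ⟨L₂, hL₂, h₂⟩ := ih p
    refine ⟨L₁ - starScalar z ε * L₂, ?_, fun Ω _ P _ A ν hA => ?_⟩
    · have hz : ‖starScalar z ε‖ = ‖z‖ := by cases ε <;> simp [starScalar]
      refine (norm_sub_le _ _).trans ?_
      rw [norm_mul, hz, List.length_cons]
      rw [List.length_append, List.length_singleton] at hL₁
      have hz0 := norm_nonneg z
      have hX : 0 ≤ (1 + ‖z‖) ^ s.length * 2 ^ (p.length + s.length) := by positivity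
      calc ‖L₁‖ + ‖z‖ * ‖L₂‖
          ≤ (1 + ‖z‖) ^ s.length * 2 ^ (p.length + 1 + s.length) +
            ‖z‖ * ((1 + ‖z‖) ^ s.length * 2 ^ (p.length + s.length)) := by gcongr
        _ ≤ (1 + ‖z‖) ^ s.length * 2 ^ (p.length + s.length) * (2 + 2 * ‖z‖) := by
            rw [show p.length + 1 + s.length = (p.length + s.length) + 1 by ring, pow_succ]
            nlinarith
        _ = (1 + ‖z‖) ^ (s.length + 1) * 2 ^ (p.length + (s.length + 1)) := by
            rw [← add_assoc, pow_succ, pow_succ]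
            ring
    · obtain ⟨hi₁, ht₁⟩ := h₁ Ω P A ν hA
      obtain ⟨hi₂, ht₂⟩ := h₂ Ω P A ν hA
      have heq : ∀ n ω, ((p.map (scaledLetter (A n ω))).prod *
          ((ε :: s).map (starMatrix (shifted (A n ω) z))).prod).trace =
          (((p ++ [ε]).map (scaledLetter (A n ω))).prod *
            (s.map (starMatrix (shifted (A n ω) z))).prod).trace -
          starScalar z ε * ((p.map (scaledLetter (A n ω))).prod *
            (s.map (starMatrix (shifted (A n ω) z))).prod).trace := by
        intro n ω
        rw [List.map_cons, List.prod_cons, starMatrix_shifted, List.map_append, List.prod_append,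
          List.map_singleton, List.prod_singleton, sub_mul, mul_sub, Matrix.trace_sub, mul_assoc,
          smul_mul_assoc, one_mul, mul_smul_comm, Matrix.trace_smul, smul_eq_mul]
      constructor
      · intro n
        simp only [heq]
        exact (hi₁ n).sub ((hi₂ n).const_mul _)
      · refine (ht₁.sub (ht₂.const_mul (starScalar z ε))).congr fun n => ?_
        simp only [mixedMoment, heq]
        rw [integral_sub (hi₁ n) ((hi₂ n).const_mul _), integral_const_mul]
        ring

/-! ### Traces as sums over eigenvalues -/

section Spectral

variable {n : ℕ} {H : Matrix (Fin n) (Fin n) ℂ}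

open Unitary in
/-- Hermitian functional calculus: the image of a function of the eigenvalues. -/
def diagFun (hH : H.IsHermitian) (φ : ℝ → ℝ) : Matrix (Fin n) (Fin n) ℂ :=
  conjStarAlgAut ℂ _ hH.eigenvectorUnitary
    (Matrix.diagonal fun i => ((φ (hH.eigenvalues i) : ℝ) : ℂ))

theorem diagFun_id (hH : H.IsHermitian) : diagFun hH id = H :=
  hH.spectral_theorem.symm

theorem diagFun_one (hH : H.IsHermitian) : diagFun hH (fun _ => 1) = 1 := by
  simp [diagFun]

theorem diagFun_mul (hH : H.IsHermitian) (φ ψ : ℝ → ℝ) :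
    diagFun hH (fun x => φ x * ψ x) = diagFun hH φ * diagFun hH ψ := by
  rw [diagFun, diagFun, diagFun, ← map_mul, Matrix.diagonal_mul_diagonal]
  simp

theorem diagFun_add (hH : H.IsHermitian) (φ ψ : ℝ → ℝ) :
    diagFun hH (fun x => φ x + ψ x) = diagFun hH φ + diagFun hH ψ := by
  rw [diagFun, diagFun, diagFun, ← map_add, Matrix.diagonal_add]
  simp

theorem diagFun_pow (hH : H.IsHermitian) (φ : ℝ → ℝ) (k : ℕ) :
    diagFun hH (fun x => φ x ^ k) = diagFun hH φ ^ k := by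
  induction k with
  | zero => simpa using diagFun_one hH
  | succ k ih => simp only [pow_succ, diagFun_mul hH (fun x => φ x ^ k) φ, ih]

theorem trace_diagFun (hH : H.IsHermitian) (φ : ℝ → ℝ) :
    (diagFun hH φ).trace = ((∑ i, φ (hH.eigenvalues i) : ℝ) : ℂ) := by
  rw [diagFun, Unitary.conjStarAlgAut_apply, Matrix.trace_mul_cycle, Unitary.coe_star_mul_self,
    one_mul, Matrix.trace_diagonal]
  push_cast
  rfl

theorem trace_pow_eq_sum (hH : H.IsHermitian) (k : ℕ) :
    (H ^ k).trace = ((∑ i, hH.eigenvalues i ^ k : ℝ) : ℂ) := by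
  rw [← trace_diagFun hH fun x => x ^ k]
  have := diagFun_pow hH id k
  rw [diagFun_id] at this
  rw [← this]
  rfl

theorem diagFun_inv (hH : H.IsHermitian) (h0 : ∀ i, 0 ≤ hH.eigenvalues i) :
    (1 + H)⁻¹ = diagFun hH fun x => (1 + x)⁻¹ := by
  refine Matrix.inv_eq_right_inv ?_
  have h1 : 1 + H = diagFun hH fun x => 1 + x := by
    rw [diagFun_add hH (fun _ => 1) fun x => x, diagFun_one]
    congr 1
    exact (diagFun_id hH).symm
  rw [h1, ← diagFun_mul]
  have h2 : ∀ i, (1 + hH.eigenvalues i) * (1 + hH.eigenvalues i)⁻¹ = 1 := fun i =>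
    mul_inv_cancel₀ (by linarith [h0 i])
  simp [diagFun, h2]

theorem trace_inv_pow_eq_sum (hH : H.IsHermitian) (h0 : ∀ i, 0 ≤ hH.eigenvalues i) (j : ℕ) :
    ((1 + H)⁻¹ ^ j).trace = ((∑ i, ((1 + hH.eigenvalues i)⁻¹) ^ j : ℝ) : ℂ) := by
  rw [diagFun_inv hH h0, ← diagFun_pow, trace_diagFun]

end Spectral

open scoped ComplexOrder in
theorem hermitization_eigenvalues_nonneg {n : ℕ} (M : Matrix (Fin n) (Fin n) ℂ) (z : ℂ)
    (i : Fin n) : 0 ≤ (isHermitian_hermitization M z).eigenvalues i :=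
  (Matrix.posSemidef_self_mul_conjTranspose (shifted M z)).eigenvalues_nonneg i

/-- The average of a function over the eigenvalues of the hermitization. -/
def eigAverage {n : ℕ} (M : Matrix (Fin n) (Fin n) ℂ) (z : ℂ) (φ : ℝ → ℝ) : ℝ :=
  (1 / (n : ℝ)) * ∑ i, φ ((isHermitian_hermitization M z).eigenvalues i)

/-- The expected moments of the spectral measures converge to limits of at most exponential growth
that depend on `z` only. -/
theorem exists_tendsto_moments (z : ℂ) : ∃ (D : ℝ) (m : ℕ → ℝ), 0 < D ∧ (∀ k, |m k| ≤ D ^ k) ∧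
    ∀ (Ω : Type u) [MeasurableSpace Ω] (P : Measure Ω)
      [IsProbabilityMeasure P] (A : (n : ℕ) → Ω → Matrix (Fin n) (Fin n) ℂ)
      (ν : (n : ℕ) → Measure (Fin n → ℂ)), RowModel P A ν → ∀ k : ℕ,
      (∀ n, Integrable (fun ω => eigAverage (A n ω) z fun x => x ^ k) P) ∧
      Tendsto (fun n : ℕ => ∫ ω, eigAverage (A n ω) z (fun x => x ^ k) ∂P) atTop (𝓝 (m k)) := by
  choose L hL h using fun k : ℕ =>
    exists_tendsto_mixedMoment.{u} z (List.replicate k [true, false]).flatten []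
  refine ⟨((1 + ‖z‖) * 2) ^ 2, fun k => (L k).re, by positivity, fun k => ?_,
    fun Ω _ P _ A ν hA k => ?_⟩
  · refine (Complex.abs_re_le_norm _).trans ((hL k).trans (le_of_eq ?_))
    have : (List.replicate k [true, false]).flatten.length = 2 * k := by simp [mul_comm]
    rw [this, List.length_nil, zero_add, ← mul_pow, pow_mul]
  · obtain ⟨hi, ht⟩ := h k Ω P A ν hA
    have heq : ∀ n ω, (([].map (scaledLetter (A n ω))).prod *
        ((List.replicate k [true, false]).flatten.map
          (starMatrix (shifted (A n ω) z))).prod).trace =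
        ((∑ i, (isHermitian_hermitization (A n ω) z).eigenvalues i ^ k : ℝ) : ℂ) := by
      intro n ω
      rw [← hermitization_pow, List.map_nil, List.prod_nil, one_mul,
        trace_pow_eq_sum (isHermitian_hermitization (A n ω) z)]
    simp only [mixedMoment, heq] at hi ht
    constructor
    · intro n
      have := (hi n).re
      simp only [RCLike.re_eq_complex_re, Complex.ofReal_re] at this
      exact this.const_mul _
    · refine ((Complex.continuous_re.tendsto _).comp ht).congr fun n => ?_
      simp only [Function.comp_apply, eigAverage]
      rw [integral_complex_ofReal, integral_const_mul, ← Complex.ofReal_natCast,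
        ← Complex.ofReal_one, ← Complex.ofReal_div, ← Complex.ofReal_mul, Complex.ofReal_re]

end RowDependent

end

/-! ### McDiarmid's inequality for independent coordinates -/

noncomputable section

namespace RowDependent

section McDiarmid

variable {E : Type*} [MeasurableSpace E]

/-- **McDiarmid's inequality** in the form of a bound on the moment generating function. -/
theorem integral_exp_le_of_bounded_differences (ν : Measure E) [IsProbabilityMeasure ν] {c : ℝ}
    (hc : 0 ≤ c) (t : ℝ) (n : ℕ) (f : (Fin n → E) → ℝ) (hf : Measurable f) (B : ℝ)
    (hB : ∀ x, |f x| ≤ B) (hd : ∀ x i y, |f (Function.update x i y) - f x| ≤ c) :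
    ∫ x, Real.exp (t * (f x - ∫ y, f y ∂(Measure.pi fun _ => ν))) ∂(Measure.pi fun _ => ν) ≤
      Real.exp (n * (c ^ 2 * t ^ 2 / 2)) := by
  induction n with
  | zero =>
    have h : ∀ x, f x = f default := fun x => congrArg f (Subsingleton.elim _ _)
    simp [h]
  | succ n ih =>
    set μ := Measure.pi fun _ : Fin n => ν with hμ
    set μ' := Measure.pi fun _ : Fin (n + 1) => ν with hμ'
    have hmp := measurePreserving_piFinSuccAbove (fun _ : Fin (n + 1) => ν) 0
    let e := MeasurableEquiv.piFinSuccAbove (fun _ : Fin (n + 1) => E) 0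
    have hint : ∀ g : (Fin (n + 1) → E) → ℝ,
        ∫ x, g x ∂μ' = ∫ p, g (e.symm p) ∂(ν.prod μ) := fun g =>
      ((MeasurePreserving.symm e hmp).integral_comp e.symm.measurableEmbedding g).symm
    let F : E × (Fin n → E) → ℝ := fun p => f (e.symm p)
    have hFm : Measurable F := hf.comp e.symm.measurable
    have hFb : ∀ p, |F p| ≤ B := fun p => hB _
    have he : ∀ a x, e.symm (a, x) = (Fin.cons a x : Fin (n + 1) → E) := fun a x => by
      simp [e, MeasurableEquiv.piFinSuccAbove]
      rfl
    have hB0 : 0 ≤ B := (abs_nonneg _).trans (hB (e.symm ((Measure.nonempty_of_neZero ν).some,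
      fun _ => (Measure.nonempty_of_neZero ν).some)))
    have hFi : ∀ x, Integrable (fun a => F (a, x)) ν := fun x =>
      Integrable.of_bound (hFm.comp (measurable_id.prodMk measurable_const)).aestronglyMeasurable B
        (Eventually.of_forall fun a => hFb _)
    have hFi2 : Integrable F (ν.prod μ) :=
      Integrable.of_bound hFm.aestronglyMeasurable B (Eventually.of_forall fun a => hFb _)
    -- Integrating out the first coordinate preserves the bounded differences, so the induction
    -- hypothesis handles `G`; Hoeffding's lemma handles `F (·, x) - G x`.
    let G : (Fin n → E) → ℝ := fun x => ∫ a, F (a, x) ∂ν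
    have hGm : Measurable G := (hFm.stronglyMeasurable.integral_prod_left').measurable
    have hGb : ∀ x, |G x| ≤ B := fun x => by
      have := norm_integral_le_of_norm_le_const (μ := ν) (f := fun a => F (a, x)) (C := B)
        (Eventually.of_forall fun a => hFb _)
      simpa using this
    have hGd : ∀ x i y, |G (Function.update x i y) - G x| ≤ c := fun x i y => by
      have h1 : G (Function.update x i y) - G x =
          ∫ a, (F (a, Function.update x i y) - F (a, x)) ∂ν := (integral_sub (hFi _) (hFi _)).symm
      rw [h1]
      have := norm_integral_le_of_norm_le_const (μ := ν)
        (f := fun a => F (a, Function.update x i y) - F (a, x)) (C := c)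
        (Eventually.of_forall fun a => by
          simp only [F, he, Real.norm_eq_abs]
          rw [Fin.cons_update]
          exact hd _ _ _)
      simpa using this
    have hm : ∫ x, f x ∂μ' = ∫ x, G x ∂μ := by
      rw [hint f, integral_prod_symm _ hFi2]
    set m := ∫ x, G x ∂μ with hmdef
    have hexpb : ∀ r : ℝ, |r| ≤ 2 * B → Real.exp (t * r) ≤ Real.exp (|t| * (2 * B)) := by
      intro r hr
      refine Real.exp_le_exp.2 ((le_abs_self _).trans ?_)
      rw [abs_mul]
      gcongr
    have hmb : |m| ≤ B := by
      have := norm_integral_le_of_norm_le_const (μ := μ) (f := G) (C := B)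
        (Eventually.of_forall fun a => hGb _)
      simpa using this
    have hEi : Integrable (fun p => Real.exp (t * (F p - m))) (ν.prod μ) := by
      refine Integrable.of_bound (Real.measurable_exp.comp
        ((hFm.sub_const m).const_mul t)).aestronglyMeasurable (Real.exp (|t| * (2 * B)))
        (Eventually.of_forall fun p => ?_)
      rw [Real.norm_of_nonneg (Real.exp_pos _).le]
      refine hexpb _ ((abs_sub _ _).trans ?_)
      linarith [hFb p]
    have hGi : Integrable (fun x => Real.exp (t * (G x - m))) μ := by
      refine Integrable.of_bound (Real.measurable_exp.comp
        ((hGm.sub_const m).const_mul t)).aestronglyMeasurable (Real.exp (|t| * (2 * B)))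
        (Eventually.of_forall fun x => ?_)
      rw [Real.norm_of_nonneg (Real.exp_pos _).le]
      refine hexpb _ ((abs_sub _ _).trans ?_)
      linarith [hGb x]
    have hinner : ∀ x, ∫ a, Real.exp (t * (F (a, x) - m)) ∂ν ≤
        Real.exp (t * (G x - m)) * Real.exp (c ^ 2 * t ^ 2 / 2) := by
      intro x
      have hne := (Measure.nonempty_of_neZero ν)
      obtain ⟨a₀⟩ := hne
      -- Changing the first coordinate moves `F` by at most `c`, so all values lie within `c` of the
      -- one at an arbitrary `a₀`. The resulting parameter `c ^ 2` is not sharp but suffices.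
      have hsub := hasSubgaussianMGF_of_mem_Icc (μ := ν) (X := fun a => F (a, x))
        (a := F (a₀, x) - c) (b := F (a₀, x) + c)
        (hFm.comp (measurable_id.prodMk measurable_const)).aemeasurable
        (Eventually.of_forall fun a => by
          have h1 := hd (Fin.cons a₀ x : Fin (n + 1) → E) 0 a
          rw [Fin.update_cons_zero] at h1
          simp only [F, he]
          rw [abs_le] at h1
          constructor <;> linarith [h1.1, h1.2])
      have h2 := hsub.mgf_le t
      have hpar : (((‖F (a₀, x) + c - (F (a₀, x) - c)‖₊ / 2) ^ 2 : NNReal) : ℝ) = c ^ 2 := by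
        push_cast
        rw [show F (a₀, x) + c - (F (a₀, x) - c) = 2 * c by ring, Real.norm_of_nonneg (by positivity)]
        ring
      rw [hpar] at h2
      have h3 : ∀ a, Real.exp (t * (F (a, x) - m)) =
          Real.exp (t * (G x - m)) * Real.exp (t * (F (a, x) - G x)) := fun a => by
        rw [← Real.exp_add]
        ring_nf
      simp only [h3]
      rw [integral_const_mul]
      exact mul_le_mul_of_nonneg_left h2 (Real.exp_pos _).le
    rw [hm, hint]
    have hswap : ∫ p, Real.exp (t * (f (e.symm p) - m)) ∂(ν.prod μ) =
        ∫ x, ∫ a, Real.exp (t * (F (a, x) - m)) ∂ν ∂μ := integral_prod_symm _ hEi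
    rw [hswap]
    calc ∫ x, ∫ a, Real.exp (t * (F (a, x) - m)) ∂ν ∂μ
        ≤ ∫ x, Real.exp (t * (G x - m)) * Real.exp (c ^ 2 * t ^ 2 / 2) ∂μ :=
          integral_mono hEi.integral_prod_right (hGi.mul_const _) hinner
      _ ≤ Real.exp (n * (c ^ 2 * t ^ 2 / 2)) * Real.exp (c ^ 2 * t ^ 2 / 2) := by
          rw [integral_mul_const]
          exact mul_le_mul_of_nonneg_right (ih G hGm hGb hGd) (Real.exp_pos _).le
      _ = Real.exp ((n + 1 : ℕ) * (c ^ 2 * t ^ 2 / 2)) := by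
          rw [← Real.exp_add]
          push_cast
          ring_nf

/-- **McDiarmid's inequality**. -/
theorem measureReal_abs_sub_integral_ge_le (ν : Measure E) [IsProbabilityMeasure ν] {c : ℝ}
    (hc : 0 ≤ c) (n : ℕ) (f : (Fin n → E) → ℝ) (hf : Measurable f) (B : ℝ)
    (hB : ∀ x, |f x| ≤ B) (hd : ∀ x i y, |f (Function.update x i y) - f x| ≤ c) {ε : ℝ}
    (hε : 0 ≤ ε) :
    (Measure.pi fun _ => ν).real {x | ε ≤ |f x - ∫ y, f y ∂(Measure.pi fun _ => ν)|} ≤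
      2 * Real.exp (-ε ^ 2 / (2 * (n * c ^ 2))) := by
  have key : ∀ g : (Fin n → E) → ℝ, Measurable g → (∀ x, |g x| ≤ B) →
      (∀ x i y, |g (Function.update x i y) - g x| ≤ c) →
      (Measure.pi fun _ => ν).real {x | ε ≤ g x - ∫ y, g y ∂(Measure.pi fun _ => ν)} ≤
        Real.exp (-ε ^ 2 / (2 * (n * c ^ 2))) := by
    intro g hg hgB hgd
    have hsub : HasSubgaussianMGF (fun x => g x - ∫ y, g y ∂(Measure.pi fun _ => ν))
        ⟨n * c ^ 2, by positivity⟩ (Measure.pi fun _ => ν) := by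
      refine ⟨fun t => ?_, fun t => ?_⟩
      · refine integrable_exp_mul_of_mem_Icc (a := -B - ∫ y, g y ∂(Measure.pi fun _ => ν))
          (b := B - ∫ y, g y ∂(Measure.pi fun _ => ν)) (hg.sub_const _).aemeasurable
          (Eventually.of_forall fun x => ?_)
        have := abs_le.1 (hgB x)
        constructor <;> linarith [this.1, this.2]
      · refine (integral_exp_le_of_bounded_differences ν hc t n g hg B hgB hgd).trans
          (le_of_eq ?_)
        change _ = Real.exp (n * c ^ 2 * t ^ 2 / 2)
        ring_nf
    exact hsub.measure_ge_le hε
  have h1 := key f hf hB hd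
  have h2 := key (fun x => -f x) hf.neg (fun x => by rw [abs_neg]; exact hB x) (fun x i y => by
    rw [neg_sub_neg, abs_sub_comm]
    exact hd x i y)
  have hset : {x | ε ≤ |f x - ∫ y, f y ∂(Measure.pi fun _ => ν)|} ⊆
      {x | ε ≤ f x - ∫ y, f y ∂(Measure.pi fun _ => ν)} ∪
        {x | ε ≤ -f x - ∫ y, -f y ∂(Measure.pi fun _ => ν)} := by
    intro x hx
    rw [Set.mem_ofPred_eq, le_abs] at hx
    rcases hx with hx | hx
    · exact Or.inl hx
    · right
      rw [Set.mem_ofPred_eq, integral_neg]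
      linarith
  calc _ ≤ _ := measureReal_mono hset
    _ ≤ _ := measureReal_union_le _ _
    _ ≤ _ := by linarith

end McDiarmid

end RowDependent

end

/-! ### Replacing one row: traces of powers of the resolvent -/

noncomputable section

namespace RowDependent

section RankOne

variable {n : ℕ}

/-- The squared Euclidean norm of a vector. -/
def normSqVec (x : Fin n → ℂ) : ℝ := ∑ i, ‖x i‖ ^ 2

theorem normSqVec_nonneg (x : Fin n → ℂ) : 0 ≤ normSqVec x :=
  Finset.sum_nonneg fun i _ => by positivity

theorem star_dotProduct_self (x : Fin n → ℂ) : star x ⬝ᵥ x = (normSqVec x : ℂ) := by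
  simp only [dotProduct, normSqVec, Pi.star_apply, RCLike.star_def]
  push_cast
  refine Finset.sum_congr rfl fun i _ => ?_
  rw [mul_comm, Complex.mul_conj, Complex.normSq_eq_norm_sq]
  push_cast
  rfl

theorem norm_star_dotProduct_le (x y : Fin n → ℂ) :
    ‖star x ⬝ᵥ y‖ ≤ (normSqVec x + normSqVec y) / 2 := by
  rw [normSqVec, normSqVec, ← Finset.sum_add_distrib, Finset.sum_div]
  refine norm_sum_le_of_le _ fun i _ => ?_
  rw [norm_mul, Pi.star_apply, norm_star]
  nlinarith [sq_nonneg (‖x i‖ - ‖y i‖)]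

/-- The resolvent `(1 + C^* C)⁻¹`. -/
def gramInv (C : Matrix (Fin n) (Fin n) ℂ) : Matrix (Fin n) (Fin n) ℂ := (1 + Cᴴ * C)⁻¹

open scoped ComplexOrder in
theorem isUnit_one_add_gram (C : Matrix (Fin n) (Fin n) ℂ) : IsUnit (1 + Cᴴ * C) :=
  (Matrix.PosDef.one.add_posSemidef (Matrix.posSemidef_conjTranspose_mul_self C)).isUnit

theorem gramInv_mul (C : Matrix (Fin n) (Fin n) ℂ) : gramInv C * (1 + Cᴴ * C) = 1 :=
  Matrix.nonsing_inv_mul _ ((Matrix.isUnit_iff_isUnit_det _).1 (isUnit_one_add_gram C))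

theorem mul_gramInv (C : Matrix (Fin n) (Fin n) ℂ) : (1 + Cᴴ * C) * gramInv C = 1 :=
  Matrix.mul_nonsing_inv _ ((Matrix.isUnit_iff_isUnit_det _).1 (isUnit_one_add_gram C))

theorem conjTranspose_gramInv (C : Matrix (Fin n) (Fin n) ℂ) : (gramInv C)ᴴ = gramInv C := by
  rw [gramInv, Matrix.conjTranspose_nonsing_inv]
  simp [Matrix.conjTranspose_mul]

theorem star_dotProduct_gram (C : Matrix (Fin n) (Fin n) ℂ) (y : Fin n → ℂ) :
    star ((1 + Cᴴ * C) *ᵥ y) ⬝ᵥ y = ((normSqVec y + normSqVec (C *ᵥ y) : ℝ) : ℂ) := by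
  have h : star ((Cᴴ * C) *ᵥ y) ⬝ᵥ y = star (C *ᵥ y) ⬝ᵥ (C *ᵥ y) := by
    rw [← Matrix.mulVec_mulVec, Matrix.star_mulVec, Matrix.conjTranspose_conjTranspose,
      ← Matrix.dotProduct_mulVec]
  rw [Matrix.add_mulVec, Matrix.one_mulVec, star_add, add_dotProduct, h, star_dotProduct_self,
    star_dotProduct_self]
  push_cast
  rfl

/-- With `y = gramInv C *ᵥ x`, pairing `x` with `y` gives `|y|² + |C y|²`, which is at most `(|x|² +
|y|²) / 2`. -/
theorem normSqVec_gramInv_mulVec_le (C : Matrix (Fin n) (Fin n) ℂ) (x : Fin n → ℂ) :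
    normSqVec (gramInv C *ᵥ x) ≤ normSqVec x := by
  set y := gramInv C *ᵥ x with hy
  have hx : x = (1 + Cᴴ * C) *ᵥ y := by
    rw [hy, Matrix.mulVec_mulVec, mul_gramInv, Matrix.one_mulVec]
  have h1 := star_dotProduct_gram C y
  rw [← hx] at h1
  have h2 := norm_star_dotProduct_le x y
  rw [h1, Complex.norm_real, Real.norm_of_nonneg
    (add_nonneg (normSqVec_nonneg _) (normSqVec_nonneg _))] at h2
  linarith [normSqVec_nonneg (C *ᵥ y)]

theorem normSqVec_gramInv_pow_mulVec_le (C : Matrix (Fin n) (Fin n) ℂ) (x : Fin n → ℂ) (j : ℕ) :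
    normSqVec (gramInv C ^ j *ᵥ x) ≤ normSqVec x := by
  induction j with
  | zero => simp
  | succ j ih =>
    rw [pow_succ', ← Matrix.mulVec_mulVec]
    exact (normSqVec_gramInv_mulVec_le C _).trans ih

theorem gram_eq_updateRow (B : Matrix (Fin n) (Fin n) ℂ) (i : Fin n) :
    Bᴴ * B = (B.updateRow i 0)ᴴ * B.updateRow i 0 + Matrix.vecMulVec (star (B i)) (B i) := by
  ext a b
  simp only [Matrix.mul_apply, Matrix.add_apply, Matrix.vecMulVec_apply,
    Matrix.conjTranspose_apply, Pi.star_apply]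
  rw [← Finset.add_sum_erase _ _ (Finset.mem_univ i),
    ← Finset.add_sum_erase _ (fun x => star (B.updateRow i 0 x a) * B.updateRow i 0 x b)
      (Finset.mem_univ i)]
  rw [Finset.sum_congr rfl (g := fun x => star (B x a) * B x b) (s₂ := Finset.univ.erase i)
    (f := fun x => star (B.updateRow i 0 x a) * B.updateRow i 0 x b)]
  · simp [add_comm]
  · intro x hx
    rw [Matrix.updateRow_ne (Finset.ne_of_mem_erase hx)]

/-- The Sherman–Morrison formula for the resolvent of a matrix with one row set to zero. -/
theorem exists_gramInv_sub_eq (B : Matrix (Fin n) (Fin n) ℂ) (i : Fin n) :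
    ∃ (y : Fin n → ℂ) (s : ℝ), 1 ≤ s ∧ normSqVec y ≤ s ∧
      gramInv B - gramInv (B.updateRow i 0) =
        -((s⁻¹ : ℝ) : ℂ) • Matrix.vecMulVec y (star y) := by
  set C := B.updateRow i 0 with hC
  set u := star (B i) with hu
  set y := gramInv C *ᵥ u with hy
  -- This is the Sherman–Morrison denominator `1 + u^* y`, in a form that shows `1 ≤ s` and
  -- `normSqVec y ≤ s`.
  set s : ℝ := 1 + (normSqVec y + normSqVec (C *ᵥ y)) with hs
  have hs1 : 1 ≤ s := by
    rw [hs]; linarith [normSqVec_nonneg y, normSqVec_nonneg (C *ᵥ y)]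
  refine ⟨y, s, hs1, by rw [hs]; linarith [normSqVec_nonneg (C *ᵥ y)], ?_⟩
  have hs0 : (s : ℂ) ≠ 0 := by
    exact_mod_cast (by linarith : s ≠ 0)
  have huy : u = (1 + Cᴴ * C) *ᵥ y := by
    rw [hy, Matrix.mulVec_mulVec, mul_gramInv, Matrix.one_mulVec]
  have hdot : star u ⬝ᵥ y = (s : ℂ) - 1 := by
    have := star_dotProduct_gram C y
    rw [← huy] at this
    rw [this, hs]
    push_cast
    ring
  have hstary : star u ᵥ* gramInv C = star y := by
    rw [hy, Matrix.star_mulVec, conjTranspose_gramInv]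
  have hBi : B i = star u := by rw [hu, star_star]
  have hinv : gramInv B = gramInv C + -((s⁻¹ : ℝ) : ℂ) • Matrix.vecMulVec y (star y) := by
    refine Matrix.inv_eq_right_inv ?_
    rw [gram_eq_updateRow B i, ← hC, ← hu, hBi, ← add_assoc, add_mul, mul_add, mul_gramInv,
      mul_smul_comm, Matrix.mul_vecMulVec, ← huy, mul_add, Matrix.vecMulVec_mul, hstary,
      mul_smul_comm, Matrix.vecMulVec_mul_vecMulVec, hdot, Matrix.vecMulVec_smul, smul_smul]
    have h1 : -((s⁻¹ : ℝ) : ℂ) * ((s : ℂ) - 1) = -1 - -((s⁻¹ : ℝ) : ℂ) := by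
      push_cast
      field_simp
      ring
    rw [h1, sub_smul, neg_one_smul]
    abel
  rw [hinv, add_sub_cancel_left]

/-- The difference of powers telescopes. By the rank one formula the trace of `R ^ j * (R - S) * S ^
b` is `-s⁻¹` times `y^* S ^ b R ^ j y`, which is at most one in modulus because `R` and `S` are
contractions and `|y|² ≤ s`. The spare power `b` makes the induction close. -/
theorem norm_trace_gramInv_pow_sub_le (B : Matrix (Fin n) (Fin n) ℂ) (i : Fin n) (j : ℕ) :
    ∀ b : ℕ, ‖((gramInv B ^ j - gramInv (B.updateRow i 0) ^ j) *
      gramInv (B.updateRow i 0) ^ b).trace‖ ≤ j := by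
  induction j with
  | zero => simp
  | succ j ih =>
    intro b
    set R := gramInv B
    set S := gramInv (B.updateRow i 0) with hS
    have hsplit : (R ^ (j + 1) - S ^ (j + 1)) * S ^ b =
        R ^ j * (R - S) * S ^ b + (R ^ j - S ^ j) * S ^ (b + 1) := by
      rw [pow_succ R, pow_succ S, pow_succ' S b]
      noncomm_ring
    rw [hsplit, Matrix.trace_add]
    refine (norm_add_le _ _).trans ?_
    have h1 : ‖(R ^ j * (R - S) * S ^ b).trace‖ ≤ 1 := by
      obtain ⟨y, s, hs1, hys, hRS⟩ := exists_gramInv_sub_eq B i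
      have hRS' : R - S = -((s⁻¹ : ℝ) : ℂ) • Matrix.vecMulVec y (star y) := hRS
      rw [Matrix.trace_mul_cycle, hRS', mul_smul_comm, Matrix.mul_vecMulVec, Matrix.trace_smul, Matrix.trace_vecMulVec,
        ← Matrix.mulVec_mulVec, smul_eq_mul, norm_mul, norm_neg, Complex.norm_real,
        Real.norm_of_nonneg (by positivity), dotProduct_comm]
      have h2 := norm_star_dotProduct_le y (S ^ b *ᵥ R ^ j *ᵥ y)
      have h3 := (normSqVec_gramInv_pow_mulVec_le (B.updateRow i 0) (R ^ j *ᵥ y) b).trans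
        (normSqVec_gramInv_pow_mulVec_le B y j)
      rw [inv_mul_le_iff₀ (by linarith)]
      linarith
    have h4 := ih (b + 1)
    push_cast
    linarith

/-- Both matrices are compared with the one whose row `i` is zero, each at the cost of `j`. -/
theorem norm_trace_gramInv_pow_updateRow_le (B : Matrix (Fin n) (Fin n) ℂ) (i : Fin n)
    (r : Fin n → ℂ) (j : ℕ) :
    ‖(gramInv (B.updateRow i r) ^ j).trace - (gramInv B ^ j).trace‖ ≤ 2 * j := by
  have h1 := norm_trace_gramInv_pow_sub_le B i j 0
  have h2 := norm_trace_gramInv_pow_sub_le (B.updateRow i r) i j 0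
  have h3 : (B.updateRow i r).updateRow i 0 = B.updateRow i 0 := by
    simp
  rw [h3] at h2
  rw [pow_zero, mul_one, Matrix.trace_sub] at h1 h2
  calc _ = ‖((gramInv (B.updateRow i r) ^ j).trace - (gramInv (B.updateRow i 0) ^ j).trace) -
        ((gramInv B ^ j).trace - (gramInv (B.updateRow i 0) ^ j).trace)‖ := by ring_nf
    _ ≤ _ := norm_sub_le _ _
    _ ≤ _ := by linarith

/-- A row of `B` enters `Bᴴ * B` as a rank one summand, but the hermitization is of the form `B *
Bᴴ`; this identity passes between them. Both resolvents are intertwined by `B`, and the recursion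
`hstep` together with cyclicity of the trace gives equality for all powers. -/
theorem trace_gramInv_conjTranspose_pow (B : Matrix (Fin n) (Fin n) ℂ) (j : ℕ) :
    (gramInv Bᴴ ^ j).trace = (gramInv B ^ j).trace := by
  have hcomm : gramInv Bᴴ * B = B * gramInv B := by
    have h1 : (1 + Bᴴᴴ * Bᴴ) * B = B * (1 + Bᴴ * B) := by
      rw [Matrix.conjTranspose_conjTranspose]
      noncomm_ring
    calc gramInv Bᴴ * B = gramInv Bᴴ * (B * (1 + Bᴴ * B)) * gramInv B := by
          rw [mul_assoc, mul_assoc, mul_gramInv, mul_one]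
      _ = gramInv Bᴴ * (1 + Bᴴᴴ * Bᴴ) * B * gramInv B := by
          rw [← h1]; simp only [mul_assoc]
      _ = _ := by rw [gramInv_mul, one_mul]
  have hpow : ∀ j, gramInv Bᴴ ^ j * B = B * gramInv B ^ j := by
    intro j
    induction j with
    | zero => simp
    | succ j ih => rw [pow_succ, mul_assoc, hcomm, ← mul_assoc, ih, mul_assoc, ← pow_succ]
  have hstep : ∀ C : Matrix (Fin n) (Fin n) ℂ, ∀ j, gramInv C ^ (j + 1) =
      gramInv C ^ j - gramInv C ^ (j + 1) * (Cᴴ * C) := by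
    intro C j
    rw [eq_sub_iff_add_eq]
    conv_rhs => rw [← mul_one (gramInv C ^ j), ← gramInv_mul C, ← mul_assoc, ← pow_succ]
    rw [mul_add, mul_one]
  induction j with
  | zero => simp
  | succ j ih =>
    have h1 : (gramInv Bᴴ ^ (j + 1) * (B * Bᴴ)).trace =
        (gramInv B ^ (j + 1) * (Bᴴ * B)).trace := by
      rw [← mul_assoc, hpow, Matrix.trace_mul_comm, ← mul_assoc, Matrix.trace_mul_comm]
    rw [hstep Bᴴ j, hstep B j, Matrix.trace_sub, Matrix.trace_sub, ih,
      Matrix.conjTranspose_conjTranspose, h1]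

end RankOne

/-- The test functions for the concentration of the spectral measures. -/
def resolventFun (j : ℕ) (x : ℝ) : ℝ := ((1 + x)⁻¹) ^ j

/-! ### Concentration of resolvent averages -/

section Concentration

variable {n : ℕ}

theorem eigAverage_resolventFun (M : Matrix (Fin n) (Fin n) ℂ) (z : ℂ) (j : ℕ) :
    ((eigAverage M z (resolventFun j) : ℝ) : ℂ) =
      (1 / (n : ℂ)) * (gramInv (shifted M z) ^ j).trace := by
  have h := trace_inv_pow_eq_sum (isHermitian_hermitization M z)
    (hermitization_eigenvalues_nonneg M z) j
  have h2 : (1 + hermitization M z)⁻¹ = gramInv (shifted M z)ᴴ := by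
    rw [gramInv, Matrix.conjTranspose_conjTranspose]
    rfl
  rw [h2, trace_gramInv_conjTranspose_pow] at h
  rw [h, eigAverage]
  simp only [resolventFun]
  push_cast
  rfl

theorem shifted_updateRow (M : Matrix (Fin n) (Fin n) ℂ) (z : ℂ) (i : Fin n) (r : Fin n → ℂ) :
    ∃ r', shifted (M.updateRow i r) z = (shifted M z).updateRow i r' := by
  refine ⟨shifted (M.updateRow i r) z i, ?_⟩
  ext a b
  rcases eq_or_ne a i with rfl | ha
  · rw [Matrix.updateRow_self]
  · rw [Matrix.updateRow_ne ha]
    simp [shifted, Matrix.updateRow_ne ha]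

/-- The factor `j + 1` instead of `j` keeps the bound positive for `j = 0`, so that the exponent
obtained from it by division is negative. -/
theorem abs_eigAverage_resolventFun_update_sub_le (M : Matrix (Fin n) (Fin n) ℂ) (z : ℂ) (j : ℕ)
    (i : Fin n) (r : Fin n → ℂ) :
    |eigAverage (M.updateRow i r) z (resolventFun j) - eigAverage M z (resolventFun j)| ≤
      2 * (j + 1) / n := by
  obtain ⟨r', hr'⟩ := shifted_updateRow M z i r
  rw [← Real.norm_eq_abs, ← Complex.norm_real]
  push_cast
  rw [eigAverage_resolventFun, eigAverage_resolventFun, hr', ← mul_sub, norm_mul, norm_div,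
    norm_one, Complex.norm_natCast, div_mul_eq_mul_div, one_mul]
  gcongr
  have := norm_trace_gramInv_pow_updateRow_le (shifted M z) i r' j
  linarith

theorem resolventFun_mem_Icc (j : ℕ) {x : ℝ} (hx : 0 ≤ x) :
    0 ≤ resolventFun j x ∧ resolventFun j x ≤ 1 := by
  have h1 : 0 ≤ (1 + x)⁻¹ := by positivity
  have h2 : (1 + x)⁻¹ ≤ 1 := inv_le_one_of_one_le₀ (by linarith)
  exact ⟨pow_nonneg h1 j, pow_le_one₀ h1 h2⟩

theorem abs_eigAverage_le (M : Matrix (Fin n) (Fin n) ℂ) (z : ℂ) {φ : ℝ → ℝ} {B : ℝ} (hB0 : 0 ≤ B)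
    (hφ : ∀ x, 0 ≤ x → |φ x| ≤ B) : |eigAverage M z φ| ≤ B := by
  rw [eigAverage, abs_mul, abs_of_nonneg (by positivity : (0 : ℝ) ≤ 1 / n)]
  rcases Nat.eq_zero_or_pos n with rfl | hn
  · simpa using hB0
  have h1 : |∑ i, φ ((isHermitian_hermitization M z).eigenvalues i)| ≤ ∑ _i : Fin n, B :=
    (Finset.abs_sum_le_sum_abs _ _).trans (Finset.sum_le_sum fun i _ =>
      hφ _ (hermitization_eigenvalues_nonneg M z i))
  rw [Finset.sum_const, Finset.card_univ, Fintype.card_fin, nsmul_eq_mul] at h1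
  have hpos : 0 < (n : ℝ) := by positivity
  rw [div_mul_eq_mul_div, one_mul, div_le_iff₀ hpos]
  linarith

/-- Cramer's rule expresses the trace through a determinant and an adjugate, which are continuous in
the entries; measurability of the individual eigenvalues is not needed. -/
theorem measurable_eigAverage_resolventFun (n : ℕ) (z : ℂ) (j : ℕ) :
    Measurable fun x : Fin n → Fin n → ℂ => eigAverage (Matrix.of x) z (resolventFun j) := by
  have hS : Continuous fun x : Fin n → Fin n → ℂ => shifted (Matrix.of x) z := by
    unfold shifted
    have : Continuous fun x : Fin n → Fin n → ℂ => (Matrix.of x) := continuous_id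
    fun_prop
  have hK : Continuous fun x : Fin n → Fin n → ℂ =>
      1 + (shifted (Matrix.of x) z)ᴴ * shifted (Matrix.of x) z := by
    fun_prop
  have heq : ∀ x : Fin n → Fin n → ℂ, eigAverage (Matrix.of x) z (resolventFun j) =
      ((1 / (n : ℂ)) * (((1 + (shifted (Matrix.of x) z)ᴴ * shifted (Matrix.of x) z).det⁻¹) ^ j *
        ((1 + (shifted (Matrix.of x) z)ᴴ * shifted (Matrix.of x) z).adjugate ^ j).trace)).re := by
    intro x
    rw [← Complex.ofReal_re (eigAverage (Matrix.of x) z (resolventFun j)),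
      eigAverage_resolventFun, gramInv, Matrix.inv_def, smul_pow, Matrix.trace_smul, smul_eq_mul,
      Ring.inverse_eq_inv']
  simp only [heq]
  have h1 : Measurable fun x : Fin n → Fin n → ℂ =>
      (1 + (shifted (Matrix.of x) z)ᴴ * shifted (Matrix.of x) z).det⁻¹ :=
    (hK.matrix_det).measurable.inv
  have h2 : Measurable fun x : Fin n → Fin n → ℂ =>
      ((1 + (shifted (Matrix.of x) z)ᴴ * shifted (Matrix.of x) z).adjugate ^ j).trace :=
    ((hK.matrix_adjugate.pow j).matrix_trace).measurable
  exact Complex.measurable_re.comp (((h1.pow_const j).mul h2).const_mul _)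

end Concentration

variable {Ω : Type*} [MeasurableSpace Ω] {P : Measure Ω}
  {A : (n : ℕ) → Ω → Matrix (Fin n) (Fin n) ℂ} {ν : (n : ℕ) → Measure (Fin n → ℂ)}

theorem RowModel.aemeasurable_eigAverage_resolventFun (h : RowModel P A ν) (n : ℕ) (z : ℂ)
    (j : ℕ) : AEMeasurable (fun ω => eigAverage (A n ω) z (resolventFun j)) P :=
  (measurable_eigAverage_resolventFun n z j).comp_aemeasurable (h.iid n).aemeasurable

variable [IsProbabilityMeasure P]

theorem RowModel.measureReal_eigAverage_le (h : RowModel P A ν) {n : ℕ} (hn : 0 < n) (z : ℂ)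
    (j : ℕ) {ε : ℝ} (hε : 0 ≤ ε) :
    P.real {ω | ε ≤ |eigAverage (A n ω) z (resolventFun j) -
      ∫ ω, eigAverage (A n ω) z (resolventFun j) ∂P|} ≤
      2 * Real.exp (n * (-ε ^ 2 / (8 * (j + 1) ^ 2))) := by
  have : IsProbabilityMeasure (ν n) := by
    rw [← ((h.iid n).hasLaw ⟨0, hn⟩).map_eq]
    exact Measure.isProbabilityMeasure_map ((h.iid n).hasLaw ⟨0, hn⟩).aemeasurable
  have hm := measurable_eigAverage_resolventFun n z j
  have hc : (0 : ℝ) ≤ 2 * (j + 1) / n := by positivity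
  have key := measureReal_abs_sub_integral_ge_le (ν n) hc n _ hm 1
    (fun x => abs_eigAverage_le _ z zero_le_one fun x hx => by
      have := resolventFun_mem_Icc j hx
      rw [abs_of_nonneg this.1]
      exact this.2)
    (fun x i y => abs_eigAverage_resolventFun_update_sub_le (Matrix.of x) z j i y) hε
  rw [← (h.iid n).map_eq, integral_map (h.iid n).aemeasurable hm.aestronglyMeasurable,
    map_measureReal_apply_of_aemeasurable (h.iid n).aemeasurable
      (measurableSet_le measurable_const (hm.sub_const _).abs)] at key
  refine key.trans (le_of_eq ?_)
  have hn' : (n : ℝ) ≠ 0 := by positivity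
  congr 2
  field_simp
  ring

/-- The exponential bounds are summable in `n`, so Borel–Cantelli applies whatever the joint law of
the matrices of different sizes is. -/
theorem RowModel.ae_tendsto_eigAverage_sub (h : RowModel P A ν) (z : ℂ) :
    ∀ᵐ ω ∂P, ∀ j : ℕ, Tendsto (fun n => eigAverage (A n ω) z (resolventFun j) -
      ∫ ω, eigAverage (A n ω) z (resolventFun j) ∂P) atTop (𝓝 0) := by
  rw [ae_all_iff]
  intro j
  have hk : ∀ᵐ ω ∂P, ∀ k : ℕ, ∀ᶠ n in atTop, ω ∉ {ω | 1 / ((k : ℝ) + 1) ≤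
      |eigAverage (A n ω) z (resolventFun j) - ∫ ω, eigAverage (A n ω) z (resolventFun j) ∂P|} := by
    rw [ae_all_iff]
    intro k
    refine ae_eventually_notMem ?_
    have hε : (0 : ℝ) < 1 / ((k : ℝ) + 1) := by positivity
    have hsum : Summable fun n : ℕ =>
        2 * Real.exp (n * (-(1 / ((k : ℝ) + 1)) ^ 2 / (8 * ((j : ℝ) + 1) ^ 2))) := by
      refine (Real.summable_exp_nat_mul_iff.2 ?_).mul_left 2
      rw [neg_div]
      exact neg_neg_of_pos (by positivity)
    have hle : ∀ n : ℕ, P {ω | 1 / ((k : ℝ) + 1) ≤ |eigAverage (A n ω) z (resolventFun j) -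
        ∫ ω, eigAverage (A n ω) z (resolventFun j) ∂P|} ≤ ENNReal.ofReal
        (2 * Real.exp (n * (-(1 / ((k : ℝ) + 1)) ^ 2 / (8 * ((j : ℝ) + 1) ^ 2)))) := by
      intro n
      rcases Nat.eq_zero_or_pos n with rfl | hn
      · refine prob_le_one.trans ?_
        rw [← ENNReal.ofReal_one]
        exact ENNReal.ofReal_le_ofReal (by simp)
      · rw [← ofReal_measureReal]
        exact ENNReal.ofReal_le_ofReal (h.measureReal_eigAverage_le hn z j hε.le)
    exact ne_top_of_le_ne_top hsum.tsum_ofReal_ne_top (ENNReal.tsum_le_tsum hle)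
  filter_upwards [hk] with ω hω
  rw [Metric.tendsto_nhds]
  intro ε hε
  obtain ⟨k, hkε⟩ := exists_nat_one_div_lt hε
  filter_upwards [hω k] with n hn
  rw [Real.dist_0_eq_abs]
  simp only [not_le] at hn
  exact hn.trans hkε

end RowDependent

end

/-! ### From moments to bounded test functions -/

noncomputable section

namespace RowDependent

section EigAverage

variable {n : ℕ} (M : Matrix (Fin n) (Fin n) ℂ) (z : ℂ)

theorem eigAverage_sum {ι : Type*} (s : Finset ι) (c : ι → ℝ) (φ : ι → ℝ → ℝ) :
    eigAverage M z (fun x => ∑ k ∈ s, c k * φ k x) = ∑ k ∈ s, c k * eigAverage M z (φ k) := by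
  simp only [eigAverage]
  rw [Finset.sum_comm, Finset.mul_sum]
  refine Finset.sum_congr rfl fun k _ => ?_
  rw [← Finset.mul_sum]
  ring

theorem abs_eigAverage_sub_le {φ ψ : ℝ → ℝ} {ε C : ℝ} {χ : ℝ → ℝ} (hε : 0 ≤ ε)
    (h : ∀ x, 0 ≤ x → |φ x - ψ x| ≤ ε + C * χ x) :
    |eigAverage M z φ - eigAverage M z ψ| ≤ ε + C * eigAverage M z χ := by
  rcases Nat.eq_zero_or_pos n with rfl | hn
  · simpa [eigAverage] using hε
  have hn' : (0 : ℝ) < n := by exact_mod_cast hn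
  have h1 : |∑ i, (φ ((isHermitian_hermitization M z).eigenvalues i) -
      ψ ((isHermitian_hermitization M z).eigenvalues i))| ≤
      ∑ i, (ε + C * χ ((isHermitian_hermitization M z).eigenvalues i)) :=
    (Finset.abs_sum_le_sum_abs _ _).trans (Finset.sum_le_sum fun i _ =>
      h _ (hermitization_eigenvalues_nonneg M z i))
  rw [Finset.sum_add_distrib, Finset.sum_const, Finset.card_univ, Fintype.card_fin, nsmul_eq_mul,
    ← Finset.mul_sum, Finset.sum_sub_distrib] at h1
  simp only [eigAverage]
  rw [← mul_sub, abs_mul, abs_of_nonneg (by positivity : (0 : ℝ) ≤ 1 / n), one_div,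
    inv_mul_le_iff₀ hn']
  refine h1.trans (le_of_eq ?_)
  field_simp

end EigAverage

/-- On `[0, K]` this is Weierstrass approximation; beyond `K` the power `(x / K) ^ N` dominates both
`f` and `q`. Since `C` does not depend on `N`, one may fix `q` first and then let `N` grow. -/
theorem exists_polynomial_approx {f : ℝ → ℝ} (hf : ContinuousOn f (Set.Ici 0))
    (hf1 : ∀ x, 0 ≤ x → |f x| ≤ 1) {K ε : ℝ} (hK : 0 < K) (hε : 0 < ε) :
    ∃ (q : Polynomial ℝ) (C : ℝ), 0 ≤ C ∧ ∀ N, q.natDegree ≤ N → ∀ x, 0 ≤ x →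
      |f x - q.eval x| ≤ ε + C * (x / K) ^ N := by
  obtain ⟨q, hq⟩ := exists_polynomial_near_of_continuousOn 0 K f
    (hf.mono fun x hx => hx.1) ε hε
  have hC : 0 ≤ ∑ k ∈ Finset.range (q.natDegree + 1), |q.coeff k| * K ^ k :=
    Finset.sum_nonneg fun k _ => by positivity
  refine ⟨q, 1 + ∑ k ∈ Finset.range (q.natDegree + 1), |q.coeff k| * K ^ k, by positivity,
    fun N hN x hx => ?_⟩
  have hxK : 0 ≤ x / K := by positivity
  rcases le_or_gt x K with hle | hgt
  · rw [abs_sub_comm]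
    refine (hq x ⟨hx, hle⟩).le.trans (le_add_of_nonneg_right (by positivity))
  · have h1 : 1 ≤ x / K := (one_le_div hK).2 hgt.le
    have hqx : |q.eval x| ≤
        (∑ k ∈ Finset.range (q.natDegree + 1), |q.coeff k| * K ^ k) * (x / K) ^ N := by
      rw [Polynomial.eval_eq_sum_range, Finset.sum_mul]
      refine (Finset.abs_sum_le_sum_abs _ _).trans (Finset.sum_le_sum fun k hk => ?_)
      have hkN : k ≤ N := (Nat.lt_succ_iff.1 (Finset.mem_range.1 hk)).trans hN
      calc |q.coeff k * x ^ k| = |q.coeff k| * K ^ k * (x / K) ^ k := by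
            rw [abs_mul, abs_of_nonneg (pow_nonneg hx k), mul_assoc, ← mul_pow,
              mul_div_cancel₀ _ hK.ne']
        _ ≤ |q.coeff k| * K ^ k * (x / K) ^ N := by
            gcongr
    have h2 : (1 : ℝ) ≤ (x / K) ^ N := one_le_pow₀ h1
    have h3 := abs_sub (f x) (q.eval x)
    have h4 := hf1 x hx
    rw [add_mul, one_mul]
    linarith

/-- A class of real sequences that eventually cluster around common points at every scale has a
common limit. -/
theorem exists_common_limit {S : (ℕ → ℝ) → Prop}
    (h : ∀ ε > 0, ∃ a : ℝ, ∀ u, S u → ∀ᶠ n in atTop, |u n - a| ≤ ε) :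
    ∃ l : ℝ, ∀ u, S u → Tendsto u atTop (𝓝 l) := by
  by_cases hS : ∃ u, S u
  · obtain ⟨u₀, hu₀⟩ := hS
    have hc : CauchySeq u₀ := by
      refine Metric.cauchySeq_iff'.2 fun ε hε => ?_
      obtain ⟨a, ha⟩ := h (ε / 3) (by positivity)
      obtain ⟨N, hN⟩ := eventually_atTop.1 (ha u₀ hu₀)
      refine ⟨N, fun n hn => ?_⟩
      have h1 := abs_le.1 (hN n hn)
      have h2 := abs_le.1 (hN N le_rfl)
      rw [Real.dist_eq, abs_lt]
      constructor <;> linarith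
    obtain ⟨l, hl⟩ := cauchySeq_tendsto_of_complete hc
    refine ⟨l, fun u hu => Metric.tendsto_nhds.2 fun ε hε => ?_⟩
    obtain ⟨a, ha⟩ := h (ε / 3) (by positivity)
    have hla := abs_le.1 (le_of_tendsto (hl.sub_const a).abs (ha u₀ hu₀))
    filter_upwards [ha u hu] with n hn
    have h1 := abs_le.1 hn
    rw [Real.dist_eq, abs_lt]
    constructor <;> linarith
  · exact ⟨0, fun u hu => (hS ⟨u, hu⟩).elim⟩

/-- The functions `(x / (1 + x)) ^ j`, written as polynomials in `(1 + x)⁻¹`. -/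
def tailFun (j : ℕ) (x : ℝ) : ℝ := (1 - (1 + x)⁻¹) ^ j

theorem tailFun_mem_Icc (j : ℕ) {x : ℝ} (hx : 0 ≤ x) : 0 ≤ tailFun j x ∧ tailFun j x ≤ 1 := by
  have h1 : 0 ≤ (1 + x)⁻¹ := by positivity
  have h2 : (1 + x)⁻¹ ≤ 1 := inv_le_one_of_one_le₀ (by linarith)
  exact ⟨pow_nonneg (by linarith) j, pow_le_one₀ (by linarith) (by linarith)⟩

theorem continuousOn_tailFun (j : ℕ) : ContinuousOn (tailFun j) (Set.Ici 0) := by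
  unfold tailFun
  refine ContinuousOn.pow (continuousOn_const.sub (ContinuousOn.inv₀ (by fun_prop) ?_)) j
  intro x hx
  have : 0 ≤ x := hx
  positivity

theorem tailFun_mono (j : ℕ) {x y : ℝ} (hx : 0 ≤ x) (hxy : x ≤ y) : tailFun j x ≤ tailFun j y := by
  have h2 : (1 + x)⁻¹ ≤ 1 := inv_le_one_of_one_le₀ (by linarith)
  unfold tailFun
  gcongr

theorem tailFun_eq_sum (j : ℕ) (x : ℝ) : tailFun j x =
    ∑ k ∈ Finset.range (j + 1), ((-1) ^ k * (j.choose k : ℝ)) * resolventFun k x := by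
  rw [tailFun, sub_eq_neg_add, add_pow]
  refine Finset.sum_congr rfl fun k _ => ?_
  rw [resolventFun, neg_pow, one_pow]
  ring

theorem eigAverage_tailFun {n : ℕ} (M : Matrix (Fin n) (Fin n) ℂ) (z : ℂ) (j : ℕ) :
    eigAverage M z (tailFun j) = ∑ k ∈ Finset.range (j + 1),
      ((-1) ^ k * (j.choose k : ℝ)) * eigAverage M z (resolventFun k) := by
  rw [← eigAverage_sum]
  congr 1
  ext x
  exact tailFun_eq_sum j x

/-- Beyond `R` the linear term exceeds one. With this bound the first moment shows that no mass
escapes to infinity; `x ^ 1` fits the form of `abs_integral_eigAverage_sub_le`. -/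
theorem tailFun_le_add_div (j : ℕ) {R x : ℝ} (hR : 0 < R) (hx : 0 ≤ x) :
    tailFun j x ≤ tailFun j R + R⁻¹ * x ^ 1 := by
  rw [pow_one]
  rcases le_or_gt x R with h | h
  · exact (tailFun_mono j hx h).trans (le_add_of_nonneg_right (by positivity))
  · have h1 : 1 ≤ R⁻¹ * x := by
      rw [inv_mul_eq_div]
      exact (one_le_div hR).2 h.le
    linarith [(tailFun_mem_Icc j hx).2, (tailFun_mem_Icc j hR.le).1]

theorem tendsto_tailFun {R : ℝ} (hR : 0 < R) : Tendsto (fun j => tailFun j R) atTop (𝓝 0) := by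
  unfold tailFun
  have h1 : 0 < (1 + R)⁻¹ := by positivity
  have h2 : (1 + R)⁻¹ ≤ 1 := inv_le_one_of_one_le₀ (by linarith)
  exact tendsto_pow_atTop_nhds_zero_of_lt_one (by linarith) (by linarith)

section Model

variable {Ω : Type*} [MeasurableSpace Ω] {P : Measure Ω}
  {A : (n : ℕ) → Ω → Matrix (Fin n) (Fin n) ℂ} {ν : (n : ℕ) → Measure (Fin n → ℂ)}

variable [IsProbabilityMeasure P]

theorem RowModel.integrable_eigAverage_resolventFun (h : RowModel P A ν) (n : ℕ) (z : ℂ) (j : ℕ) :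
    Integrable (fun ω => eigAverage (A n ω) z (resolventFun j)) P :=
  Integrable.of_bound (h.aemeasurable_eigAverage_resolventFun n z j).aestronglyMeasurable 1
    (ae_of_all _ fun ω => abs_eigAverage_le _ z zero_le_one fun x hx => by
      have := resolventFun_mem_Icc j hx
      rw [abs_of_nonneg this.1]
      exact this.2)

theorem RowModel.integrable_eigAverage_tailFun (h : RowModel P A ν) (n : ℕ) (z : ℂ) (j : ℕ) :
    Integrable (fun ω => eigAverage (A n ω) z (tailFun j)) P := by
  simp only [eigAverage_tailFun]
  exact integrable_finsetSum _ fun k _ =>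
    (h.integrable_eigAverage_resolventFun n z k).const_mul _

theorem RowModel.ae_tendsto_eigAverage_tailFun_sub (h : RowModel P A ν) (z : ℂ) :
    ∀ᵐ ω ∂P, ∀ j : ℕ, Tendsto (fun n => eigAverage (A n ω) z (tailFun j) -
      ∫ ω, eigAverage (A n ω) z (tailFun j) ∂P) atTop (𝓝 0) := by
  filter_upwards [h.ae_tendsto_eigAverage_sub z] with ω hω j
  have h1 : Tendsto (fun n => ∑ k ∈ Finset.range (j + 1), ((-1) ^ k * (j.choose k : ℝ)) *
      (eigAverage (A n ω) z (resolventFun k) - ∫ ω, eigAverage (A n ω) z (resolventFun k) ∂P))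
      atTop (𝓝 (∑ k ∈ Finset.range (j + 1), ((-1) ^ k * (j.choose k : ℝ)) * 0)) :=
    tendsto_finsetSum _ fun k _ => (hω k).const_mul _
  simp only [mul_zero, Finset.sum_const_zero] at h1
  refine h1.congr fun n => ?_
  simp only [eigAverage_tailFun]
  rw [integral_finsetSum _ fun k _ =>
    (h.integrable_eigAverage_resolventFun n z k).const_mul _, ← Finset.sum_sub_distrib]
  refine Finset.sum_congr rfl fun k _ => ?_
  rw [integral_const_mul, mul_sub]

theorem abs_integral_eigAverage_sub_le {n : ℕ} {A : Ω → Matrix (Fin n) (Fin n) ℂ} {z : ℂ}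
    (hmom : ∀ k : ℕ, Integrable (fun ω => eigAverage (A ω) z fun x => x ^ k) P) {f : ℝ → ℝ}
    (hfi : Integrable (fun ω => eigAverage (A ω) z f) P) {q : Polynomial ℝ} {ε C : ℝ} {N : ℕ}
    (hε : 0 ≤ ε) (hq : ∀ x, 0 ≤ x → |f x - q.eval x| ≤ ε + C * x ^ N) :
    |∫ ω, eigAverage (A ω) z f ∂P - ∑ k ∈ Finset.range (q.natDegree + 1),
      q.coeff k * ∫ ω, eigAverage (A ω) z (fun x => x ^ k) ∂P| ≤
      ε + C * ∫ ω, eigAverage (A ω) z (fun x => x ^ N) ∂P := by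
  have hqi : ∀ k ∈ Finset.range (q.natDegree + 1),
      Integrable (fun ω => q.coeff k * eigAverage (A ω) z fun x => x ^ k) P :=
    fun k _ => (hmom k).const_mul _
  simp only [← integral_const_mul]
  rw [← integral_finsetSum _ hqi, ← integral_sub hfi (integrable_finsetSum _ hqi)]
  refine (abs_integral_le_integral_abs).trans ?_
  have h1 : ε + ∫ ω, C * eigAverage (A ω) z (fun x => x ^ N) ∂P =
      ∫ ω, (ε + C * eigAverage (A ω) z (fun x => x ^ N)) ∂P := by
    rw [integral_add (integrable_const _) ((hmom N).const_mul _)]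
    simp
  rw [h1]
  refine integral_mono (hfi.sub (integrable_finsetSum _ hqi)).abs
    ((integrable_const _).add ((hmom N).const_mul _)) fun ω => ?_
  have h2 := abs_eigAverage_sub_le (A ω) z (ψ := fun x => q.eval x) hε hq
  simp only [Polynomial.eval_eq_sum_range] at h2
  rwa [eigAverage_sum] at h2

end Model

universe u

/-- For `K = 2 * D` the error term `C * (x / K) ^ N` has limiting mean at most `C * 2 ^ (-N)`, so
the exponential growth bound lets the moments determine these limits. -/
theorem exists_tendsto_tailFun (z : ℂ) : ∃ τ : ℕ → ℝ, Tendsto τ atTop (𝓝 0) ∧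
    ∀ (Ω : Type u) [MeasurableSpace Ω] (P : Measure Ω)
      [IsProbabilityMeasure P] (A : (n : ℕ) → Ω → Matrix (Fin n) (Fin n) ℂ)
      (ν : (n : ℕ) → Measure (Fin n → ℂ)), RowModel P A ν → ∀ j : ℕ,
      Tendsto (fun n : ℕ => ∫ ω, eigAverage (A n ω) z (tailFun j) ∂P) atTop (𝓝 (τ j)) := by
  obtain ⟨D, m, hD, hm, H⟩ := exists_tendsto_moments.{u} z
  -- Sequences from all models are collected in one class, so that their limits are found and shown
  -- to agree at once.
  let S : ℕ → (ℕ → ℝ) → Prop := fun j v => ∃ (Ω : Type u) (_ : MeasurableSpace Ω) (P : Measure Ω)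
    (_ : IsProbabilityMeasure P) (A : (n : ℕ) → Ω → Matrix (Fin n) (Fin n) ℂ)
    (ν : (n : ℕ) → Measure (Fin n → ℂ)), RowModel P A ν ∧
    v = fun n : ℕ => ∫ ω, eigAverage (A n ω) z (tailFun j) ∂P
  have hS : ∀ j, ∃ l : ℝ, ∀ v, S j v → Tendsto v atTop (𝓝 l) := by
    intro j
    refine exists_common_limit fun ε hε => ?_
    obtain ⟨q, C, hC, hq⟩ := exists_polynomial_approx (continuousOn_tailFun j)
      (fun x hx => by
        rw [abs_of_nonneg (tailFun_mem_Icc j hx).1]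
        exact (tailFun_mem_Icc j hx).2) (K := 2 * D) (by positivity) (half_pos (half_pos hε))
    refine ⟨∑ k ∈ Finset.range (q.natDegree + 1), q.coeff k * m k, ?_⟩
    rintro v ⟨Ω, _, P, _, A, ν, hA, rfl⟩
    have hlim : Tendsto (fun N : ℕ => C * (1 / 2 : ℝ) ^ N) atTop (𝓝 0) := by
      simpa using (tendsto_pow_atTop_nhds_zero_of_lt_one (r := (1 / 2 : ℝ)) (by norm_num)
        (by norm_num)).const_mul C
    obtain ⟨N, hN1, hN2⟩ := ((hlim.eventually_lt_const (half_pos (half_pos hε))).and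
      (eventually_ge_atTop q.natDegree)).exists
    have hN3 : C / (2 * D) ^ N * m N < ε / 2 / 2 := by
      refine lt_of_le_of_lt ?_ hN1
      calc C / (2 * D) ^ N * m N ≤ C / (2 * D) ^ N * D ^ N := by
            gcongr
            exact (le_abs_self _).trans (hm N)
        _ = C * (1 / 2) ^ N := by
            rw [mul_pow, div_pow, one_pow]
            field_simp
    have h1 := (((H Ω P A ν hA N).2).const_mul (C / (2 * D) ^ N)).eventually_lt_const hN3
    have h2 : Tendsto (fun n => ∑ k ∈ Finset.range (q.natDegree + 1),
        q.coeff k * ∫ ω, eigAverage (A n ω) z (fun x => x ^ k) ∂P) atTop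
        (𝓝 (∑ k ∈ Finset.range (q.natDegree + 1), q.coeff k * m k)) :=
      tendsto_finsetSum _ fun k _ => ((H Ω P A ν hA k).2).const_mul _
    filter_upwards [h1, Metric.tendsto_nhds.1 h2 (ε / 2) (half_pos hε)] with n hn1 hn2
    have h3 := abs_integral_eigAverage_sub_le (fun k => (H Ω P A ν hA k).1 n)
      (hA.integrable_eigAverage_tailFun n z j) (half_pos (half_pos hε)).le
      (q := q) (C := C / (2 * D) ^ N) (N := N) fun x hx => by
        have := hq N hN2 x hx
        rwa [div_pow, mul_div_left_comm, mul_comm (x ^ N)] at this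
    rw [Real.dist_eq] at hn2
    refine (abs_sub_le _ _ _).trans (add_le_add h3 hn2.le |>.trans ?_)
    linarith
  -- That `τ` vanishes at infinity is read off from one model; without any model the choice of `τ`
  -- is free.
  by_cases hne : ∃ (Ω : Type u) (_ : MeasurableSpace Ω) (P : Measure Ω)
    (_ : IsProbabilityMeasure P) (A : (n : ℕ) → Ω → Matrix (Fin n) (Fin n) ℂ)
    (ν : (n : ℕ) → Measure (Fin n → ℂ)), RowModel P A ν
  · choose τ hτ using hS
    refine ⟨τ, ?_, fun Ω _ P _ A ν hA j => hτ j _ ⟨Ω, _, P, ‹_›, A, ν, hA, rfl⟩⟩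
    obtain ⟨Ω, _, P, _, A, ν, hA⟩ := hne
    have hl := fun j => hτ j _ ⟨Ω, _, P, ‹_›, A, ν, hA, rfl⟩
    have h0 : ∀ j, 0 ≤ τ j := fun j => ge_of_tendsto' (hl j) fun n =>
      integral_nonneg fun ω => by
        unfold eigAverage
        exact mul_nonneg (by positivity) (Finset.sum_nonneg fun i _ =>
          (tailFun_mem_Icc j (hermitization_eigenvalues_nonneg _ z i)).1)
    have h1 : ∀ j (R : ℝ), 0 < R → τ j ≤ tailFun j R + R⁻¹ * m 1 := by
      intro j R hR
      refine le_of_tendsto_of_tendsto' (hl j)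
        ((((H Ω P A ν hA 1).2).const_mul R⁻¹).const_add (tailFun j R)) fun n => ?_
      have h3 := abs_integral_eigAverage_sub_le (fun k => (H Ω P A ν hA k).1 n)
        (hA.integrable_eigAverage_tailFun n z j) (tailFun_mem_Icc j hR.le).1
        (q := 0) (C := R⁻¹) (N := 1) fun x hx => by
          rw [Polynomial.eval_zero, sub_zero, abs_of_nonneg (tailFun_mem_Icc j hx).1]
          exact tailFun_le_add_div j hR hx
      simp only [Polynomial.coeff_zero, zero_mul, Finset.sum_const_zero, sub_zero] at h3
      exact (le_abs_self _).trans h3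
    rw [Metric.tendsto_nhds]
    intro ε hε
    -- This `R` makes the bound `D / R` from the first moment equal to `ε / 2`.
    have hR : (0 : ℝ) < 2 * D / ε := by positivity
    filter_upwards [(tendsto_tailFun hR).eventually_lt_const (half_pos hε)] with j hj
    rw [Real.dist_0_eq_abs, abs_of_nonneg (h0 j)]
    have h2 := h1 j _ hR
    have h3 : (2 * D / ε)⁻¹ * m 1 ≤ ε / 2 := by
      calc (2 * D / ε)⁻¹ * m 1 ≤ (2 * D / ε)⁻¹ * D := by
            gcongr
            simpa using (le_abs_self _).trans (hm 1)
        _ = ε / 2 := by field_simp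
    linarith
  · exact ⟨0, tendsto_const_nhds, fun Ω _ P _ A ν hA =>
      (hne ⟨Ω, _, P, ‹_›, A, ν, hA⟩).elim⟩

end RowDependent

end

/-! ### Weak convergence on the half line -/

noncomputable section

namespace RowDependent

section Weak

open scoped NNReal ENNReal BoundedContinuousFunction

/-- The function `x / (1 + x)` on `[0, ∞)`. -/
def tailMap : ℝ≥0 →ᵇ ℝ :=
  BoundedContinuousFunction.ofNormedAddCommGroup (fun x : ℝ≥0 => tailFun 1 x)
    ((continuousOn_tailFun 1).comp_continuous NNReal.continuous_coe fun x => x.coe_nonneg) 1 fun x => by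
      have := tailFun_mem_Icc 1 x.coe_nonneg
      rw [Real.norm_eq_abs, abs_of_nonneg this.1]
      exact this.2

theorem tailMap_pow_apply (j : ℕ) (x : ℝ≥0) : (tailMap ^ j) x = tailFun j x := by
  rw [BoundedContinuousFunction.coe_pow, Pi.pow_apply]
  simp [tailMap, tailFun]

theorem integrable_tailFun (ρ : ProbabilityMeasure ℝ≥0) (j : ℕ) :
    Integrable (fun x : ℝ≥0 => tailFun j x) (ρ : Measure ℝ≥0) :=
  ((tailMap ^ j).integrable (ρ : Measure ℝ≥0)).congr (ae_of_all _ (tailMap_pow_apply j))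

theorem tailMap_injective : Function.Injective tailMap := by
  intro x y hxy
  have h : 1 - (1 + (x : ℝ))⁻¹ = 1 - (1 + (y : ℝ))⁻¹ := by
    simpa [tailMap, tailFun] using hxy
  have h2 : (1 + (x : ℝ)) = 1 + y := inv_injective (by linarith)
  exact NNReal.coe_injective (by linarith)

/-- Choose `j` with `τ j < ε / 2`, then `R` beyond which `tailFun j` is at least `1 / 2`. Markov's
inequality bounds the mass beyond `R` by `ε` for all large `n`, and the finitely many other measures
are tight one by one. -/
theorem isTightMeasureSet_of_tendsto_tailFun {ρ : ℕ → ProbabilityMeasure ℝ≥0} {τ : ℕ → ℝ}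
    (hτ : Tendsto τ atTop (𝓝 0))
    (h : ∀ j, Tendsto (fun n => ∫ x : ℝ≥0, tailFun j x ∂(ρ n)) atTop (𝓝 (τ j))) :
    IsTightMeasureSet {(ρ n : Measure ℝ≥0) | n} := by
  rw [isTightMeasureSet_iff_exists_isCompact_measure_compl_le]
  intro ε hε
  by_cases hεt : ε = ∞
  · exact ⟨∅, isCompact_empty, by simp [hεt]⟩
  have hε' : 0 < ε.toReal := ENNReal.toReal_pos hε.ne' hεt
  obtain ⟨j, hj⟩ := (hτ.eventually_lt_const (half_pos hε')).exists
  obtain ⟨N, hN⟩ := eventually_atTop.1 ((h j).eventually_lt_const hj)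
  obtain ⟨R, hR⟩ : ∃ R : ℝ≥0, 1 / 2 ≤ tailFun j R := by
    have h1 : Tendsto (fun R : ℝ => tailFun j R) atTop (𝓝 ((1 - 0) ^ j)) :=
      (tendsto_const_nhds.sub
        (tendsto_inv_atTop_zero.comp (tendsto_const_nhds.add_atTop tendsto_id))).pow j
    rw [sub_zero, one_pow] at h1
    obtain ⟨R, hR1, hR2⟩ := ((h1.eventually_const_lt (by norm_num : (1 / 2 : ℝ) < 1)).and
      (eventually_gt_atTop 0)).exists
    exact ⟨⟨R, hR2.le⟩, hR1.le⟩
  have htail : ∀ n, N ≤ n → (ρ n : Measure ℝ≥0) (Set.Icc 0 R)ᶜ ≤ ε := by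
    intro n hn
    have h1 := mul_meas_ge_le_integral_of_nonneg (μ := (ρ n : Measure ℝ≥0))
      (ae_of_all _ fun x : ℝ≥0 => (tailFun_mem_Icc j x.coe_nonneg).1) (integrable_tailFun (ρ n) j) (1 / 2)
    have h2 : (Set.Icc 0 R)ᶜ ⊆ {x : ℝ≥0 | 1 / 2 ≤ tailFun j x} := by
      intro x hx
      have hx' : R < x := by simpa using hx
      exact hR.trans (tailFun_mono j R.coe_nonneg (NNReal.coe_le_coe.2 hx'.le))
    have h3 := measureReal_mono (μ := (ρ n : Measure ℝ≥0)) h2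
    rw [← ENNReal.ofReal_toReal hεt, ← ofReal_measureReal]
    refine ENNReal.ofReal_le_ofReal ?_
    have h4 := hN n hn
    linarith
  have hsingle : ∀ n, ∃ K : Set ℝ≥0, IsCompact K ∧ (ρ n : Measure ℝ≥0) Kᶜ ≤ ε := by
    intro n
    obtain ⟨K, hK, hK2⟩ := isTightMeasureSet_iff_exists_isCompact_measure_compl_le.1
      (isTightMeasureSet_singleton (μ := (ρ n : Measure ℝ≥0))) ε hε
    exact ⟨K, hK, hK2 _ rfl⟩
  choose K hK hKε using hsingle
  refine ⟨Set.Icc 0 R ∪ ⋃ n ∈ Finset.range N, K n,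
    isCompact_Icc.union ((Finset.range N).isCompact_biUnion fun n _ => hK n), ?_⟩
  rintro _ ⟨n, rfl⟩
  rcases le_or_gt N n with hn | hn
  · exact (measure_mono (Set.compl_subset_compl.2 Set.subset_union_left)).trans (htail n hn)
  · refine (measure_mono (Set.compl_subset_compl.2 ?_)).trans (hKε n)
    exact Set.subset_union_of_subset_right
      (Set.subset_biUnion_of_mem (u := K) (Finset.mem_coe.2 (Finset.mem_range.2 hn))) _

/-- By Prokhorov's theorem there is a limit along an ultrafilter, and bounded continuous functions
pass to it. -/
theorem exists_integral_tailFun_eq {ρ : ℕ → ProbabilityMeasure ℝ≥0} {τ : ℕ → ℝ}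
    (hτ : Tendsto τ atTop (𝓝 0))
    (h : ∀ j, Tendsto (fun n => ∫ x : ℝ≥0, tailFun j x ∂(ρ n)) atTop (𝓝 (τ j))) :
    ∃ μ : ProbabilityMeasure ℝ≥0, ∀ j, ∫ x : ℝ≥0, tailFun j x ∂μ = τ j := by
  have hc : IsCompact (closure {ρ n | n}) := isCompact_closure_of_isTightMeasureSet
    (by simpa using isTightMeasureSet_of_tendsto_tailFun hτ h)
  obtain ⟨μ, -, hμ⟩ := hc.ultrafilter_le_nhds ((hyperfilter ℕ).map ρ)
    (.trans (by simp) (monotone_principal subset_closure))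
  have hμ' : Tendsto ρ (hyperfilter ℕ) (𝓝 μ) := hμ
  rw [ProbabilityMeasure.tendsto_iff_forall_integral_tendsto] at hμ'
  refine ⟨μ, fun j => tendsto_nhds_unique ?_ ((h j).mono_left Nat.hyperfilter_le_atTop)⟩
  simpa only [tailMap_pow_apply] using hμ' (tailMap ^ j)

/-- `tailMap` is injective on `ℝ≥0`, so the polynomials in it form an algebra that separates points.
For tight sequences convergence on such an algebra is weak convergence. -/
theorem tendsto_of_tendsto_integral_tailFun {ρ : ℕ → ProbabilityMeasure ℝ≥0}
    {μ : ProbabilityMeasure ℝ≥0} (hτ : Tendsto (fun j => ∫ x : ℝ≥0, tailFun j x ∂μ) atTop (𝓝 0))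
    (h : ∀ j, Tendsto (fun n => ∫ x : ℝ≥0, tailFun j x ∂(ρ n)) atTop
      (𝓝 (∫ x : ℝ≥0, tailFun j x ∂μ))) : Tendsto ρ atTop (𝓝 μ) := by
  refine ProbabilityMeasure.tendsto_of_tight_of_separatesPoints ℝ
    (isTightMeasureSet_of_tendsto_tailFun hτ h) (A := StarAlgebra.adjoin ℝ {tailMap}) ?_ ?_
  · intro x y hxy
    refine ⟨tailMap, ⟨BoundedContinuousFunction.toContinuousMapStarₐ ℝ tailMap,
      ⟨tailMap, StarAlgebra.self_mem_adjoin_singleton ℝ tailMap, rfl⟩, rfl⟩, ?_⟩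
    exact tailMap_injective.ne hxy
  · intro g hg
    have hg' : g ∈ Algebra.adjoin ℝ ({tailMap} : Set (ℝ≥0 →ᵇ ℝ)) := by
      have h1 : star ({tailMap} : Set (ℝ≥0 →ᵇ ℝ)) = {tailMap} := by
        rw [Set.star_singleton]
        congr 1
      have h2 := StarAlgebra.adjoin_toSubalgebra ℝ ({tailMap} : Set (ℝ≥0 →ᵇ ℝ))
      rw [h1, Set.union_self] at h2
      rw [← h2]
      exact hg
    rw [Algebra.adjoin_singleton_eq_range_aeval] at hg'
    obtain ⟨q, rfl⟩ := hg'
    have hq : ∀ ρ : ProbabilityMeasure ℝ≥0, ∫ x, (Polynomial.aeval tailMap q) x ∂ρ =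
        ∑ k ∈ Finset.range (q.natDegree + 1), q.coeff k * ∫ x : ℝ≥0, tailFun k x ∂ρ := by
      intro ρ
      simp only [← integral_const_mul]
      rw [← integral_finsetSum _ fun k _ => (integrable_tailFun ρ k).const_mul _]
      refine integral_congr_ae (ae_of_all _ fun x => ?_)
      simp [Polynomial.aeval_eq_sum_range, ← tailMap_pow_apply]
    refine (tendsto_congr fun n => hq _).2 ?_
    refine Eq.subst (motive := fun c => Tendsto _ atTop (𝓝 c)) (hq μ).symm ?_
    exact tendsto_finsetSum _ fun k _ => (h k).const_mul _

end Weak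

open scoped NNReal

/-- The spectral measure of the Hermitization of a matrix of positive size, as a probability
measure on `[0, ∞)`. -/
def singularMeasure {n : ℕ} (M : Matrix (Fin (n + 1)) (Fin (n + 1)) ℂ) (z : ℂ) :
    ProbabilityMeasure ℝ≥0 :=
  ⟨((n + 1 : ℕ) : ℝ≥0)⁻¹ •
    ∑ i, Measure.dirac ((isHermitian_hermitization M z).eigenvalues i).toNNReal, ⟨by
      rw [Measure.smul_apply, Measure.finsetSum_apply]
      simp only [measure_univ, Finset.sum_const, Finset.card_univ, Fintype.card_fin,
        nsmul_eq_mul, mul_one]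
      rw [ENNReal.smul_def, smul_eq_mul, ENNReal.coe_inv (by positivity), ENNReal.coe_natCast]
      exact ENNReal.inv_mul_cancel (by simp) (ENNReal.natCast_ne_top _)⟩⟩

theorem integral_singularMeasure {n : ℕ} (M : Matrix (Fin (n + 1)) (Fin (n + 1)) ℂ) (z : ℂ)
    (g : ℝ → ℝ) : ∫ x : ℝ≥0, g x ∂(singularMeasure M z) = eigAverage M z g := by
  rw [singularMeasure, ProbabilityMeasure.coe_mk, integral_smul_nnreal_measure,
    integral_finsetSum_measure fun i _ => integrable_dirac (by simp)]
  simp only [integral_dirac, eigAverage, NNReal.smul_def, smul_eq_mul]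
  simp only [Real.coe_toNNReal _ (hermitization_eigenvalues_nonneg M z _)]
  simp

theorem integral_spectralMeasure {n : ℕ} (M : Matrix (Fin n) (Fin n) ℂ) (z : ℂ) (g : ℝ → ℝ) :
    ∫ x, g x ∂(spectralMeasure (isHermitian_hermitization M z) : Measure ℝ) =
      eigAverage M z g := by
  have h : (spectralMeasure (isHermitian_hermitization M z) : Measure ℝ) = (n : ℝ≥0)⁻¹ •
      ∑ i, Measure.dirac ((isHermitian_hermitization M z).eigenvalues i) := by
    rw [spectralMeasure, FiniteMeasure.toMeasure_smul, FiniteMeasure.toMeasure_sum]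
    rfl
  rw [h, integral_smul_nnreal_measure,
    integral_finsetSum_measure fun i _ => integrable_dirac (by simp)]
  simp [eigAverage, NNReal.smul_def]

universe u

/-- One realization of one model yields a measure with the integrals `τ`. As `τ` is common to all
models, it is the limit for each of them. -/
theorem exists_tendsto_singularMeasure (z : ℂ) : ∃ μ : ProbabilityMeasure ℝ≥0,
    ∀ (Ω : Type u) [MeasurableSpace Ω] (P : Measure Ω)
      [IsProbabilityMeasure P] (A : (n : ℕ) → Ω → Matrix (Fin n) (Fin n) ℂ)
      (ν : (n : ℕ) → Measure (Fin n → ℂ)), RowModel P A ν →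
      ∀ᵐ ω ∂P, Tendsto (fun n => singularMeasure (A (n + 1) ω) z) atTop (𝓝 μ) := by
  obtain ⟨τ, hτ, H⟩ := exists_tendsto_tailFun.{u} z
  have hlim : ∀ (Ω : Type u) [MeasurableSpace Ω] (P : Measure Ω)
      [IsProbabilityMeasure P] (A : (n : ℕ) → Ω → Matrix (Fin n) (Fin n) ℂ)
      (ν : (n : ℕ) → Measure (Fin n → ℂ)), RowModel P A ν → ∀ᵐ ω ∂P, ∀ j, Tendsto
        (fun n => ∫ x : ℝ≥0, tailFun j x ∂(singularMeasure (A (n + 1) ω) z)) atTop (𝓝 (τ j)) := by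
    intro Ω _ P _ A ν hA
    filter_upwards [hA.ae_tendsto_eigAverage_tailFun_sub z] with ω hω j
    simp only [integral_singularMeasure]
    have h1 := (hω j).add (H Ω P A ν hA j)
    simp only [sub_add_cancel, zero_add] at h1
    exact h1.comp (tendsto_add_atTop_nat 1)
  by_cases hne : ∃ (Ω : Type u) (_ : MeasurableSpace Ω) (P : Measure Ω)
    (_ : IsProbabilityMeasure P) (A : (n : ℕ) → Ω → Matrix (Fin n) (Fin n) ℂ)
    (ν : (n : ℕ) → Measure (Fin n → ℂ)), RowModel P A ν
  · have hμ : ∃ μ : ProbabilityMeasure ℝ≥0, ∀ j, ∫ x : ℝ≥0, tailFun j x ∂μ = τ j := by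
      obtain ⟨Ω, _, P, _, A, ν, hA⟩ := hne
      obtain ⟨ω, hω⟩ := (hlim Ω P A ν hA).exists
      exact exists_integral_tailFun_eq hτ hω
    obtain ⟨μ, hμ⟩ := hμ
    refine ⟨μ, fun Ω _ P _ A ν hA => ?_⟩
    filter_upwards [hlim Ω P A ν hA] with ω hω
    refine tendsto_of_tendsto_integral_tailFun ?_ ?_
    · simpa only [hμ] using hτ
    · simpa only [hμ] using hω
  · exact ⟨diracProba 0, fun Ω _ P _ A ν hA => (hne ⟨Ω, _, P, ‹_›, A, ν, hA⟩).elim⟩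

theorem tendsto_spectralMeasure {A : (n : ℕ) → Matrix (Fin n) (Fin n) ℂ} {z : ℂ}
    {μ : ProbabilityMeasure ℝ≥0}
    (h : Tendsto (fun n => singularMeasure (A (n + 1)) z) atTop (𝓝 μ)) :
    Tendsto (fun n => spectralMeasure (isHermitian_hermitization (A n) z)) atTop
      (𝓝 (μ.map NNReal.continuous_coe.measurable.aemeasurable).toFiniteMeasure) := by
  -- In size zero the spectral measure is the zero measure, so only positive sizes are compared with
  -- probability measures.
  rw [← tendsto_add_atTop_iff_nat 1, FiniteMeasure.tendsto_iff_forall_integral_tendsto]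
  intro g
  rw [ProbabilityMeasure.tendsto_iff_forall_integral_tendsto] at h
  have h1 := h (g.compContinuous ⟨_, NNReal.continuous_coe⟩)
  simp only [BoundedContinuousFunction.compContinuous_apply, ContinuousMap.coe_mk,
    integral_singularMeasure] at h1
  simp only [integral_spectralMeasure]
  convert h1 using 2
  exact integral_map NNReal.continuous_coe.measurable.aemeasurable
    g.continuous.aestronglyMeasurable

end RowDependent

end

theorem mainTheorem3 :
    ∃ μ : ℂ → ProbabilityMeasure ℝ,
      ∀ (Ω : Type*) [MeasurableSpace Ω] (P : Measure Ω) [IsProbabilityMeasure P]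
        (A : (n : ℕ) → Ω → Matrix (Fin n) (Fin n) ℂ)
        (ν : (n : ℕ) → Measure (Fin n → ℂ)),
        (∀ n, RowDependent.HasIIDRows (A n) (ν n) P) →
        RowDependent.AssumptionA1 P A →
        RowDependent.AssumptionA2 P A →
        RowDependent.AssumptionA3 P A →
        ∀ z : ℂ, ∀ᵐ ω ∂P,
          Tendsto
            (fun n => RowDependent.spectralMeasure
              (RowDependent.isHermitian_hermitization (A n ω) z))
            atTop (𝓝 (μ z).toFiniteMeasure) := by
  choose μ hμ using RowDependent.exists_tendsto_singularMeasure
  refine ⟨fun z => (μ z).map NNReal.continuous_coe.measurable.aemeasurable, ?_⟩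
  intro Ω _ P _ A ν hiid h1 h2 h3 z
  filter_upwards [hμ z Ω P A ν ⟨hiid, h1, h2, h3⟩] with ω hω
  exact RowDependent.tendsto_spectralMeasure (A := fun n => A n ω) hω
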